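/- **Setting.** Let $n\ge 1$ and let $\Omega\subset\mathbb{R}^n$ be a bounded, connected (non-empty) open set with Lipschitz boundary, $s\in(0,1)$, $\alpha=1-2s$ and $\mathcal{C}=\Omega\times(0,\infty)$, with points $(x,y)$. Let $H^1(y^\alpha,\mathcal{C})$ be the space of functions which together with their weak gradient belong to $L^2(y^\alpha,\mathcal{C})$ (the $L^2$ space for the measure $y^\alpha\,dx\,dy$), with norm $\big(\|w\|_{L^2(y^\alpha,\mathcal{C})}^2+\|\nabla w\|_{L^2(y^\alpha,\mathcal{C})}^2\big)^{1/2}$, and let $\mathring H^1_L(y^\alpha,\mathcal{C})$ be its closed subspace of functions vanishing on the lateral boundary $\partial\Omega\times[0,\infty)$, i.e. the closure of $C_c^\infty(\Omega\times\mathbb{R})|_{\mathcal{C}}$. Let $\operatorname{tr} w\in L^2(\Omega)$ denote the trace of $w\in\mathring H^1_L(y^\alpha,\mathcal{C})$ on $\Omega\times\{0\}$. Let $\mathcal{L}u=-\operatorname{div}(A\nabla u)+cu$ with homogeneous Dirichlet conditions on $\partial\Omega$, where $A$ is measurable, symmetric, bounded and uniformly elliptic and $0\le c\in L^\infty(\Omega)$;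 let $(\varphi_k)$ be a complete $L^2(\Omega)$-orthonormal system of eigenfunctions of $\mathcal{L}$ with eigenvalues $\lambda_k$, and let $\mathbb{H}^s(\Omega)=\{u\in L^2(\Omega):\sum_k\lambda_k^s\,(u,\varphi_k)_{L^2(\Omega)}^2<\infty\}$. Let $\Psi$ map each $u\in\mathbb{H}^s(\Omega)$ to a measurable function $\Psi(u):\Omega\to\mathbb{R}$ such that * if $u_1,u_2\in\mathbb{H}^s(\Omega)$ and $0\le u_1\le u_2$ a.e., then $0\le\Psi(u_1)\le\Psi(u_2)$ a.e. in $\Omega$; * there is a constant $\nu>0$ with $\Psi(u)\ge\nu$ a.e. in $\Omega$ for all $u\in\mathbb{H}^s(\Omega)$; * if $u_n,u^*\in\mathbb{H}^s(\Omega)$ and $u_n\to u^*$ in $L^p(\Omega)$ for all $1<p<\infty$, then $\Psi(u_n)\to\Psi(u^*)$ in $L^\infty(\Omega)$. For $w\in\mathring H^1_L(y^\alpha,\mathcal{C})$ and $\tau\in(0,\infty)$ put $$\mathcal{K}(w)=\{v\in\mathring H^1_L(y^\alpha,\mathcal{C}):\operatorname{tr}v\le\Psi(\operatorname{tr}w)\text{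 a.e. in }\Omega\},\qquad \mathcal{K}^\tau(w)=\{v\in\mathcal{K}(w):v\le 0\text{ a.e. in }\Omega\times(\tau,\infty)\},$$ and $\mathcal{K}^{\infty}(w)=\mathcal{K}(w)$. Non-empty closed convex subsets $\mathcal{K}_n$ of a reflexive Banach space $X$ converge in the sense of Mosco to a non-empty closed convex subset $\mathcal{K}$ of $X$ if (i) for each $v\in\mathcal{K}$ there are $v_n\in\mathcal{K}_n$ with $v_n\to v$ in $X$, and (ii) whenever $v_n\in\mathcal{K}_n$ for all $n$ and $v_n\rightharpoonup v$ in $X$ along a subsequence, then $v\in\mathcal{K}$. **Lemma.** Let $(v_n)$ be a bounded sequence in $\mathring H^1_L(y^\alpha,\mathcal{C})$ such that $0\le v_n\le v_{n+1}\le Y^*$ a.e. in $\mathcal{C}$ for all $n$, for some $Y^*\in\mathring H^1_L(y^\alpha,\mathcal{C})$ with $\operatorname{tr}Y^*\in L^\infty(\Omega)$. Let $\tau^*\in(0,\infty]$ and let $(\tau_n)$ be a sequence in $(0,\infty)$ with $\tau_n\to\tau^*$. Then there is $v^*\in\mathring H^1_L(y^\alpha,\mathcal{C})$ such that $v_n\rightharpoonup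 v^*$ weakly in $\mathring H^1_L(y^\alpha,\mathcal{C})$, $v_n\uparrow v^*$ pointwise a.e. in $\mathcal{C}$, and, as $n\to\infty$, $$\mathcal{K}^{\tau^*}(v_n)\to\mathcal{K}^{\tau^*}(v^*)\qquad\text{and}\qquad\mathcal{K}^{\tau_n}(v_n)\to\mathcal{K}^{\tau^*}(v^*),$$ both in the sense of Mosco in $\mathring H^1_L(y^\alpha,\mathcal{C})$ (in particular, all these sets are non-empty, closed and convex). -/

import Mathlib

open MeasureTheory Filter Topology Set
open scoped ENNReal NNReal ContDiff

/-! ### Domains and test functions -/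

/-- Euclidean space `ℝⁿ`. -/
abbrev Eucl (n : ℕ) : Type := EuclideanSpace ℝ (Fin n)

/-- `φ ∈ C_c^∞(U)`. -/
def IsTestFunction {X : Type*} [NormedAddCommGroup X] [NormedSpace ℝ X] (U : Set X)
    (φ : X → ℝ) : Prop :=
  ContDiff ℝ ∞ φ ∧ HasCompactSupport φ ∧ tsupport φ ⊆ U

/-- The boundary of `Ω` is Lipschitz: near each boundary point there is a unit vector `e` such that
`Ω` is the region lying, in direction `e`, strictly above the graph of a Lipschitz function of the
projection `z - ⟪e, z⟫ e` of the point `z` to the hyperplane orthogonal to `e`. -/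
def HasLipschitzBoundary {n : ℕ} (Ω : Set (Eucl n)) : Prop :=
  ∀ x ∈ frontier Ω, ∃ (e : Eucl n) (L : ℝ≥0) (g : Eucl n → ℝ) (U : Set (Eucl n)),
    ‖e‖ = 1 ∧ LipschitzWith L g ∧ IsOpen U ∧ x ∈ U ∧
      ∀ z ∈ U, (z ∈ Ω ↔ g (z - inner ℝ e z • e) < inner ℝ e z)

/-- `Ω ⊆ ℝⁿ` is a bounded domain (open, connected, non-empty) with Lipschitz boundary. -/
structure IsLipschitzDomain {n : ℕ} (Ω : Set (Eucl n)) : Prop where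
  isOpen : IsOpen Ω
  isConnected : IsConnected Ω
  isBounded : Bornology.IsBounded Ω
  lipschitz : HasLipschitzBoundary Ω

/-- The semi-infinite cylinder `C = Ω × (0, ∞)`. -/
def openCylinder {n : ℕ} (Ω : Set (Eucl n)) : Set (Eucl n × ℝ) := Ω ×ˢ Ioi (0 : ℝ)

/-! ### The weighted Sobolev spaces on the cylinder -/

/-- The measure `y^α dx dy` on the cylinder `C`. -/
noncomputable def cylMeasure {n : ℕ} (Ω : Set (Eucl n)) (α : ℝ) : Measure (Eucl n × ℝ) :=
  (volume.restrict (openCylinder Ω)).withDensity (fun p => ENNReal.ofReal (p.2 ^ α))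

/-- `(G, g)` is the weak gradient `(∇ₓ w, ∂_y w)` of `w` in `C`: for all `φ ∈ C_c^∞(C)` and all
directions `(v, t)`, `∫_C w ∂_{(v,t)} φ = - ∫_C (G ⬝ v + g t) φ` (Lebesgue integrals). -/
def IsWeakGradient {n : ℕ} (Ω : Set (Eucl n)) (w : Eucl n × ℝ → ℝ) (G : Eucl n × ℝ → Eucl n)
    (g : Eucl n × ℝ → ℝ) : Prop :=
  ∀ φ : Eucl n × ℝ → ℝ, IsTestFunction (openCylinder Ω) φ → ∀ (v : Eucl n) (t : ℝ),
    ∫ p in openCylinder Ω, w p * fderiv ℝ φ p (v, t) =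
      - ∫ p in openCylinder Ω, (inner ℝ (G p) v + g p * t) * φ p

/-- Triples `(w, G, g)` in `L²(y^α, C)`, with the norm `(‖w‖² + ‖G‖² + ‖g‖²)^{1/2}`. -/
abbrev GradTriple {n : ℕ} (Ω : Set (Eucl n)) (α : ℝ) : Type :=
  WithLp 2 (Lp ℝ 2 (cylMeasure Ω α) ×
    WithLp 2 (Lp (Eucl n) 2 (cylMeasure Ω α) × Lp ℝ 2 (cylMeasure Ω α)))

/-- On a compact subset of the open cylinder the weight is bounded below. -/
theorem volume_restrict_le_cylMeasure {n : ℕ} {Ω : Set (Eucl n)} {α : ℝ}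
    {K : Set (Eucl n × ℝ)} (hKc : IsCompact K) (hK : K ⊆ openCylinder Ω) :
    ∃ c : ℝ≥0∞, c ≠ ⊤ ∧ volume.restrict K ≤ c • cylMeasure Ω α := by
  obtain ⟨m, hm, hml⟩ : ∃ m : ℝ, 0 < m ∧ ∀ p ∈ K, m ≤ p.2 ^ α := by
    rcases K.eq_empty_or_nonempty with he | hne
    · exact ⟨1, one_pos, by simp [he]⟩
    · have hcont : ContinuousOn (fun p : Eucl n × ℝ => p.2 ^ α) K := by
        intro p hp
        have hp2 : (0 : ℝ) < p.2 := (hK hp).2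
        exact ((Real.continuousAt_rpow_const p.2 α (Or.inl hp2.ne')).comp
          continuousAt_snd).continuousWithinAt
      obtain ⟨q, hq, hmin⟩ := hKc.exists_isMinOn hne hcont
      exact ⟨q.2 ^ α, Real.rpow_pos_of_pos (hK hq).2 α, fun p hp => hmin hp⟩
  have hKm : MeasurableSet K := hKc.measurableSet
  have hm0 : ENNReal.ofReal m ≠ 0 := by simpa using hm
  refine ⟨(ENNReal.ofReal m)⁻¹, by simpa using hm, Measure.le_iff.2 fun s hsm => ?_⟩
  have h1 : ENNReal.ofReal m * volume.restrict K s ≤ cylMeasure Ω α s := by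
    rw [Measure.restrict_apply hsm, cylMeasure, withDensity_apply _ hsm,
      Measure.restrict_restrict hsm]
    calc ENNReal.ofReal m * volume (s ∩ K)
        = ∫⁻ _ in s ∩ K, ENNReal.ofReal m := by simp
      _ ≤ ∫⁻ p in s ∩ K, ENNReal.ofReal (p.2 ^ α) :=
          setLIntegral_mono' (hsm.inter hKm)
            fun p hp => ENNReal.ofReal_le_ofReal (hml p hp.2)
      _ ≤ ∫⁻ p in s ∩ openCylinder Ω, ENNReal.ofReal (p.2 ^ α) :=
          lintegral_mono_set (inter_subset_inter_right s hK)
  calc volume.restrict K s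
      = (ENNReal.ofReal m)⁻¹ * (ENNReal.ofReal m * volume.restrict K s) := by
        rw [← mul_assoc, ENNReal.inv_mul_cancel hm0 ENNReal.ofReal_ne_top, one_mul]
    _ ≤ (ENNReal.ofReal m)⁻¹ * cylMeasure Ω α s := by gcongr

/-- A property that holds almost everywhere for `y^α dx dy` holds almost everywhere for Lebesgue
measure on compact subsets of the open cylinder. -/
theorem ae_mem_imp_of_ae_cylMeasure {n : ℕ} {Ω : Set (Eucl n)} {α : ℝ} {K : Set (Eucl n × ℝ)}
    (hKc : IsCompact K) (hK : K ⊆ openCylinder Ω) {P : Eucl n × ℝ → Prop}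
    (hP : ∀ᵐ p ∂cylMeasure Ω α, P p) : ∀ᵐ p ∂volume.restrict (openCylinder Ω), p ∈ K → P p := by
  obtain ⟨c, hc, hle⟩ := volume_restrict_le_cylMeasure (α := α) hKc hK
  have h := (Measure.absolutelyContinuous_of_le_smul hle).ae_le hP
  exact ae_restrict_of_ae ((ae_restrict_iff' hKc.measurableSet).1 h)

/-- Functions in `L²(y^α, C)` are integrable against continuous functions with compact support
in the open cylinder. -/
theorem cylMeasure_integrable_smul {n : ℕ} {Ω : Set (Eucl n)} {α : ℝ}
    {F : Type*} [NormedAddCommGroup F] [NormedSpace ℝ F] (w : Lp F 2 (cylMeasure Ω α))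
    {ψ : Eucl n × ℝ → ℝ} (hc : Continuous ψ) (hs : HasCompactSupport ψ)
    (hK : tsupport ψ ⊆ openCylinder Ω) :
    Integrable (fun p => ψ p • w p) (volume.restrict (openCylinder Ω)) := by
  have hKc : IsCompact (tsupport ψ) := hs
  obtain ⟨c, hcT, hle⟩ := volume_restrict_le_cylMeasure (α := α) hKc hK
  have hw : MemLp w 2 (volume.restrict (tsupport ψ)) :=
    ((Lp.memLp w).smul_measure hcT).mono_measure hle
  have : IsFiniteMeasure (volume.restrict (tsupport ψ)) :=
    ⟨by simpa using hKc.measure_lt_top⟩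
  have hwi : Integrable w (volume.restrict (tsupport ψ)) := hw.integrable one_le_two
  obtain ⟨B, hB⟩ := hs.exists_bound_of_continuous hc
  have h2 : IntegrableOn (fun p => ψ p • w p) (tsupport ψ) :=
    hwi.bdd_smul B hc.aestronglyMeasurable (Eventually.of_forall hB)
  have h3 : Integrable (fun p => ψ p • w p) volume := by
    refine (integrableOn_iff_integrable_of_support_subset ?_).1 h2
    intro p hp
    refine subset_tsupport ψ fun h0 => hp ?_
    simp [h0]
  exact h3.restrict

/-- A linear combination of triples with the weak gradient property has that property. -/
theorem IsWeakGradient.combination {n : ℕ} {Ω : Set (Eucl n)} {α : ℝ} {W W' : GradTriple Ω α}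
    (h : IsWeakGradient Ω W.fst W.snd.fst W.snd.snd)
    (h' : IsWeakGradient Ω W'.fst W'.snd.fst W'.snd.snd) (a b : ℝ) :
    IsWeakGradient Ω (a • W + b • W').fst (a • W + b • W').snd.fst (a • W + b • W').snd.snd := by
  intro φ hφ v t
  obtain ⟨hsm, hcs, hsub⟩ := hφ
  have hKc : IsCompact (tsupport φ) := hcs
  have hlin : ∀ {F : Type} [NormedAddCommGroup F] [NormedSpace ℝ F]
      (u u' : Lp F 2 (cylMeasure Ω α)), ∀ᵐ p ∂volume.restrict (openCylinder Ω),
      p ∈ tsupport φ → (a • u + b • u' : Lp F 2 (cylMeasure Ω α)) p = a • u p + b • u' p := by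
    intro F _ _ u u'
    refine ae_mem_imp_of_ae_cylMeasure (α := α) hKc hsub ?_
    filter_upwards [Lp.coeFn_add (a • u) (b • u'), Lp.coeFn_smul a u, Lp.coeFn_smul b u']
      with p h1 h2 h3
    rw [h1, Pi.add_apply, h2, h3, Pi.smul_apply, Pi.smul_apply]
  have hd0 : ∀ p, p ∉ tsupport φ → fderiv ℝ φ p (v, t) = 0 := by
    intro p hp
    have hp' : p ∉ tsupport (fderiv ℝ φ) := fun hq => hp (tsupport_fderiv_subset ℝ hq)
    rw [image_eq_zero_of_notMem_tsupport hp']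
    rfl
  have hdc : Continuous fun p => fderiv ℝ φ p (v, t) :=
    (hsm.continuous_fderiv (by simp)).clm_apply continuous_const
  have hds : HasCompactSupport fun p => fderiv ℝ φ p (v, t) := hcs.fderiv_apply ℝ (v, t)
  have hdt : tsupport (fun p => fderiv ℝ φ p (v, t)) ⊆ openCylinder Ω :=
    (closure_minimal (fun p hp => by_contra fun hq => (Function.mem_support.1 hp) (hd0 p hq))
      (isClosed_tsupport φ)).trans hsub
  have hL : ∀ u : Lp ℝ 2 (cylMeasure Ω α),
      Integrable (fun p => u p * fderiv ℝ φ p (v, t)) (volume.restrict (openCylinder Ω)) := fun u =>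
    (cylMeasure_integrable_smul u hdc hds hdt).congr
      (Eventually.of_forall fun p => by simp [mul_comm])
  have hR : ∀ (G : Lp (Eucl n) 2 (cylMeasure Ω α)) (g : Lp ℝ 2 (cylMeasure Ω α)),
      Integrable (fun p => (inner ℝ (G p) v + g p * t) * φ p)
        (volume.restrict (openCylinder Ω)) := fun G g =>
    (((cylMeasure_integrable_smul G hsm.continuous hcs hsub).inner_const (𝕜 := ℝ) v).add
      ((cylMeasure_integrable_smul g hsm.continuous hcs hsub).mul_const t)).congr
      (Eventually.of_forall fun p => by
        simp only [Pi.add_apply, real_inner_smul_left, smul_eq_mul]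
        ring)
  have e1 : ∫ p in openCylinder Ω, (a • W + b • W').fst p * fderiv ℝ φ p (v, t) =
      a * (∫ p in openCylinder Ω, W.fst p * fderiv ℝ φ p (v, t)) +
      b * ∫ p in openCylinder Ω, W'.fst p * fderiv ℝ φ p (v, t) := by
    rw [← integral_const_mul, ← integral_const_mul,
      ← integral_add ((hL _).const_mul a) ((hL _).const_mul b)]
    refine integral_congr_ae ?_
    filter_upwards [hlin W.fst W'.fst] with p hp
    by_cases hpt : p ∈ tsupport φ
    · have := hp hpt
      simp only [smul_eq_mul] at this
      simp only [WithLp.add_fst, WithLp.smul_fst, this]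
      ring
    · simp [hd0 p hpt]
  have e2 : ∫ p in openCylinder Ω, (inner ℝ ((a • W + b • W').snd.fst p) v +
        (a • W + b • W').snd.snd p * t) * φ p =
      a * (∫ p in openCylinder Ω, (inner ℝ (W.snd.fst p) v + W.snd.snd p * t) * φ p) +
      b * ∫ p in openCylinder Ω, (inner ℝ (W'.snd.fst p) v + W'.snd.snd p * t) * φ p := by
    rw [← integral_const_mul, ← integral_const_mul,
      ← integral_add ((hR _ _).const_mul a) ((hR _ _).const_mul b)]
    refine integral_congr_ae ?_
    filter_upwards [hlin W.snd.fst W'.snd.fst, hlin W.snd.snd W'.snd.snd] with p hp hp'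
    by_cases hpt : p ∈ tsupport φ
    · have h1 := hp hpt
      have h2 := hp' hpt
      simp only [smul_eq_mul] at h2
      simp only [WithLp.add_fst, WithLp.smul_fst, WithLp.add_snd, WithLp.smul_snd, h1, h2,
        inner_add_left, real_inner_smul_left]
      ring
    · simp [image_eq_zero_of_notMem_tsupport hpt]
  rw [e1, e2, h φ ⟨hsm, hcs, hsub⟩ v t, h' φ ⟨hsm, hcs, hsub⟩ v t]
  ring

/-- `H¹(y^α, C)`: functions in `L²(y^α, C)` with weak gradient in `L²(y^α, C)`, with the norm
`(‖w‖² + ‖∇ w‖²)^{1/2}`. An element is the function together with its weak gradient (which the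
function determines almost everywhere in `C`). -/
noncomputable def H1Weighted {n : ℕ} (Ω : Set (Eucl n)) (α : ℝ) :
    Submodule ℝ (GradTriple Ω α) where
  carrier := {W | IsWeakGradient Ω W.fst W.snd.fst W.snd.snd}
  zero_mem' := by
    have h0 : ∀ {F : Type} [NormedAddCommGroup F],
        ((0 : Lp F 2 (cylMeasure Ω α)) : Eucl n × ℝ → F) =ᵐ[cylMeasure Ω α] 0 :=
      fun {F} _ => Lp.coeFn_zero F 2 (cylMeasure Ω α)
    intro φ hφ v t
    have hz := ae_mem_imp_of_ae_cylMeasure (α := α) hφ.2.1 hφ.2.2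
      ((h0 (F := ℝ)).and (h0 (F := Eucl n)))
    have e1 : ∫ p in openCylinder Ω, (0 : GradTriple Ω α).fst p * fderiv ℝ φ p (v, t) = 0 := by
      refine integral_eq_zero_of_ae ?_
      filter_upwards [hz] with p hp
      by_cases hpt : p ∈ tsupport φ
      · rw [WithLp.zero_fst, (hp hpt).1]
        simp
      · have hp' : p ∉ tsupport (fderiv ℝ φ) := fun hq => hpt (tsupport_fderiv_subset ℝ hq)
        simp [image_eq_zero_of_notMem_tsupport hp']
    have e2 : ∫ p in openCylinder Ω, (inner ℝ ((0 : GradTriple Ω α).snd.fst p) v +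
        (0 : GradTriple Ω α).snd.snd p * t) * φ p = 0 := by
      refine integral_eq_zero_of_ae ?_
      filter_upwards [hz] with p hp
      by_cases hpt : p ∈ tsupport φ
      · rw [WithLp.zero_snd, WithLp.zero_fst, WithLp.zero_snd, (hp hpt).1, (hp hpt).2]
        simp
      · simp [image_eq_zero_of_notMem_tsupport hpt]
    rw [e1, e2, neg_zero]
  add_mem' := by
    intro W W' h h'
    simpa using IsWeakGradient.combination h h' 1 1
  smul_mem' := by
    intro a W h
    simpa using IsWeakGradient.combination h h a 0

/-- `H¹_L(y^α, C)`: the functions in `H¹(y^α, C)` that vanish on the lateral boundary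
`∂Ω × [0, ∞)`, that is, the closure in `H¹(y^α, C)` of the smooth functions on `C ∪ (Ω × {0})`
with bounded support at a positive distance from the lateral boundary (the restrictions to `C` of
the elements of `C_c^∞(Ω × ℝ)`). -/
noncomputable def HL {n : ℕ} (Ω : Set (Eucl n)) (α : ℝ) : Submodule ℝ (H1Weighted Ω α) :=
  (Submodule.span ℝ {w : H1Weighted Ω α | ∃ φ : Eucl n × ℝ → ℝ,
    IsTestFunction (Ω ×ˢ univ) φ ∧ w.1.fst =ᵐ[cylMeasure Ω α] φ}).topologicalClosure

/-- The function on the cylinder underlying an element of `H¹_L(y^α, C)`. -/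
noncomputable def cylFun {n : ℕ} {Ω : Set (Eucl n)} {α : ℝ} (w : HL Ω α) : Eucl n × ℝ → ℝ :=
  w.1.1.fst

/-! ### The trace on `Ω × {0}` -/

/-- `L²(Ω)`. -/
abbrev L2 {n : ℕ} (Ω : Set (Eucl n)) : Type := Lp ℝ 2 (volume.restrict Ω)

/-- `g ∈ L²(Ω)` is the trace of `w` on `Ω × {0}`:
`(1 / δ) ∫_0^δ ‖w(·, y) - g‖²_{L²(Ω)} dy → 0` as `δ → 0+`. -/
def IsTrace {n : ℕ} (Ω : Set (Eucl n)) (w : Eucl n × ℝ → ℝ) (g : Eucl n → ℝ) : Prop :=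
  Tendsto (fun δ : ℝ => (ENNReal.ofReal δ)⁻¹ *
    ∫⁻ p in Ω ×ˢ Ioo (0 : ℝ) δ, ‖w p - g p.1‖ₑ ^ 2) (𝓝[>] 0) (𝓝 0)

open Classical in
/-- The trace operator `tr : H¹_L(y^α, C) → L²(Ω)`. (For `α ∈ (-1, 1)` every element has a trace,
and it is unique; the value `0` in the second case is never used.) -/
noncomputable def tr {n : ℕ} {Ω : Set (Eucl n)} {α : ℝ} (w : HL Ω α) : L2 Ω :=
  if h : ∃ g : L2 Ω, IsTrace Ω (cylFun w) g then h.choose else 0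

/-! ### The elliptic operator and its fractional order spaces -/

/-- The coefficients of `𝓛 u = - div (A ∇u) + c u`: `A` is measurable, symmetric, bounded and
uniformly elliptic in `Ω`, and `0 ≤ c ∈ L^∞(Ω)`. -/
structure IsEllipticCoeff {n : ℕ} (Ω : Set (Eucl n)) (A : Eucl n → Matrix (Fin n) (Fin n) ℝ)
    (c : Eucl n → ℝ) : Prop where
  measurable_A : ∀ i j, AEMeasurable (fun x => A x i j) (volume.restrict Ω)
  symm_A : ∀ᵐ x ∂volume.restrict Ω, (A x).IsSymm
  elliptic : ∃ Λ₁ Λ₂ : ℝ, 0 < Λ₁ ∧ Λ₁ ≤ Λ₂ ∧ ∀ᵐ x ∂volume.restrict Ω, ∀ ξ : Eucl n,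
    Λ₁ * ‖ξ‖ ^ 2 ≤ inner ℝ (Matrix.toEuclideanCLM (n := Fin n) (𝕜 := ℝ) (A x) ξ) ξ ∧
      inner ℝ (Matrix.toEuclideanCLM (n := Fin n) (𝕜 := ℝ) (A x) ξ) ξ ≤ Λ₂ * ‖ξ‖ ^ 2
  bounded_c : MemLp c ⊤ (volume.restrict Ω)
  nonneg_c : ∀ᵐ x ∂volume.restrict Ω, 0 ≤ c x

/-- The pairs `(u, ∇u)` with `u ∈ H¹₀(Ω)`: the closure in `L²` of the pairs `(ψ, ∇ψ)` with
`ψ ∈ C_c^∞(Ω)`. -/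
def H10Pairs {n : ℕ} (Ω : Set (Eucl n)) : Set (L2 Ω × Lp (Eucl n) 2 (volume.restrict Ω)) :=
  closure {P | ∃ ψ : Eucl n → ℝ, IsTestFunction Ω ψ ∧
    P.1 =ᵐ[volume.restrict Ω] ψ ∧ P.2 =ᵐ[volume.restrict Ω] gradient ψ}

/-- `u ∈ H¹₀(Ω)` and `𝓛 u = lam u` weakly in `Ω` (homogeneous Dirichlet conditions). -/
def IsDirichletEigenpair {n : ℕ} (Ω : Set (Eucl n)) (A : Eucl n → Matrix (Fin n) (Fin n) ℝ)
    (c : Eucl n → ℝ) (lam : ℝ) (u : L2 Ω) : Prop :=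
  ∃ G : Lp (Eucl n) 2 (volume.restrict Ω), (u, G) ∈ H10Pairs Ω ∧
    ∀ ψ : Eucl n → ℝ, IsTestFunction Ω ψ →
      ∫ x in Ω, (inner ℝ (Matrix.toEuclideanCLM (n := Fin n) (𝕜 := ℝ) (A x) (G x)) (gradient ψ x)
        + c x * u x * ψ x) = lam * ∫ x in Ω, u x * ψ x

/-- The space `ℍˢ(Ω)` of the `u ∈ L²(Ω)` with `∑ₖ λₖˢ (u, φₖ)² < ∞`, where `(φₖ)` is a complete
orthonormal system of eigenfunctions of `𝓛` in `L²(Ω)` with eigenvalues `λₖ`. (The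
value of the sum does not depend on the choice of the system.) -/
def fracSpace {n : ℕ} (Ω : Set (Eucl n)) (A : Eucl n → Matrix (Fin n) (Fin n) ℝ)
    (c : Eucl n → ℝ) (s : ℝ) : Set (L2 Ω) :=
  {u | ∀ (lam : ℕ → ℝ) (φ : HilbertBasis ℕ ℝ (L2 Ω)),
    (∀ k, IsDirichletEigenpair Ω A c (lam k) (φ k)) →
      Summable fun k => lam k ^ s * (inner ℝ u (φ k)) ^ 2}

/-! ### Obstacle maps and constraint sets -/

/-- `uₖ → u` in `L^p(Ω)`. -/
def ConvergesInLp {n : ℕ} (Ω : Set (Eucl n)) (p : ℝ≥0∞) (u : ℕ → Eucl n → ℝ)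
    (u₀ : Eucl n → ℝ) : Prop :=
  (∀ k, MemLp (u k) p (volume.restrict Ω)) ∧ MemLp u₀ p (volume.restrict Ω) ∧
    Tendsto (fun k => eLpNorm (fun x => u k x - u₀ x) p (volume.restrict Ω)) atTop (𝓝 0)

/-- The standing assumptions on the obstacle map `Ψ`, which sends `u ∈ ℍˢ(Ω)` to a measurable
function on `Ω` (modulo null sets); only its values on the domain `D = ℍˢ(Ω)` matter. -/
structure IsObstacleMap {n : ℕ} (Ω : Set (Eucl n)) (D : Set (L2 Ω))
    (Ψ : L2 Ω → (Eucl n →ₘ[volume.restrict Ω] ℝ)) : Prop where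
  mono : ∀ u₁ ∈ D, ∀ u₂ ∈ D, (∀ᵐ x ∂volume.restrict Ω, 0 ≤ u₁ x ∧ u₁ x ≤ u₂ x) →
    ∀ᵐ x ∂volume.restrict Ω, 0 ≤ Ψ u₁ x ∧ Ψ u₁ x ≤ Ψ u₂ x
  lower_bound : ∃ ν : ℝ, 0 < ν ∧ ∀ u ∈ D, ∀ᵐ x ∂volume.restrict Ω, ν ≤ Ψ u x
  continuous : ∀ (u : ℕ → L2 Ω) (u₀ : L2 Ω), (∀ k, u k ∈ D) → u₀ ∈ D →
    (∀ p : ℝ≥0∞, 1 < p → p < ⊤ → ConvergesInLp Ω p (fun k => u k) u₀) →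
      ConvergesInLp Ω ⊤ (fun k => Ψ (u k)) (Ψ u₀)

/-- `𝓚(w)`: the `v ∈ H¹_L(y^α, C)` with `tr v ≤ Ψ(tr w)` a.e. in `Ω`. -/
def constraintSet {n : ℕ} {Ω : Set (Eucl n)} {α : ℝ}
    (Ψ : L2 Ω → (Eucl n →ₘ[volume.restrict Ω] ℝ)) (w : HL Ω α) : Set (HL Ω α) :=
  {v | ∀ᵐ x ∂volume.restrict Ω, tr v x ≤ Ψ (tr w) x}

/-- `𝓚^τ(w)`: the `v ∈ 𝓚(w)` with `v ≤ 0` a.e. in `Ω × (τ, ∞)`. For `τ = ∞` this set is empty, the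
additional condition is void, and `𝓚^∞(w) = 𝓚(w)`. -/
def truncConstraintSet {n : ℕ} {Ω : Set (Eucl n)} {α : ℝ}
    (Ψ : L2 Ω → (Eucl n →ₘ[volume.restrict Ω] ℝ)) (τ : EReal) (w : HL Ω α) : Set (HL Ω α) :=
  {v | v ∈ constraintSet Ψ w ∧
    ∀ᵐ p ∂volume.restrict (openCylinder Ω), τ < (p.2 : EReal) → cylFun v p ≤ 0}

/-- The convention `𝓚^∞ = 𝓚`. -/
theorem truncConstraintSet_top {n : ℕ} {Ω : Set (Eucl n)} {α : ℝ}
    (Ψ : L2 Ω → (Eucl n →ₘ[volume.restrict Ω] ℝ)) (w : HL Ω α) :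
    truncConstraintSet Ψ ⊤ w = constraintSet Ψ w := by
  ext v
  simp [truncConstraintSet]

/-! ### Weak convergence and Mosco convergence -/

/-- `xₖ ⇀ x` weakly in the normed space `X`. -/
def WeaklyConverges {X : Type*} [NormedAddCommGroup X] [NormedSpace ℝ X] (x : ℕ → X) (x₀ : X) :
    Prop :=
  ∀ ℓ : X →L[ℝ] ℝ, Tendsto (fun k => ℓ (x k)) atTop (𝓝 (ℓ x₀))

/-- Mosco convergence of non-empty closed convex sets `Kₙ` to the non-empty closed convex set
`K₀`. -/
structure MoscoConverges {X : Type*} [NormedAddCommGroup X] [NormedSpace ℝ X] (K : ℕ → Set X)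
    (K₀ : Set X) : Prop where
  admissible : ∀ k, (K k).Nonempty ∧ IsClosed (K k) ∧ Convex ℝ (K k)
  admissible_limit : K₀.Nonempty ∧ IsClosed K₀ ∧ Convex ℝ K₀
  recovery : ∀ v ∈ K₀, ∃ x : ℕ → X, (∀ k, x k ∈ K k) ∧ Tendsto x atTop (𝓝 v)
  weak_limit : ∀ (x : ℕ → X) (v : X), (∀ k, x k ∈ K k) →
    (∃ σ : ℕ → ℕ, StrictMono σ ∧ WeaklyConverges (x ∘ σ) v) → v ∈ K₀

/-! A constraint set depends on `w` only through the obstacle `Ψ (tr w)`. Two things are therefore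
needed: uniform convergence of the obstacles `Ψ (tr vₙ)` to `Ψ (tr v*)`, and a way to adjust the
truncation height of a function without changing its trace.

Obstacles. The increasing sequence is dominated by `Y*`, so it has a limit in `L²(y^α)`; boundedness
in the Hilbert space `HL` turns this into a weak limit there (`exists_monotone_limit_HL`). The trace
is linear, continuous and order preserving, so `tr vₙ` increases to `tr v* ≤ tr Y*`, which is
bounded above. As `Ω` is bounded, dominated convergence gives convergence in every `L^p` with `1 < p
< ∞`. The continuity of `Ψ` then gives convergence in `L^∞`, and its monotonicity gives `Ψ (tr vₙ) ≤
Ψ (tr v*)`.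

The hypotheses on `Ψ` only apply to elements of `ℍˢ(Ω)`, so traces must be shown to lie there. Both
this and the existence of the trace rest on the half-line inequality `rpow_mul_enorm_zero_sq_le`,
namely `λˢ |f(0)|² ≤ C (λ ∫ y^α f² + ∫ y^α f'²)`. With `λ = 1` on vertical lines it bounds the
trace. With `λ = λₖ` for the `k`-th Fourier coefficient, summed over `k`, it gives
`trOp_mem_fracSpace`.

Mosco convergence (`moscoConverges_obstacleSet`). Weak limits stay admissible because the
constraints are closed and convex and the obstacles increase. For recovery let `εₙ` be the `L^∞`
distance of the obstacles. Since `Ψ ≥ ν`, one has `Ψ (tr v*) ≤ (1 + εₙ/ν) Ψ (tr vₙ)`, so division by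
`1 + εₙ/ν` makes `v` admissible for the `n`-th obstacle. The height is adjusted beforehand by
operators that tend strongly to the identity and preserve traces (`exists_recovery_operators`): the
stretching `v(x, rₙ y)` with `rₙ = max(1, τ*/τₙ)` if `τ* < ∞`, and multiplication by a cut-off in
`y` if `τ* = ∞`. -/

/-! ### The weighted measures -/

/-- The measure `y^α dy` on `(0, ∞)`. -/
noncomputable def powerMeasure (α : ℝ) : Measure ℝ :=
  (volume.restrict (Ioi (0 : ℝ))).withDensity fun y => ENNReal.ofReal (y ^ α)

theorem measurable_ofReal_rpow (α : ℝ) : Measurable fun y : ℝ => ENNReal.ofReal (y ^ α) := by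
  fun_prop

/-- The weight depends on `y` alone, so Tonelli reduces energy estimates on the cylinder to vertical
lines or to horizontal slices. -/
theorem cylMeasure_eq_prod {n : ℕ} (Ω : Set (Eucl n)) (α : ℝ) :
    cylMeasure Ω α = (volume.restrict Ω).prod (powerMeasure α) := by
  rw [cylMeasure, powerMeasure, prod_withDensity_right (measurable_ofReal_rpow α),
    Measure.prod_restrict]
  rfl

instance isAddHaarMeasure_volume_cyl (n : ℕ) :
    (volume : Measure (Eucl n × ℝ)).IsAddHaarMeasure :=
  inferInstanceAs ((volume : Measure (Eucl n)).prod (volume : Measure ℝ)).IsAddHaarMeasure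

instance sigmaFinite_powerMeasure (α : ℝ) : SigmaFinite (powerMeasure α) := by
  unfold powerMeasure
  infer_instance

/-- The condition `-1 < α` is integrability of `y^α` at `0`. It makes the weighted measures locally
finite, so that smooth functions which do not vanish at `y = 0` have finite norm. -/
theorem powerMeasure_Iio_lt_top {α : ℝ} (hα : -1 < α) (R : ℝ) : powerMeasure α (Iio R) < ⊤ := by
  rw [powerMeasure, withDensity_apply _ measurableSet_Iio,
    Measure.restrict_restrict measurableSet_Iio]
  have h : IntegrableOn (fun y : ℝ => y ^ α) (Ioc 0 (max R 0)) :=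
    (intervalIntegrable_iff_integrableOn_Ioc_of_le (le_max_right R 0)).1
      (intervalIntegral.intervalIntegrable_rpow' hα)
  refine lt_of_le_of_lt (lintegral_mono_set (t := Ioc 0 (max R 0)) ?_) h.setLIntegral_lt_top
  rintro y ⟨h1, h2⟩
  exact ⟨h2, le_max_of_le_left (le_of_lt h1)⟩

theorem isLocallyFiniteMeasure_powerMeasure {α : ℝ} (hα : -1 < α) :
    IsLocallyFiniteMeasure (powerMeasure α) :=
  ⟨fun y => ⟨Iio (y + 1), Iio_mem_nhds (lt_add_one y), powerMeasure_Iio_lt_top hα _⟩⟩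

theorem isLocallyFiniteMeasure_cylMeasure {n : ℕ} (Ω : Set (Eucl n)) {α : ℝ} (hα : -1 < α) :
    IsLocallyFiniteMeasure (cylMeasure Ω α) := by
  have := isLocallyFiniteMeasure_powerMeasure hα
  rw [cylMeasure_eq_prod]
  infer_instance

theorem cylMeasure_absolutelyContinuous {n : ℕ} (Ω : Set (Eucl n)) (α : ℝ) :
    cylMeasure Ω α ≪ volume.restrict (openCylinder Ω) :=
  withDensity_absolutelyContinuous _ _

theorem measurableSet_openCylinder {n : ℕ} {Ω : Set (Eucl n)} (hΩ : IsOpen Ω) :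
    MeasurableSet (openCylinder Ω) :=
  (hΩ.prod isOpen_Ioi).measurableSet

theorem absolutelyContinuous_cylMeasure {n : ℕ} {Ω : Set (Eucl n)} (hΩ : IsOpen Ω) (α : ℝ) :
    volume.restrict (openCylinder Ω) ≪ cylMeasure Ω α := by
  refine withDensity_absolutelyContinuous'
    ((measurable_ofReal_rpow α).comp measurable_snd).aemeasurable ?_
  filter_upwards [ae_restrict_mem (measurableSet_openCylinder hΩ)] with p hp
  have : 0 < p.2 ^ α := Real.rpow_pos_of_pos hp.2 α
  simpa using this

/-- The weight is positive on the cylinder, so both measures have the same null sets there. -/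
theorem ae_cylMeasure_iff {n : ℕ} {Ω : Set (Eucl n)} (hΩ : IsOpen Ω) (α : ℝ)
    {P : Eucl n × ℝ → Prop} :
    (∀ᵐ p ∂cylMeasure Ω α, P p) ↔ ∀ᵐ p ∂volume.restrict (openCylinder Ω), P p :=
  ⟨fun h => (absolutelyContinuous_cylMeasure hΩ α).ae_le h,
    fun h => (cylMeasure_absolutelyContinuous Ω α).ae_le h⟩

theorem integral_cylMeasure {n : ℕ} {Ω : Set (Eucl n)} (hΩ : IsOpen Ω) (α : ℝ)
    (f : Eucl n × ℝ → ℝ) :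
    ∫ p, f p ∂cylMeasure Ω α = ∫ p in openCylinder Ω, p.2 ^ α * f p := by
  have hm : Measurable fun p : Eucl n × ℝ => ENNReal.ofReal (p.2 ^ α) :=
    (measurable_ofReal_rpow α).comp measurable_snd
  rw [cylMeasure, integral_withDensity_eq_integral_toReal_smul hm
    (Eventually.of_forall fun _ => by simp)]
  refine integral_congr_ae ?_
  filter_upwards [ae_restrict_mem (measurableSet_openCylinder hΩ)] with p hp
  simp [ENNReal.toReal_ofReal (Real.rpow_pos_of_pos hp.2 α).le]

/-- Integration against a continuous function with compact support in the open cylinder is a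
continuous functional on `L²(y^α, C)`. -/
theorem exists_inner_eq_setIntegral {n : ℕ} {Ω : Set (Eucl n)} (hΩ : IsOpen Ω) {α : ℝ}
    (hα : -1 < α) {ψ : Eucl n × ℝ → ℝ} (hc : Continuous ψ) (hs : HasCompactSupport ψ)
    (hK : tsupport ψ ⊆ openCylinder Ω) :
    ∃ h : Lp ℝ 2 (cylMeasure Ω α), ∀ w : Lp ℝ 2 (cylMeasure Ω α),
      ∫ p in openCylinder Ω, w p * ψ p = inner ℝ h w := by
  have := isLocallyFiniteMeasure_cylMeasure Ω hα
  -- The representing element is `ψ y^{-α}`: dividing by the weight turns the weighted pairing into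
  -- a Lebesgue integral. It is continuous because `ψ` is supported away from `y = 0`.
  have hcont : Continuous fun p : Eucl n × ℝ => ψ p * (p.2 ^ α)⁻¹ := by
    rw [continuous_iff_continuousAt]
    intro p
    by_cases hp : p ∈ tsupport ψ
    · have h0 : (0 : ℝ) < p.2 := (hK hp).2
      exact hc.continuousAt.mul (((Real.continuousAt_rpow_const p.2 α (Or.inl h0.ne')).comp
          continuousAt_snd).inv₀ (Real.rpow_pos_of_pos h0 α).ne')
    · have : (fun p : Eucl n × ℝ => ψ p * (p.2 ^ α)⁻¹) =ᶠ[𝓝 p] fun _ => 0 := by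
        filter_upwards [(isClosed_tsupport ψ).isOpen_compl.mem_nhds hp] with q hq
        simp [image_eq_zero_of_notMem_tsupport hq]
      exact continuousAt_const.congr this.symm
  have hm : MemLp (fun p : Eucl n × ℝ => ψ p * (p.2 ^ α)⁻¹) 2 (cylMeasure Ω α) :=
    hcont.memLp_of_hasCompactSupport hs.mul_right
  refine ⟨hm.toLp _, fun w => ?_⟩
  rw [L2.inner_def]
  have e : ∫ p, inner ℝ (hm.toLp _ p) (w p) ∂cylMeasure Ω α =
      ∫ p, (ψ p * (p.2 ^ α)⁻¹) * w p ∂cylMeasure Ω α := by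
    refine integral_congr_ae ?_
    filter_upwards [hm.coeFn_toLp] with p hp
    rw [hp]
    simp [mul_comm]
  rw [e, integral_cylMeasure hΩ]
  refine integral_congr_ae ?_
  filter_upwards [ae_restrict_mem (measurableSet_openCylinder hΩ)] with p hp
  have := (Real.rpow_pos_of_pos hp.2 α).ne'
  field_simp

/-! ### Completeness, and uniqueness of weak gradients -/

theorem IsTestFunction.fderiv_apply {X : Type*} [NormedAddCommGroup X] [NormedSpace ℝ X]
    {U : Set X} {φ : X → ℝ} (h : IsTestFunction U φ) (v : X) :
    IsTestFunction U fun p => fderiv ℝ φ p v := by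
  refine ⟨?_, h.2.1.fderiv_apply ℝ v, ?_⟩
  · exact (h.1.fderiv_right (m := ∞) (by simp)).clm_apply contDiff_const
  · refine (closure_minimal (fun p hp => ?_) (isClosed_tsupport φ)).trans h.2.2
    by_contra hq
    have hp' : p ∉ tsupport (fderiv ℝ φ) := fun h' => hq (tsupport_fderiv_subset ℝ h')
    exact hp (by simp [image_eq_zero_of_notMem_tsupport hp'])

/-- Each identity that defines a weak gradient equates two continuous functionals of the triple,
hence is a closed condition. -/
theorem isClosed_H1Weighted {n : ℕ} {Ω : Set (Eucl n)} (hΩ : IsOpen Ω) {α : ℝ} (hα : -1 < α) :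
    IsClosed (H1Weighted Ω α : Set (GradTriple Ω α)) := by
  have key : (H1Weighted Ω α : Set (GradTriple Ω α)) =
      ⋂ (φ : Eucl n × ℝ → ℝ) (_ : IsTestFunction (openCylinder Ω) φ) (v : Eucl n) (t : ℝ),
        {W | ∫ p in openCylinder Ω, W.fst p * fderiv ℝ φ p (v, t) =
          - ∫ p in openCylinder Ω, (inner ℝ (W.snd.fst p) v + W.snd.snd p * t) * φ p} := by
    ext W
    simp only [mem_iInter]
    rfl
  rw [key]
  refine isClosed_iInter fun φ => isClosed_iInter fun hφ => isClosed_iInter fun v =>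
    isClosed_iInter fun t => ?_
  have hd := hφ.fderiv_apply (v, t)
  obtain ⟨h1, e1⟩ := exists_inner_eq_setIntegral hΩ hα hd.1.continuous hd.2.1 hd.2.2
  obtain ⟨h2, e2⟩ := exists_inner_eq_setIntegral hΩ hα hφ.1.continuous hφ.2.1 hφ.2.2
  have e3 : ∀ W : GradTriple Ω α,
      ∫ p in openCylinder Ω, (inner ℝ (W.snd.fst p) v + W.snd.snd p * t) * φ p =
        inner ℝ h2 ((innerSL ℝ v).compLp W.snd.fst + t • W.snd.snd) := by
    intro W
    rw [← e2]
    refine integral_congr_ae ?_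
    refine (absolutelyContinuous_cylMeasure hΩ α).ae_le ?_
    filter_upwards [Lp.coeFn_add ((innerSL ℝ v).compLp W.snd.fst) (t • W.snd.snd),
      Lp.coeFn_smul t W.snd.snd, (innerSL ℝ v).coeFn_compLp W.snd.fst] with p h1 h2 h3
    rw [h1, Pi.add_apply, h2, h3]
    simp [real_inner_comm, mul_comm]
  simp only [e1, e3]
  have c1 : Continuous fun W : GradTriple Ω α => W.fst := WithLp.continuous_fst _ _ _
  have c2 : Continuous fun W : GradTriple Ω α => W.snd := WithLp.continuous_snd _ _ _
  refine isClosed_eq (continuous_const.inner c1) (continuous_const.inner ?_).neg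
  refine Continuous.add ?_ (Continuous.const_smul ((WithLp.continuous_snd _ _ _).comp c2) t)
  exact ((innerSL ℝ v).compLpL 2 (cylMeasure Ω α)).continuous.comp ((WithLp.continuous_fst _ _ _).comp c2)

theorem completeSpace_HL {n : ℕ} {Ω : Set (Eucl n)} (hΩ : IsOpen Ω) {α : ℝ} (hα : -1 < α) :
    CompleteSpace (HL Ω α) := by
  have : CompleteSpace (H1Weighted Ω α) := (isClosed_H1Weighted hΩ hα).completeSpace_coe
  exact (Submodule.isClosed_topologicalClosure _).completeSpace_coe

/-- The fundamental lemma of the calculus of variations; it applies because the weight is bounded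
below on compact subsets of the open cylinder, which gives local Lebesgue integrability. -/
theorem ae_eq_zero_of_forall_test {n : ℕ} {Ω : Set (Eucl n)} (hΩ : IsOpen Ω) {α : ℝ}
    (w : Lp ℝ 2 (cylMeasure Ω α))
    (h : ∀ φ : Eucl n × ℝ → ℝ, IsTestFunction (openCylinder Ω) φ →
      ∫ p in openCylinder Ω, w p * φ p = 0) : w = 0 := by
  have ho : IsOpen (openCylinder Ω) := hΩ.prod isOpen_Ioi
  have hloc : LocallyIntegrableOn w (openCylinder Ω) (volume.restrict (openCylinder Ω)) := by
    rw [locallyIntegrableOn_iff ho.isLocallyClosed]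
    intro K hK hKc
    obtain ⟨c, hcT, hle⟩ := volume_restrict_le_cylMeasure (α := α) hKc hK
    have : IsFiniteMeasure (volume.restrict K) := ⟨by simpa using hKc.measure_lt_top⟩
    have hw : MemLp w 2 (volume.restrict K) :=
      ((Lp.memLp w).smul_measure hcT).mono_measure hle
    rw [IntegrableOn, Measure.restrict_restrict hKc.measurableSet, inter_eq_left.2 hK]
    exact hw.integrable one_le_two
  have h1 := ho.ae_eq_zero_of_integral_contDiff_smul_eq_zero hloc fun g h1 h2 h3 => by
    simpa [mul_comm] using h g ⟨h1, h2, h3⟩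
  have h2 : ∀ᵐ p ∂volume.restrict (openCylinder Ω), w p = 0 := by
    filter_upwards [h1, ae_restrict_mem (measurableSet_openCylinder hΩ)] with p hp hq
    exact hp hq
  exact (Lp.eq_zero_iff_ae_eq_zero).2 ((ae_cylMeasure_iff hΩ α).2 h2)

/-- The function determines its weak gradient. -/
theorem H1Weighted.ext_fst {n : ℕ} {Ω : Set (Eucl n)} (hΩ : IsOpen Ω) {α : ℝ}
    {w w' : H1Weighted Ω α} (h : w.1.fst = w'.1.fst) : w = w' := by
  suffices H : ∀ u : H1Weighted Ω α, u.1.fst = 0 → u = 0 by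
    exact sub_eq_zero.1 (H (w - w') (by simp [h]))
  intro u hu
  -- A vanishing function forces every directional component of its gradient to be orthogonal to all
  -- test functions.
  have h0 : ∀ (v : Eucl n) (t : ℝ),
      (innerSL ℝ v).compLp u.1.snd.fst + t • u.1.snd.snd = 0 := by
    intro v t
    refine ae_eq_zero_of_forall_test hΩ _ fun φ hφ => ?_
    have h1 := u.2 φ hφ v t
    have h2 : ∫ p in openCylinder Ω, u.1.fst p * fderiv ℝ φ p (v, t) = 0 := by
      refine integral_eq_zero_of_ae ?_
      refine (absolutelyContinuous_cylMeasure hΩ α).ae_le ?_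
      rw [hu]
      filter_upwards [Lp.coeFn_zero ℝ 2 (cylMeasure Ω α)] with p hp
      rw [hp]
      simp
    rw [h2, eq_comm, neg_eq_zero] at h1
    rw [← h1]
    refine integral_congr_ae ?_
    refine (absolutelyContinuous_cylMeasure hΩ α).ae_le ?_
    filter_upwards [Lp.coeFn_add ((innerSL ℝ v).compLp u.1.snd.fst) (t • u.1.snd.snd),
      Lp.coeFn_smul t u.1.snd.snd, (innerSL ℝ v).coeFn_compLp u.1.snd.fst] with p h1 h2 h3
    rw [h1, Pi.add_apply, h2, h3]
    simp [real_inner_comm, mul_comm]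
  have hg : u.1.snd.snd = 0 := by
    have := h0 0 1
    have e : (innerSL ℝ (0 : Eucl n)).compLp u.1.snd.fst = 0 := by
      refine Lp.ext ?_
      filter_upwards [(innerSL ℝ (0 : Eucl n)).coeFn_compLp u.1.snd.fst,
        Lp.coeFn_zero ℝ 2 (cylMeasure Ω α)] with p h1 h2
      rw [h1, h2]
      simp
    rwa [e, zero_add, one_smul] at this
  have hG : u.1.snd.fst = 0 := by
    have h1 : ∀ i : Fin n, ∀ᵐ p ∂cylMeasure Ω α, u.1.snd.fst p i = 0 := by
      intro i
      have h2 := h0 (EuclideanSpace.single i 1) 0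
      rw [zero_smul, add_zero] at h2
      filter_upwards [(innerSL ℝ (EuclideanSpace.single i (1 : ℝ))).coeFn_compLp u.1.snd.fst,
        Lp.coeFn_zero ℝ 2 (cylMeasure Ω α)] with p h3 h4
      rw [h2, h4] at h3
      simpa [EuclideanSpace.inner_single_left] using h3.symm
    refine (Lp.eq_zero_iff_ae_eq_zero).2 ?_
    filter_upwards [ae_all_iff.2 h1] with p hp
    ext i
    simpa using hp i
  apply Subtype.ext
  apply (WithLp.equiv 2 _).injective
  refine Prod.ext hu ?_
  apply (WithLp.equiv 2 _).injective
  exact Prod.ext hG hg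

/-! ### Smooth elements -/

/-- The space `C_c^∞(Ω × ℝ)`. -/
def TestFn {n : ℕ} (Ω : Set (Eucl n)) : Submodule ℝ (Eucl n × ℝ → ℝ) where
  carrier := {φ | IsTestFunction (Ω ×ˢ univ) φ}
  zero_mem' := ⟨contDiff_const, HasCompactSupport.zero, by simp [tsupport]⟩
  add_mem' {φ ψ} h h' := ⟨h.1.add h'.1, h.2.1.add h'.2.1,
    (tsupport_add φ ψ).trans (union_subset h.2.2 h'.2.2)⟩
  smul_mem' a φ h := ⟨contDiff_const.smul h.1, h.2.1.smul_left (f := fun _ => a),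
    (tsupport_smul_subset_right (fun _ => a) φ).trans h.2.2⟩

/-- The partial gradient `∇ₓ φ`. -/
noncomputable def gradX {n : ℕ} (φ : Eucl n × ℝ → ℝ) (p : Eucl n × ℝ) : Eucl n :=
  (InnerProductSpace.toDual ℝ (Eucl n)).symm
    ((fderiv ℝ φ p).comp (ContinuousLinearMap.inl ℝ (Eucl n) ℝ))

/-- The partial derivative `∂_y φ`. -/
noncomputable def dY {n : ℕ} (φ : Eucl n × ℝ → ℝ) (p : Eucl n × ℝ) : ℝ :=
  fderiv ℝ φ p (0, 1)

theorem inner_gradX_add_dY {n : ℕ} (φ : Eucl n × ℝ → ℝ) (p : Eucl n × ℝ) (v : Eucl n) (t : ℝ) :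
    inner ℝ (gradX φ p) v + dY φ p * t = fderiv ℝ φ p (v, t) := by
  have : ((v, t) : Eucl n × ℝ) = (v, 0) + t • (0, 1) := by simp
  rw [this, map_add, map_smul, gradX, dY]
  simp [mul_comm]

theorem gradX_eq_gradient {n : ℕ} {φ : Eucl n × ℝ → ℝ} (hφ : ContDiff ℝ ∞ φ) (x : Eucl n) (y : ℝ) :
    gradient (fun x' => φ (x', y)) x = gradX φ (x, y) := by
  have h1 : HasFDerivAt (fun x' : Eucl n => (x', y)) (ContinuousLinearMap.inl ℝ (Eucl n) ℝ) x :=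
    hasFDerivAt_prodMk_left x y
  have h2 := ((hφ.differentiable (by simp)) (x, y)).hasFDerivAt.comp x h1
  rw [gradient, gradX]
  congr 1
  exact h2.fderiv

theorem hasDerivAt_dY {n : ℕ} {φ : Eucl n × ℝ → ℝ} (hφ : ContDiff ℝ ∞ φ) (x : Eucl n) (y : ℝ) :
    HasDerivAt (fun y' => φ (x, y')) (dY φ (x, y)) y := by
  have h1 : HasDerivAt (fun y' : ℝ => (x, y')) ((0, 1) : Eucl n × ℝ) y :=
    (hasDerivAt_const y x).prodMk (hasDerivAt_id y)
  exact ((hφ.differentiable (by simp)) (x, y)).hasFDerivAt.comp_hasDerivAt y h1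

theorem continuous_gradX {n : ℕ} {φ : Eucl n × ℝ → ℝ} (hφ : ContDiff ℝ ∞ φ) :
    Continuous (gradX φ) :=
  (InnerProductSpace.toDual ℝ (Eucl n)).symm.continuous.comp
    ((hφ.continuous_fderiv (by simp)).clm_comp continuous_const)

theorem continuous_dY {n : ℕ} {φ : Eucl n × ℝ → ℝ} (hφ : ContDiff ℝ ∞ φ) : Continuous (dY φ) :=
  (hφ.continuous_fderiv (by simp)).clm_apply continuous_const

theorem hasCompactSupport_gradX {n : ℕ} {φ : Eucl n × ℝ → ℝ} (hφ : HasCompactSupport φ) :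
    HasCompactSupport (gradX φ) :=
  (hφ.fderiv ℝ).comp_left
    (g := fun L : Eucl n × ℝ →L[ℝ] ℝ => (InnerProductSpace.toDual ℝ (Eucl n)).symm
      (L.comp (ContinuousLinearMap.inl ℝ (Eucl n) ℝ))) (by simp)

theorem hasCompactSupport_dY {n : ℕ} {φ : Eucl n × ℝ → ℝ} (hφ : HasCompactSupport φ) :
    HasCompactSupport (dY φ) :=
  hφ.fderiv_apply ℝ (0, 1)

theorem memLp_cylMeasure {n : ℕ} (Ω : Set (Eucl n)) {α : ℝ} (hα : -1 < α) {F : Type*}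
    [NormedAddCommGroup F] {f : Eucl n × ℝ → F} (hf : Continuous f) (hs : HasCompactSupport f) :
    MemLp f 2 (cylMeasure Ω α) := by
  have := isLocallyFiniteMeasure_cylMeasure Ω hα
  exact hf.memLp_of_hasCompactSupport hs

/-- A smooth function together with its gradient. -/
noncomputable def smoothTriple {n : ℕ} (Ω : Set (Eucl n)) {α : ℝ} (hα : -1 < α)
    {φ : Eucl n × ℝ → ℝ} (h : ContDiff ℝ ∞ φ) (hs : HasCompactSupport φ) : GradTriple Ω α :=
  WithLp.toLp 2 ((memLp_cylMeasure Ω hα h.continuous hs).toLp φ, WithLp.toLp 2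
    ((memLp_cylMeasure Ω hα (continuous_gradX h) (hasCompactSupport_gradX hs)).toLp (gradX φ),
      (memLp_cylMeasure Ω hα (continuous_dY h) (hasCompactSupport_dY hs)).toLp (dY φ)))

/-- `ψ` is supported inside the open cylinder, so both integrals may be taken over the whole space.
No boundary term appears, although `φ` need not vanish at `y = 0`. -/
theorem setIntegral_mul_fderiv {n : ℕ} {Ω : Set (Eucl n)} {φ ψ : Eucl n × ℝ → ℝ}
    (h : ContDiff ℝ ∞ φ) (hs : HasCompactSupport φ) (hψ : IsTestFunction (openCylinder Ω) ψ)
    (v : Eucl n × ℝ) :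
    ∫ p in openCylinder Ω, φ p * fderiv ℝ ψ p v =
      - ∫ p in openCylinder Ω, fderiv ℝ φ p v * ψ p := by
  have h0 : ∀ p ∉ openCylinder Ω, ψ p = 0 := fun p hp =>
    image_eq_zero_of_notMem_tsupport fun hq => hp (hψ.2.2 hq)
  have h1 : ∀ p ∉ openCylinder Ω, fderiv ℝ ψ p v = 0 := fun p hp =>
    image_eq_zero_of_notMem_tsupport (f := fun p => fderiv ℝ ψ p v)
      fun hq => hp ((hψ.fderiv_apply v).2.2 hq)
  rw [setIntegral_eq_integral_of_forall_compl_eq_zero (fun p hp => by simp [h1 p hp]),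
    setIntegral_eq_integral_of_forall_compl_eq_zero (fun p hp => by simp [h0 p hp])]
  have c1 : Continuous fun p => fderiv ℝ φ p v :=
    (h.continuous_fderiv (by simp)).clm_apply continuous_const
  have c2 : Continuous fun p => fderiv ℝ ψ p v :=
    (hψ.1.continuous_fderiv (by simp)).clm_apply continuous_const
  refine integral_mul_fderiv_eq_neg_fderiv_mul_of_integrable ?_ ?_ ?_
    (fun x _ => h.differentiable (by simp) x) (fun x _ => hψ.1.differentiable (by simp) x)
  · exact (c1.mul hψ.1.continuous).integrable_of_hasCompactSupport hψ.2.1.mul_left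
  · exact (h.continuous.mul c2).integrable_of_hasCompactSupport hs.mul_right
  · exact (h.continuous.mul hψ.1.continuous).integrable_of_hasCompactSupport hs.mul_right

theorem smoothTriple_mem {n : ℕ} {Ω : Set (Eucl n)} (hΩ : IsOpen Ω) {α : ℝ} (hα : -1 < α)
    {φ : Eucl n × ℝ → ℝ} (h : ContDiff ℝ ∞ φ) (hs : HasCompactSupport φ) :
    smoothTriple Ω hα h hs ∈ H1Weighted Ω α := by
  intro ψ hψ v t
  have e0 := MemLp.coeFn_toLp (memLp_cylMeasure Ω hα h.continuous hs)
  have e1 := MemLp.coeFn_toLp (memLp_cylMeasure Ω hα (continuous_gradX h)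
    (hasCompactSupport_gradX hs))
  have e2 := MemLp.coeFn_toLp (memLp_cylMeasure Ω hα (continuous_dY h) (hasCompactSupport_dY hs))
  have e : ∀ᵐ p ∂volume.restrict (openCylinder Ω), (smoothTriple Ω hα h hs).fst p = φ p ∧
      (smoothTriple Ω hα h hs).snd.fst p = gradX φ p ∧
      (smoothTriple Ω hα h hs).snd.snd p = dY φ p := by
    rw [← ae_cylMeasure_iff hΩ α]
    filter_upwards [e0, e1, e2] with p h0 h1 h2
    exact ⟨h0, h1, h2⟩
  have s1 : ∫ p in openCylinder Ω, (smoothTriple Ω hα h hs).fst p * fderiv ℝ ψ p (v, t) =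
      ∫ p in openCylinder Ω, φ p * fderiv ℝ ψ p (v, t) := by
    refine integral_congr_ae ?_
    filter_upwards [e] with p hp
    rw [hp.1]
  have s2 : ∫ p in openCylinder Ω, (inner ℝ ((smoothTriple Ω hα h hs).snd.fst p) v +
      (smoothTriple Ω hα h hs).snd.snd p * t) * ψ p =
      ∫ p in openCylinder Ω, fderiv ℝ φ p (v, t) * ψ p := by
    refine integral_congr_ae ?_
    filter_upwards [e] with p hp
    rw [hp.2.1, hp.2.2, inner_gradX_add_dY]
  rw [s1, s2, setIntegral_mul_fderiv h hs hψ]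

/-- The elements of `H¹_L(y^α, C)` given by `C_c^∞(Ω × ℝ)`. -/
noncomputable def smoothElt {n : ℕ} {Ω : Set (Eucl n)} (hΩ : IsOpen Ω) {α : ℝ} (hα : -1 < α) :
    TestFn Ω →ₗ[ℝ] HL Ω α where
  toFun φ := ⟨⟨smoothTriple Ω hα φ.2.1 φ.2.2.1, smoothTriple_mem hΩ hα φ.2.1 φ.2.2.1⟩,
    Submodule.le_topologicalClosure _ (Submodule.subset_span ⟨φ, φ.2,
      (memLp_cylMeasure Ω hα φ.2.1.continuous φ.2.2.1).coeFn_toLp⟩)⟩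
  -- Linearity has to be checked on the function component only, since it determines the gradient.
  map_add' φ ψ := by
    apply Subtype.ext
    exact H1Weighted.ext_fst hΩ rfl
  map_smul' a φ := by
    apply Subtype.ext
    exact H1Weighted.ext_fst hΩ rfl

/-- `HL` is the closure of a span of elements known only through their function component.
Uniqueness of the weak gradient identifies each generator with a smooth triple, and these already
form a subspace. -/
theorem denseRange_smoothElt {n : ℕ} {Ω : Set (Eucl n)} (hΩ : IsOpen Ω) {α : ℝ} (hα : -1 < α) :
    DenseRange (smoothElt hΩ hα) := by
  intro w
  rw [closure_subtype]
  refine closure_mono ?_ w.2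
  have : Submodule.span ℝ {w : H1Weighted Ω α | ∃ φ : Eucl n × ℝ → ℝ,
      IsTestFunction (Ω ×ˢ univ) φ ∧ w.1.fst =ᵐ[cylMeasure Ω α] φ} ≤
      LinearMap.range ((HL Ω α).subtype ∘ₗ smoothElt hΩ hα) := by
    rw [Submodule.span_le]
    rintro u ⟨φ, hφ, he⟩
    refine ⟨⟨φ, hφ⟩, H1Weighted.ext_fst hΩ (Lp.ext ?_)⟩
    exact (memLp_cylMeasure Ω hα hφ.1.continuous hφ.2.1).coeFn_toLp.trans he.symm
  rintro u hu
  obtain ⟨φ, rfl⟩ := this hu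
  exact ⟨_, ⟨φ, rfl⟩, rfl⟩

/-! ### Norms as integrals -/

theorem enorm_sq_Lp {X F : Type*} [MeasurableSpace X] [NormedAddCommGroup F] {μ : Measure X}
    (w : Lp F 2 μ) : ‖w‖ₑ ^ 2 = ∫⁻ p, ‖w p‖ₑ ^ 2 ∂μ := by
  rw [Lp.enorm_def, eLpNorm_eq_lintegral_rpow_enorm_toReal (by simp) (by simp)]
  rw [← ENNReal.rpow_natCast, ← ENNReal.rpow_mul]
  simp

theorem enorm_sq_toLp {X F : Type*} [MeasurableSpace X] [NormedAddCommGroup F] {μ : Measure X}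
    {f : X → F} (hf : MemLp f 2 μ) : ‖hf.toLp f‖ₑ ^ 2 = ∫⁻ p, ‖f p‖ₑ ^ 2 ∂μ := by
  rw [enorm_sq_Lp]
  refine lintegral_congr_ae ?_
  filter_upwards [hf.coeFn_toLp] with p hp
  rw [hp]

theorem enorm_sq_withLp {E F : Type*} [NormedAddCommGroup E] [NormedAddCommGroup F]
    (w : WithLp 2 (E × F)) : ‖w‖ₑ ^ 2 = ‖w.fst‖ₑ ^ 2 + ‖w.snd‖ₑ ^ 2 := by
  simp only [← ofReal_norm, ← ENNReal.ofReal_pow (norm_nonneg _)]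
  rw [← ENNReal.ofReal_add (by positivity) (by positivity), WithLp.prod_norm_sq_eq_of_L2]

theorem enorm_sq_HL {n : ℕ} {Ω : Set (Eucl n)} {α : ℝ} (w : HL Ω α) :
    ‖w‖ₑ ^ 2 = ‖w.1.1.fst‖ₑ ^ 2 + (‖w.1.1.snd.fst‖ₑ ^ 2 + ‖w.1.1.snd.snd‖ₑ ^ 2) := by
  rw [← enorm_sq_withLp, ← enorm_sq_withLp]
  rfl

theorem enorm_sq_smoothElt {n : ℕ} {Ω : Set (Eucl n)} (hΩ : IsOpen Ω) {α : ℝ} (hα : -1 < α)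
    (φ : TestFn Ω) :
    ‖smoothElt hΩ hα φ‖ₑ ^ 2 = ∫⁻ p, ‖φ.1 p‖ₑ ^ 2 ∂cylMeasure Ω α +
      (∫⁻ p, ‖gradX φ.1 p‖ₑ ^ 2 ∂cylMeasure Ω α + ∫⁻ p, ‖dY φ.1 p‖ₑ ^ 2 ∂cylMeasure Ω α) := by
  rw [enorm_sq_HL]
  exact congrArg₂ (· + ·) (enorm_sq_toLp (memLp_cylMeasure Ω hα φ.2.1.continuous φ.2.2.1))
    (congrArg₂ (· + ·)
      (enorm_sq_toLp (memLp_cylMeasure Ω hα (continuous_gradX φ.2.1)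
        (hasCompactSupport_gradX φ.2.2.1)))
      (enorm_sq_toLp (memLp_cylMeasure Ω hα (continuous_dY φ.2.1)
        (hasCompactSupport_dY φ.2.2.1))))

theorem lintegral_cylMeasure {n : ℕ} (Ω : Set (Eucl n)) (α : ℝ) {f : Eucl n × ℝ → ℝ≥0∞}
    (hf : Measurable f) :
    ∫⁻ p, f p ∂cylMeasure Ω α = ∫⁻ x in Ω, ∫⁻ y, f (x, y) ∂powerMeasure α := by
  rw [cylMeasure_eq_prod, lintegral_prod _ hf.aemeasurable]

theorem lintegral_powerMeasure (α : ℝ) {f : ℝ → ℝ≥0∞} (hf : Measurable f) :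
    ∫⁻ y, f y ∂powerMeasure α = ∫⁻ y in Ioi 0, ENNReal.ofReal (y ^ α) * f y := by
  rw [powerMeasure, lintegral_withDensity_eq_lintegral_mul _ (measurable_ofReal_rpow α) hf]
  rfl

/-! ### One-dimensional weighted inequalities -/

theorem enorm_sq_real (a : ℝ) : ‖a‖ₑ ^ 2 = ENNReal.ofReal (a ^ 2) := by
  rw [← ofReal_norm, ← ENNReal.ofReal_pow (norm_nonneg _), Real.norm_eq_abs, sq_abs]

theorem enorm_sq_le_two_mul (a b : ℝ) : ‖a‖ₑ ^ 2 ≤ 2 * ‖b‖ₑ ^ 2 + 2 * ‖b - a‖ₑ ^ 2 := by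
  rw [enorm_sq_real, enorm_sq_real, enorm_sq_real, ← ENNReal.ofReal_ofNat,
    ← ENNReal.ofReal_mul (by norm_num), ← ENNReal.ofReal_mul (by norm_num),
    ← ENNReal.ofReal_add (by positivity) (by positivity)]
  exact ENNReal.ofReal_le_ofReal (by nlinarith [sq_nonneg (2 * b - a)])

theorem lintegral_rpow_Ioc {a : ℝ} (ha : -1 < a) {y : ℝ} (hy : 0 ≤ y) :
    ∫⁻ t in Ioc 0 y, ENNReal.ofReal (t ^ a) = ENNReal.ofReal (y ^ (a + 1) / (a + 1)) := by
  have h : IntegrableOn (fun y : ℝ => y ^ a) (Ioc 0 y) :=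
    (intervalIntegrable_iff_integrableOn_Ioc_of_le hy).1
      (intervalIntegral.intervalIntegrable_rpow' ha)
  rw [← ofReal_integral_eq_lintegral_ofReal h, ← intervalIntegral.integral_of_le hy,
    integral_rpow (Or.inl ha), Real.zero_rpow (by linarith), sub_zero]
  filter_upwards [ae_restrict_mem measurableSet_Ioc] with t ht
  exact Real.rpow_nonneg ht.1.le a

theorem lintegral_powerMeasure_Ioc_le (α : ℝ) {f : ℝ → ℝ≥0∞} (hf : Measurable f) (y : ℝ) :
    ∫⁻ t in Ioc 0 y, ENNReal.ofReal (t ^ α) * f t ≤ ∫⁻ t, f t ∂powerMeasure α := by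
  rw [lintegral_powerMeasure α hf]
  exact lintegral_mono_set fun t ht => ht.1

/-- Fundamental theorem of calculus, then Cauchy–Schwarz after writing `1 = t^{-α/2} t^{α/2}`. The
factor `t^{-α}` is integrable at `0` because `α < 1`. -/
theorem enorm_sub_zero_sq_le {α : ℝ} (hα : α < 1) {f f' : ℝ → ℝ}
    (hf : ∀ y, HasDerivAt f (f' y) y) (hc : Continuous f') {y : ℝ} (hy : 0 < y) :
    ‖f y - f 0‖ₑ ^ 2 ≤
      ENNReal.ofReal (y ^ (1 - α) / (1 - α)) * ∫⁻ t, ‖f' t‖ₑ ^ 2 ∂powerMeasure α := by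
  have h1 : ‖f y - f 0‖ₑ ≤ ∫⁻ t in Ioc 0 y, ‖f' t‖ₑ := by
    rw [← intervalIntegral.integral_eq_sub_of_hasDerivAt (fun x _ => hf x)
      (hc.intervalIntegrable 0 y), intervalIntegral.integral_of_le hy.le]
    exact enorm_integral_le_lintegral_enorm _
  have h2 : ∫⁻ t in Ioc 0 y, ‖f' t‖ₑ =
      ∫⁻ t in Ioc 0 y, ((fun t => ENNReal.ofReal (t ^ (-α / 2))) *
        fun t => ENNReal.ofReal (t ^ (α / 2)) * ‖f' t‖ₑ) t := by
    refine setLIntegral_congr_fun measurableSet_Ioc fun t ht => ?_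
    simp only [Pi.mul_apply]
    rw [← mul_assoc, ← ENNReal.ofReal_mul (Real.rpow_nonneg ht.1.le _), ← Real.rpow_add ht.1]
    simp [neg_div]
  have h3 := ENNReal.lintegral_mul_le_Lp_mul_Lq (volume.restrict (Ioc 0 y))
    (Real.HolderConjugate.two_two)
    (f := fun t => ENNReal.ofReal (t ^ (-α / 2)))
    (g := fun t => ENNReal.ofReal (t ^ (α / 2)) * ‖f' t‖ₑ)
    (measurable_ofReal_rpow _).aemeasurable
    ((measurable_ofReal_rpow _).mul hc.enorm.measurable).aemeasurable
  have sqr : ∀ a : ℝ≥0∞, (a ^ (1 / (2 : ℝ))) ^ 2 = a := by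
    intro a
    rw [← ENNReal.rpow_natCast, ← ENNReal.rpow_mul]
    simp
  have h4 : ∫⁻ t in Ioc 0 y, ENNReal.ofReal (t ^ (-α / 2)) ^ (2 : ℝ) =
      ENNReal.ofReal (y ^ (1 - α) / (1 - α)) := by
    have e := lintegral_rpow_Ioc (a := -α) (by linarith) hy.le
    rw [show -α + 1 = 1 - α by ring] at e
    rw [← e]
    refine setLIntegral_congr_fun measurableSet_Ioc fun t ht => ?_
    rw [ENNReal.ofReal_rpow_of_nonneg (Real.rpow_nonneg ht.1.le _) (by norm_num),
      ← Real.rpow_mul ht.1.le]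
    norm_num
  have h5 : ∫⁻ t in Ioc 0 y, (ENNReal.ofReal (t ^ (α / 2)) * ‖f' t‖ₑ) ^ (2 : ℝ) ≤
      ∫⁻ t, ‖f' t‖ₑ ^ 2 ∂powerMeasure α := by
    refine le_trans (le_of_eq ?_) (lintegral_powerMeasure_Ioc_le α
      (f := fun t => ‖f' t‖ₑ ^ 2) (hc.enorm.measurable.pow_const 2) y)
    refine setLIntegral_congr_fun measurableSet_Ioc fun t ht => ?_
    rw [ENNReal.mul_rpow_of_nonneg _ _ (by norm_num),
      ENNReal.ofReal_rpow_of_nonneg (Real.rpow_nonneg ht.1.le _) (by norm_num),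
      ← Real.rpow_mul ht.1.le, ENNReal.rpow_two]
    norm_num
  calc ‖f y - f 0‖ₑ ^ 2 ≤ ((∫⁻ t in Ioc 0 y, ENNReal.ofReal (t ^ (-α / 2)) ^ (2 : ℝ)) ^
        (1 / (2 : ℝ)) * (∫⁻ t in Ioc 0 y, (ENNReal.ofReal (t ^ (α / 2)) * ‖f' t‖ₑ) ^ (2 : ℝ)) ^
        (1 / (2 : ℝ))) ^ 2 := by
        gcongr
        exact h1.trans (h2.le.trans h3)
    _ = (∫⁻ t in Ioc 0 y, ENNReal.ofReal (t ^ (-α / 2)) ^ (2 : ℝ)) *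
        ∫⁻ t in Ioc 0 y, (ENNReal.ofReal (t ^ (α / 2)) * ‖f' t‖ₑ) ^ (2 : ℝ) := by
        rw [mul_pow, sqr, sqr]
    _ ≤ _ := by
        rw [h4]
        gcongr

/-- Integrate `|f(0)|² ≤ 2 |f(t)|² + 2 |f(t) - f(0)|²` against `t^α` over `(0, R]`. By the previous
estimate the last term carries `t^α t^{1-α} = t`, which produces the factor `R²`. -/
theorem enorm_zero_sq_le_of_pos {α : ℝ} (hα : -1 < α) (hα' : α < 1) {f f' : ℝ → ℝ}
    (hf : ∀ y, HasDerivAt f (f' y) y) (hc : Continuous f') {R : ℝ} (hR : 0 < R) :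
    ENNReal.ofReal (R ^ (1 + α) / (1 + α)) * ‖f 0‖ₑ ^ 2 ≤
      2 * ∫⁻ t, ‖f t‖ₑ ^ 2 ∂powerMeasure α +
        ENNReal.ofReal (R ^ 2 / (1 - α)) * ∫⁻ t, ‖f' t‖ₑ ^ 2 ∂powerMeasure α := by
  set D := ∫⁻ t, ‖f' t‖ₑ ^ 2 ∂powerMeasure α
  have hfc : Continuous f := continuous_iff_continuousAt.2 fun y => (hf y).continuousAt
  have hm : Measurable fun t => ‖f t‖ₑ ^ 2 := hfc.enorm.measurable.pow_const 2
  have e1 := lintegral_rpow_Ioc hα hR.le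
  rw [add_comm α 1] at e1
  have hα1 : 0 < 1 - α := by linarith
  have e2 : ∫⁻ t in Ioc 0 R, ENNReal.ofReal (2 * t / (1 - α)) = ENNReal.ofReal (R ^ 2 / (1 - α)) := by
    have h := lintegral_rpow_Ioc (a := 1) (by norm_num) hR.le
    simp only [Real.rpow_one] at h
    have : ∀ t : ℝ, ENNReal.ofReal (2 * t / (1 - α)) =
        ENNReal.ofReal (2 / (1 - α)) * ENNReal.ofReal t := by
      intro t
      rw [← ENNReal.ofReal_mul (by positivity)]
      congr 1
      ring
    simp only [this]
    rw [lintegral_const_mul _ ENNReal.measurable_ofReal, h, ← ENNReal.ofReal_mul (by positivity)]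
    congr 1
    norm_num
  calc ENNReal.ofReal (R ^ (1 + α) / (1 + α)) * ‖f 0‖ₑ ^ 2
      = ∫⁻ t in Ioc 0 R, ENNReal.ofReal (t ^ α) * ‖f 0‖ₑ ^ 2 := by
        rw [lintegral_mul_const _ (measurable_ofReal_rpow α), e1]
    _ ≤ ∫⁻ t in Ioc 0 R, (2 * (ENNReal.ofReal (t ^ α) * ‖f t‖ₑ ^ 2) +
          ENNReal.ofReal (2 * t / (1 - α)) * D) := by
        refine setLIntegral_mono' measurableSet_Ioc fun t ht => ?_
        have h := (enorm_sq_le_two_mul (f 0) (f t)).trans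
          (add_le_add le_rfl (mul_le_mul_right (enorm_sub_zero_sq_le hα' hf hc ht.1) 2))
        calc ENNReal.ofReal (t ^ α) * ‖f 0‖ₑ ^ 2
            ≤ ENNReal.ofReal (t ^ α) * (2 * ‖f t‖ₑ ^ 2 +
              2 * (ENNReal.ofReal (t ^ (1 - α) / (1 - α)) * D)) := by gcongr
          _ = 2 * (ENNReal.ofReal (t ^ α) * ‖f t‖ₑ ^ 2) +
              (2 * (ENNReal.ofReal (t ^ α) * ENNReal.ofReal (t ^ (1 - α) / (1 - α)))) * D := by
              ring
          _ = _ := by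
              congr 2
              rw [← ENNReal.ofReal_ofNat, ← ENNReal.ofReal_mul (Real.rpow_nonneg ht.1.le _),
                ← ENNReal.ofReal_mul (by norm_num), ← mul_div_assoc, ← Real.rpow_add ht.1]
              simp [mul_div_assoc]
    _ = 2 * (∫⁻ t in Ioc 0 R, ENNReal.ofReal (t ^ α) * ‖f t‖ₑ ^ 2) +
          ENNReal.ofReal (R ^ 2 / (1 - α)) * D := by
        have hm2 : Measurable fun t => ENNReal.ofReal (t ^ α) * ‖f t‖ₑ ^ 2 :=
          (measurable_ofReal_rpow α).mul hm
        rw [lintegral_add_left (hm2.const_mul 2), lintegral_const_mul _ hm2,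
          lintegral_mul_const _ (by fun_prop), e2]
    _ ≤ _ := by
        exact add_le_add (mul_le_mul_right (lintegral_powerMeasure_Ioc_le α hm R) 2) le_rfl

/-- `s ∈ (0, 1)` and `α = 1 - 2 s`. -/
structure FracExponent (s α : ℝ) : Prop where
  pos : 0 < s
  lt_one : s < 1
  eq : α = 1 - 2 * s

theorem FracExponent.neg_one_lt {s α : ℝ} (h : FracExponent s α) : -1 < α := by
  linarith [h.lt_one, h.eq]

theorem FracExponent.one_sub {s α : ℝ} (h : FracExponent s α) : 1 - α = 2 * s := by
  linarith [h.eq]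

/-- The fractional trace inequality on the half-line. -/
theorem rpow_mul_enorm_zero_sq_le {s α : ℝ} (h : FracExponent s α) {f f' : ℝ → ℝ}
    (hf : ∀ y, HasDerivAt f (f' y) y) (hc : Continuous f') {lam : ℝ} (hlam : 0 ≤ lam) :
    ENNReal.ofReal (lam ^ s) * ‖f 0‖ₑ ^ 2 ≤ ENNReal.ofReal (4 + 1 / s) *
      (ENNReal.ofReal lam * ∫⁻ t, ‖f t‖ₑ ^ 2 ∂powerMeasure α +
        ∫⁻ t, ‖f' t‖ₑ ^ 2 ∂powerMeasure α) := by
  obtain ⟨hs, hs', rfl⟩ := h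
  rcases hlam.eq_or_lt with rfl | hlam
  · simp [Real.zero_rpow hs.ne']
  -- The choice `R = λ^{-1/2}` balances the two terms: after multiplication by `λ (2 - 2s)` the left
  -- side carries exactly `λˢ`, because `R^{1+α} = λ^{s-1}`.
  have h := enorm_zero_sq_le_of_pos (α := 1 - 2 * s) (by linarith) (by linarith) hf hc
    (R := lam ^ (-(1 / 2) : ℝ)) (by positivity)
  have e1 : (lam ^ (-(1 / 2) : ℝ)) ^ (1 + (1 - 2 * s)) / (1 + (1 - 2 * s)) =
      lam⁻¹ * (lam ^ s / (2 - 2 * s)) := by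
    rw [← Real.rpow_mul hlam.le, ← Real.rpow_neg_one, ← mul_div_assoc, ← Real.rpow_add hlam,
      show 1 + (1 - 2 * s) = 2 - 2 * s by ring,
      show -(1 / 2 : ℝ) * (2 - 2 * s) = -1 + s by ring]
  have e2 : (lam ^ (-(1 / 2) : ℝ)) ^ 2 / (1 - (1 - 2 * s)) = lam⁻¹ * (1 / (2 * s)) := by
    rw [← Real.rpow_natCast, ← Real.rpow_mul hlam.le, ← Real.rpow_neg_one]
    norm_num
    ring
  rw [e1, e2] at h
  set F := ∫⁻ t, ‖f t‖ₑ ^ 2 ∂powerMeasure (1 - 2 * s)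
  set D := ∫⁻ t, ‖f' t‖ₑ ^ 2 ∂powerMeasure (1 - 2 * s)
  have hs2 : 0 < 2 - 2 * s := by linarith
  have hsp : 0 < 1 / s := by positivity
  calc ENNReal.ofReal (lam ^ s) * ‖f 0‖ₑ ^ 2
      = ENNReal.ofReal (lam * (2 - 2 * s)) *
        (ENNReal.ofReal (lam⁻¹ * (lam ^ s / (2 - 2 * s))) * ‖f 0‖ₑ ^ 2) := by
        rw [← mul_assoc, ← ENNReal.ofReal_mul (by positivity)]
        congr 2
        field_simp
        rw [div_self (sub_pos.2 hs').ne']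
    _ ≤ ENNReal.ofReal (lam * (2 - 2 * s)) * (2 * F + ENNReal.ofReal (lam⁻¹ * (1 / (2 * s))) * D) := by
        gcongr
    _ = ENNReal.ofReal ((2 - 2 * s) * 2) * (ENNReal.ofReal lam * F) +
        ENNReal.ofReal ((2 - 2 * s) * (1 / (2 * s))) * D := by
        rw [mul_add, ← mul_assoc, ← mul_assoc, ← mul_assoc, ← ENNReal.ofReal_mul (by positivity),
          ← ENNReal.ofReal_mul (by positivity), ← ENNReal.ofReal_ofNat,
          ← ENNReal.ofReal_mul (by positivity)]
        congr 3
        · ring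
        · field_simp
    _ ≤ ENNReal.ofReal (4 + 1 / s) * (ENNReal.ofReal lam * F) + ENNReal.ofReal (4 + 1 / s) * D := by
        gcongr
        · linarith
        · have : (2 - 2 * s) * (1 / (2 * s)) = 1 / s - 1 := by
            field_simp
          linarith
    _ = _ := by ring

/-! ### The trace operator -/

theorem hasCompactSupport_section {X F : Type*} [TopologicalSpace X] [T2Space X] [Zero F]
    {f : X × ℝ → F} (hf : HasCompactSupport f) (y : ℝ) : HasCompactSupport fun x => f (x, y) := by
  refine HasCompactSupport.intro (K := Prod.fst '' tsupport f) (hf.isCompact.image continuous_fst)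
    fun x hx => ?_
  exact image_eq_zero_of_notMem_tsupport fun h => hx ⟨_, h, rfl⟩

theorem memLp_section {n : ℕ} (Ω : Set (Eucl n)) {F : Type*} [NormedAddCommGroup F]
    {f : Eucl n × ℝ → F} (hf : Continuous f) (hs : HasCompactSupport f) (y : ℝ) :
    MemLp (fun x => f (x, y)) 2 (volume.restrict Ω) :=
  (hf.comp (Continuous.prodMk_left y)).memLp_of_hasCompactSupport (hasCompactSupport_section hs y)

/-- Restriction of smooth functions to `Ω × {0}`. -/
noncomputable def smoothTrace {n : ℕ} (Ω : Set (Eucl n)) : TestFn Ω →ₗ[ℝ] L2 Ω where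
  toFun φ := (memLp_section Ω φ.2.1.continuous φ.2.2.1 0).toLp _
  map_add' _ _ := rfl
  map_smul' _ _ := rfl

theorem norm_le_of_enorm_sq_le {E F : Type*} [NormedAddCommGroup E] [NormedAddCommGroup F]
    {a : E} {b : F} {C : ℝ} (hC : 0 ≤ C) (h : ‖a‖ₑ ^ 2 ≤ ENNReal.ofReal C * ‖b‖ₑ ^ 2) :
    ‖a‖ ≤ √C * ‖b‖ := by
  rw [← ofReal_norm, ← ofReal_norm, ← ENNReal.ofReal_pow (norm_nonneg _),
    ← ENNReal.ofReal_pow (norm_nonneg _), ← ENNReal.ofReal_mul hC,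
    ENNReal.ofReal_le_ofReal_iff (by positivity)] at h
  refine le_of_sq_le_sq ?_ (by positivity)
  rwa [mul_pow, Real.sq_sqrt hC]

/-- The half-line inequality with `λ = 1` on each vertical line, integrated over `x`. This bound is
what lets the trace extend by density. -/
theorem smoothTrace_bound {n : ℕ} {Ω : Set (Eucl n)} (hΩ : IsOpen Ω) {s α : ℝ}
    (hs : FracExponent s α) (φ : TestFn Ω) :
    ‖smoothTrace Ω φ‖ ≤ √(4 + 1 / s) * ‖smoothElt hΩ hs.neg_one_lt φ‖ := by
  have hs0 := hs.pos
  refine norm_le_of_enorm_sq_le (by positivity) ?_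
  have hm1 : Measurable fun p => ‖φ.1 p‖ₑ ^ 2 := φ.2.1.continuous.enorm.measurable.pow_const 2
  have hm2 : Measurable fun p => ‖dY φ.1 p‖ₑ ^ 2 :=
    (continuous_dY φ.2.1).enorm.measurable.pow_const 2
  calc ‖smoothTrace Ω φ‖ₑ ^ 2
      = ∫⁻ x in Ω, ‖φ.1 (x, 0)‖ₑ ^ 2 :=
        enorm_sq_toLp (memLp_section Ω φ.2.1.continuous φ.2.2.1 0)
    _ ≤ ∫⁻ x in Ω, ENNReal.ofReal (4 + 1 / s) *
          (∫⁻ y, ‖φ.1 (x, y)‖ₑ ^ 2 ∂powerMeasure α +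
          ∫⁻ y, ‖dY φ.1 (x, y)‖ₑ ^ 2 ∂powerMeasure α) := by
        refine lintegral_mono fun x => ?_
        have := rpow_mul_enorm_zero_sq_le hs (hasDerivAt_dY φ.2.1 x)
          ((continuous_dY φ.2.1).comp (Continuous.prodMk_right x)) zero_le_one
        simpa using this
    _ = ENNReal.ofReal (4 + 1 / s) * (∫⁻ p, ‖φ.1 p‖ₑ ^ 2 ∂cylMeasure Ω α +
          ∫⁻ p, ‖dY φ.1 p‖ₑ ^ 2 ∂cylMeasure Ω α) := by
        rw [lintegral_const_mul' _ _ ENNReal.ofReal_ne_top,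
          lintegral_add_left hm1.lintegral_prod_right', lintegral_cylMeasure _ _ hm1,
          lintegral_cylMeasure _ _ hm2]
    _ ≤ _ := by
        rw [enorm_sq_smoothElt]
        gcongr
        exact le_add_self

/-- The continuous trace operator. -/
noncomputable def trOp {n : ℕ} {Ω : Set (Eucl n)} (hΩ : IsOpen Ω) {s α : ℝ}
    (hs : FracExponent s α) : HL Ω α →L[ℝ] L2 Ω :=
  (smoothTrace Ω).extendOfNorm (smoothElt hΩ hs.neg_one_lt)

theorem trOp_smoothElt {n : ℕ} {Ω : Set (Eucl n)} (hΩ : IsOpen Ω) {s α : ℝ}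
    (hs : FracExponent s α) (φ : TestFn Ω) :
    trOp hΩ hs (smoothElt hΩ hs.neg_one_lt φ) = smoothTrace Ω φ :=
  LinearMap.extendOfNorm_eq (denseRange_smoothElt hΩ _) ⟨_, smoothTrace_bound hΩ hs⟩ φ

theorem exists_subseq_tendsto_ae {X F : Type*} [MeasurableSpace X] [NormedAddCommGroup F]
    {μ : Measure X} {u : ℕ → Lp F 2 μ} {u₀ : Lp F 2 μ} (h : Tendsto u atTop (𝓝 u₀)) :
    ∃ σ : ℕ → ℕ, StrictMono σ ∧ ∀ᵐ p ∂μ, Tendsto (fun k => u (σ k) p) atTop (𝓝 (u₀ p)) :=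
  (tendstoInMeasure_of_tendsto_Lp h).exists_seq_tendsto_ae

theorem exists_seq_tendsto_of_denseRange {X Y : Type*} [TopologicalSpace Y] [FrechetUrysohnSpace Y]
    {f : X → Y} (h : DenseRange f) (y : Y) :
    ∃ x : ℕ → X, Tendsto (fun k => f (x k)) atTop (𝓝 y) := by
  obtain ⟨u, hu, hlim⟩ := mem_closure_iff_seq_limit.1 (h y)
  choose x hx using hu
  exact ⟨x, by simpa only [hx] using hlim⟩

theorem continuous_fst_HL {n : ℕ} {Ω : Set (Eucl n)} {α : ℝ} :
    Continuous fun w : HL Ω α => w.1.1.fst :=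
  (WithLp.continuous_fst _ _ _).comp (continuous_subtype_val.comp continuous_subtype_val)

theorem smoothTrace_ae {n : ℕ} {Ω : Set (Eucl n)} (φ : TestFn Ω) :
    ∀ᵐ x ∂volume.restrict Ω, smoothTrace Ω φ x = φ.1 (x, 0) :=
  (memLp_section Ω φ.2.1.continuous φ.2.2.1 0).coeFn_toLp

theorem fst_smoothElt_ae {n : ℕ} {Ω : Set (Eucl n)} (hΩ : IsOpen Ω) {α : ℝ} (hα : -1 < α)
    (φ : TestFn Ω) :
    ∀ᵐ p ∂cylMeasure Ω α, (smoothElt hΩ hα φ).1.1.fst p = φ.1 p :=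
  (memLp_cylMeasure Ω hα φ.2.1.continuous φ.2.2.1).coeFn_toLp

theorem exists_smoothElt_tendsto {n : ℕ} {Ω : Set (Eucl n)} (hΩ : IsOpen Ω) {α : ℝ} (hα : -1 < α)
    (w : HL Ω α) :
    ∃ φ : ℕ → TestFn Ω, Tendsto (fun k => smoothElt hΩ hα (φ k)) atTop (𝓝 w) :=
  exists_seq_tendsto_of_denseRange (denseRange_smoothElt hΩ hα) w

theorem exists_smooth_seq_tendsto_ae {n : ℕ} {Ω : Set (Eucl n)} (hΩ : IsOpen Ω) {α : ℝ}
    (hα : -1 < α) (w : HL Ω α) :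
    ∃ φ : ℕ → TestFn Ω, Tendsto (fun k => smoothElt hΩ hα (φ k)) atTop (𝓝 w) ∧
      ∀ᵐ p ∂volume.restrict (openCylinder Ω),
        Tendsto (fun k => (φ k).1 p) atTop (𝓝 (cylFun w p)) := by
  obtain ⟨ψ, hlim⟩ := exists_smoothElt_tendsto hΩ hα w
  have l1 : Tendsto (fun k => (smoothElt hΩ hα (ψ k)).1.1.fst) atTop
    (𝓝 w.1.1.fst) := (continuous_fst_HL.tendsto w).comp hlim
  obtain ⟨σ, hσ, h1⟩ := exists_subseq_tendsto_ae l1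
  refine ⟨fun k => ψ (σ k), hlim.comp hσ.tendsto_atTop, ?_⟩
  rw [← ae_cylMeasure_iff hΩ α]
  have h3 := ae_all_iff.2 fun k => fst_smoothElt_ae hΩ hα (ψ k)
  filter_upwards [h1, h3] with p hp hp3
  exact hp.congr fun k => hp3 (σ k)

theorem exists_subseq_smoothTrace {n : ℕ} {Ω : Set (Eucl n)} {ψ : ℕ → TestFn Ω} {g : L2 Ω}
    (h : Tendsto (fun k => smoothTrace Ω (ψ k)) atTop (𝓝 g)) :
    ∃ σ : ℕ → ℕ, StrictMono σ ∧
      ∀ᵐ x ∂volume.restrict Ω, Tendsto (fun k => (ψ (σ k)).1 (x, 0)) atTop (𝓝 (g x)) := by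
  obtain ⟨σ, hσ, h2⟩ := exists_subseq_tendsto_ae h
  refine ⟨σ, hσ, ?_⟩
  have h3 := ae_all_iff.2 fun k => smoothTrace_ae (ψ k)
  filter_upwards [h2, h3] with p hp hp3
  exact hp.congr fun k => hp3 (σ k)

theorem exists_smooth_seq {n : ℕ} {Ω : Set (Eucl n)} (hΩ : IsOpen Ω) {s α : ℝ}
    (hs : FracExponent s α) (w : HL Ω α) :
    ∃ φ : ℕ → TestFn Ω, Tendsto (fun k => smoothElt hΩ hs.neg_one_lt (φ k)) atTop (𝓝 w) ∧
      (∀ᵐ p ∂volume.restrict (openCylinder Ω),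
        Tendsto (fun k => (φ k).1 p) atTop (𝓝 (cylFun w p))) ∧
      ∀ᵐ x ∂volume.restrict Ω, Tendsto (fun k => (φ k).1 (x, 0)) atTop (𝓝 (trOp hΩ hs w x)) := by
  obtain ⟨ψ, hlim, h1⟩ := exists_smooth_seq_tendsto_ae hΩ hs.neg_one_lt w
  have l2 : Tendsto (fun k => smoothTrace Ω (ψ k)) atTop (𝓝 (trOp hΩ hs w)) :=
    (((trOp hΩ hs).continuous.tendsto w).comp hlim).congr fun k => trOp_smoothElt hΩ hs (ψ k)
  obtain ⟨σ, hσ, h2⟩ := exists_subseq_smoothTrace l2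
  refine ⟨fun k => ψ (σ k), hlim.comp hσ.tendsto_atTop, ?_, h2⟩
  filter_upwards [h1] with p hp
  exact hp.comp hσ.tendsto_atTop

theorem volume_restrict_prod_Ioo {n : ℕ} (Ω : Set (Eucl n)) (δ : ℝ) :
    (volume : Measure (Eucl n × ℝ)).restrict (Ω ×ˢ Ioo 0 δ) =
      (volume.restrict Ω).prod (volume.restrict (Ioo 0 δ)) := by
  rw [Measure.prod_restrict]
  rfl

/-- On each vertical line `|φ(x,y) - φ(x,0)|²` is at most `y^{2s}/(2s)` times the weighted energy of
`∂_y φ`. Integration over a height `δ` gives one factor `δ`; the surplus `δ^{2s}` makes the average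
over the slab vanish as `δ → 0`. -/
theorem lintegral_slab_smooth_le {n : ℕ} {Ω : Set (Eucl n)} (hΩ : IsOpen Ω) {s α : ℝ}
    (hs : FracExponent s α) (φ : TestFn Ω) (δ : ℝ) :
    ∫⁻ p in Ω ×ˢ Ioo (0 : ℝ) δ, ‖φ.1 p - φ.1 (p.1, 0)‖ₑ ^ 2 ≤
      ENNReal.ofReal δ * ENNReal.ofReal (δ ^ (2 * s) / (2 * s)) *
        ‖smoothElt hΩ hs.neg_one_lt φ‖ₑ ^ 2 := by
  have hs0 := hs.pos
  have hm2 : Measurable fun p => ‖dY φ.1 p‖ₑ ^ 2 :=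
    (continuous_dY φ.2.1).enorm.measurable.pow_const 2
  have hc : Continuous fun p : Eucl n × ℝ => φ.1 p - φ.1 (p.1, 0) :=
    φ.2.1.continuous.sub (φ.2.1.continuous.comp (continuous_fst.prodMk continuous_const))
  rw [volume_restrict_prod_Ioo, lintegral_prod _ (hc.enorm.measurable.pow_const 2).aemeasurable]
  calc ∫⁻ x in Ω, ∫⁻ y in Ioo 0 δ, ‖φ.1 (x, y) - φ.1 (x, 0)‖ₑ ^ 2
      ≤ ∫⁻ x in Ω, ENNReal.ofReal δ * ENNReal.ofReal (δ ^ (2 * s) / (2 * s)) *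
          ∫⁻ y, ‖dY φ.1 (x, y)‖ₑ ^ 2 ∂powerMeasure α := by
        refine lintegral_mono fun x => ?_
        calc ∫⁻ y in Ioo 0 δ, ‖φ.1 (x, y) - φ.1 (x, 0)‖ₑ ^ 2
            ≤ ∫⁻ y in Ioo 0 δ, ENNReal.ofReal (δ ^ (2 * s) / (2 * s)) *
              ∫⁻ y, ‖dY φ.1 (x, y)‖ₑ ^ 2 ∂powerMeasure α := by
              refine setLIntegral_mono' measurableSet_Ioo fun y hy => ?_
              refine (enorm_sub_zero_sq_le (α := α) (by linarith [hs.one_sub, hs.pos]) (hasDerivAt_dY φ.2.1 x)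
                ((continuous_dY φ.2.1).comp (Continuous.prodMk_right x)) hy.1).trans ?_
              rw [hs.one_sub]
              gcongr
              · exact hy.1.le
              · exact hy.2.le
          _ = _ := by
              rw [lintegral_const, Measure.restrict_apply_univ, Real.volume_Ioo, sub_zero]
              ring
    _ = ENNReal.ofReal δ * ENNReal.ofReal (δ ^ (2 * s) / (2 * s)) *
          ∫⁻ p, ‖dY φ.1 p‖ₑ ^ 2 ∂cylMeasure Ω α := by
        rw [lintegral_const_mul _ hm2.lintegral_prod_right', lintegral_cylMeasure _ _ hm2]
    _ ≤ _ := by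
        rw [enorm_sq_smoothElt]
        gcongr
        exact le_add_self.trans le_add_self

/-- Fatou's lemma along smooth approximations whose values and boundary values both converge almost
everywhere. -/
theorem lintegral_slab_le {n : ℕ} {Ω : Set (Eucl n)} (hΩ : IsOpen Ω) {s α : ℝ}
    (hs : FracExponent s α) (w : HL Ω α) (δ : ℝ) :
    ∫⁻ p in Ω ×ˢ Ioo (0 : ℝ) δ, ‖cylFun w p - trOp hΩ hs w p.1‖ₑ ^ 2 ≤
      ENNReal.ofReal δ * ENNReal.ofReal (δ ^ (2 * s) / (2 * s)) * ‖w‖ₑ ^ 2 := by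
  obtain ⟨φ, h1, h2, h3⟩ := exists_smooth_seq hΩ hs w
  have h2' : ∀ᵐ p ∂volume.restrict (Ω ×ˢ Ioo (0 : ℝ) δ),
      Tendsto (fun k => (φ k).1 p) atTop (𝓝 (cylFun w p)) :=
    ae_restrict_of_ae_restrict_of_subset (prod_mono_right fun y hy => hy.1) h2
  have h3' : ∀ᵐ p ∂volume.restrict (Ω ×ˢ Ioo (0 : ℝ) δ),
      Tendsto (fun k => (φ k).1 (p.1, 0)) atTop (𝓝 (trOp hΩ hs w p.1)) := by
    rw [volume_restrict_prod_Ioo]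
    exact Measure.quasiMeasurePreserving_fst.ae h3
  have hc : ∀ k, Continuous fun p : Eucl n × ℝ => (φ k).1 p - (φ k).1 (p.1, 0) := fun k =>
    (φ k).2.1.continuous.sub ((φ k).2.1.continuous.comp (continuous_fst.prodMk continuous_const))
  calc ∫⁻ p in Ω ×ˢ Ioo (0 : ℝ) δ, ‖cylFun w p - trOp hΩ hs w p.1‖ₑ ^ 2
      = ∫⁻ p in Ω ×ˢ Ioo (0 : ℝ) δ,
          liminf (fun k => ‖(φ k).1 p - (φ k).1 (p.1, 0)‖ₑ ^ 2) atTop := by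
        refine lintegral_congr_ae ?_
        filter_upwards [h2', h3'] with p hp2 hp3
        have := (ENNReal.continuous_pow 2).tendsto _ |>.comp (hp2.sub hp3).enorm
        exact this.liminf_eq.symm
    _ ≤ liminf (fun k => ∫⁻ p in Ω ×ˢ Ioo (0 : ℝ) δ, ‖(φ k).1 p - (φ k).1 (p.1, 0)‖ₑ ^ 2) atTop :=
        lintegral_liminf_le fun k => (hc k).enorm.measurable.pow_const 2
    _ ≤ liminf (fun k => ENNReal.ofReal δ * ENNReal.ofReal (δ ^ (2 * s) / (2 * s)) *
          ‖smoothElt hΩ hs.neg_one_lt (φ k)‖ₑ ^ 2) atTop :=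
        liminf_le_liminf (Eventually.of_forall fun k => lintegral_slab_smooth_le hΩ hs (φ k) δ)
    _ = _ := by
        refine Tendsto.liminf_eq (ENNReal.Tendsto.const_mul ?_ (Or.inr ?_))
        · exact (ENNReal.continuous_pow 2).tendsto _ |>.comp h1.enorm
        · exact ENNReal.mul_ne_top ENNReal.ofReal_ne_top ENNReal.ofReal_ne_top

theorem ENNReal.inv_mul_mul_cancel {a : ℝ≥0∞} (ha : a ≠ 0) (ha' : a ≠ ⊤) (b c : ℝ≥0∞) :
    a⁻¹ * (a * b * c) = b * c := by
  rw [mul_assoc, ENNReal.inv_mul_cancel_left ha ha']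

theorem isTrace_trOp {n : ℕ} {Ω : Set (Eucl n)} (hΩ : IsOpen Ω) {s α : ℝ}
    (hs : FracExponent s α) (w : HL Ω α) : IsTrace Ω (cylFun w) (trOp hΩ hs w) := by
  have hs0 := hs.pos
  have hlim : Tendsto (fun δ : ℝ => ENNReal.ofReal (δ ^ (2 * s) / (2 * s)) * ‖w‖ₑ ^ 2)
      (𝓝[>] 0) (𝓝 0) := by
    have h1 : Tendsto (fun δ : ℝ => δ ^ (2 * s) / (2 * s)) (𝓝 0) (𝓝 0) := by
      have : ContinuousAt (fun δ : ℝ => δ ^ (2 * s) / (2 * s)) 0 :=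
        (Real.continuousAt_rpow_const 0 (2 * s) (Or.inr (by positivity))).div_const _
      have h := this.tendsto
      rwa [Real.zero_rpow (by positivity), zero_div] at h
    have h2 := ENNReal.Tendsto.mul_const (b := ‖w‖ₑ ^ 2)
      (ENNReal.tendsto_ofReal (h1.mono_left (nhdsWithin_le_nhds (s := Ioi 0))))
      (Or.inr (by simp))
    simpa using h2
  refine tendsto_of_tendsto_of_tendsto_of_le_of_le' tendsto_const_nhds hlim
    (Eventually.of_forall fun _ => zero_le) ?_
  filter_upwards [self_mem_nhdsWithin] with δ hδ
  have hδ' : ENNReal.ofReal δ ≠ 0 := by simpa using hδ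
  calc (ENNReal.ofReal δ)⁻¹ * ∫⁻ p in Ω ×ˢ Ioo (0 : ℝ) δ, ‖cylFun w p - trOp hΩ hs w p.1‖ₑ ^ 2
      ≤ (ENNReal.ofReal δ)⁻¹ *
        (ENNReal.ofReal δ * ENNReal.ofReal (δ ^ (2 * s) / (2 * s)) * ‖w‖ₑ ^ 2) := by
        exact mul_le_mul_right (lintegral_slab_le hΩ hs w δ) _
    _ = ENNReal.ofReal (δ ^ (2 * s) / (2 * s)) * ‖w‖ₑ ^ 2 :=
        ENNReal.inv_mul_mul_cancel hδ' ENNReal.ofReal_ne_top _ _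

theorem lintegral_slab_fst {n : ℕ} {Ω : Set (Eucl n)} {h : Eucl n → ℝ≥0∞}
    (hh : AEMeasurable h (volume.restrict Ω)) (δ : ℝ) :
    ∫⁻ p in Ω ×ˢ Ioo (0 : ℝ) δ, h p.1 = ENNReal.ofReal δ * ∫⁻ x in Ω, h x := by
  rw [volume_restrict_prod_Ioo, lintegral_prod _ hh.comp_fst]
  simp only [lintegral_const, Measure.restrict_apply_univ, Real.volume_Ioo, sub_zero]
  rw [lintegral_mul_const'' _ hh, mul_comm]

/-- A function of `x` that is dominated by the deviation of `w` from its trace vanishes. -/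
theorem ae_eq_zero_of_slab_bound {n : ℕ} {Ω : Set (Eucl n)} {h : Eucl n → ℝ}
    (hh : AEMeasurable h (volume.restrict Ω)) {B : ℝ → ℝ≥0∞}
    (hB : Tendsto (fun δ : ℝ => (ENNReal.ofReal δ)⁻¹ * B δ) (𝓝[>] 0) (𝓝 0))
    (hle : ∀ δ, ∫⁻ p in Ω ×ˢ Ioo (0 : ℝ) δ, ‖h p.1‖ₑ ^ 2 ≤ B δ) :
    ∀ᵐ x ∂volume.restrict Ω, h x = 0 := by
  have hm : AEMeasurable (fun x => ‖h x‖ₑ ^ 2) (volume.restrict Ω) := hh.enorm.pow_const 2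
  have h0 : ∫⁻ x in Ω, ‖h x‖ₑ ^ 2 = 0 := by
    refine le_antisymm (ge_of_tendsto hB ?_) zero_le
    filter_upwards [self_mem_nhdsWithin] with δ hδ
    have hδ' : ENNReal.ofReal δ ≠ 0 := by simpa using hδ
    calc ∫⁻ x in Ω, ‖h x‖ₑ ^ 2
        = (ENNReal.ofReal δ)⁻¹ * (ENNReal.ofReal δ * ∫⁻ x in Ω, ‖h x‖ₑ ^ 2) := by
          rw [← mul_assoc, ENNReal.inv_mul_cancel hδ' ENNReal.ofReal_ne_top, one_mul]
      _ ≤ _ := by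
          rw [← lintegral_slab_fst hm δ]
          gcongr
          exact hle δ
  rw [lintegral_eq_zero_iff' hm] at h0
  filter_upwards [h0] with x hx
  simpa using hx

theorem IsTrace.ae_nonneg {n : ℕ} {Ω : Set (Eucl n)} {w : Eucl n × ℝ → ℝ} {g : L2 Ω}
    (h : IsTrace Ω w g) (hw : ∀ᵐ p ∂volume.restrict (openCylinder Ω), 0 ≤ w p) :
    ∀ᵐ x ∂volume.restrict Ω, 0 ≤ g x := by
  have hg : AEMeasurable g (volume.restrict Ω) := (Lp.aestronglyMeasurable g).aemeasurable
  -- Where `g < 0 ≤ w` one has `|g| ≤ |w - g|`, so the negative part of `g` is dominated by the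
  -- deviation of `w` from its trace.
  have := ae_eq_zero_of_slab_bound (h := fun x => min (g x) 0) (hg.min aemeasurable_const) h
    fun δ => by
      refine lintegral_mono_ae ?_
      filter_upwards [ae_restrict_of_ae_restrict_of_subset (prod_mono_right fun y hy => hy.1) hw]
        with p hp
      rw [enorm_sq_real, enorm_sq_real]
      refine ENNReal.ofReal_le_ofReal ?_
      rcases le_total (g p.1) 0 with h0 | h0
      · rw [min_eq_left h0]
        nlinarith
      · rw [min_eq_right h0]
        simpa using sq_nonneg _
  filter_upwards [this] with x hx
  exact min_eq_right_iff.1 hx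

theorem aemeasurable_cylFun {n : ℕ} {Ω : Set (Eucl n)} (hΩ : IsOpen Ω) {α : ℝ} (w : HL Ω α) :
    AEMeasurable (cylFun w) (volume.restrict (openCylinder Ω)) :=
  ((Lp.aestronglyMeasurable w.1.1.fst).mono_ac
    (absolutelyContinuous_cylMeasure hΩ α)).aemeasurable

theorem IsTrace.unique {n : ℕ} {Ω : Set (Eucl n)} {w : Eucl n × ℝ → ℝ} {g₁ g₂ : L2 Ω}
    (hw : AEMeasurable w (volume.restrict (openCylinder Ω)))
    (h₁ : IsTrace Ω w g₁) (h₂ : IsTrace Ω w g₂) : g₁ = g₂ := by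
  have hg1 : AEMeasurable g₁ (volume.restrict Ω) := (Lp.aestronglyMeasurable _).aemeasurable
  have hg2 : AEMeasurable g₂ (volume.restrict Ω) := (Lp.aestronglyMeasurable _).aemeasurable
  have h12 := (ENNReal.Tendsto.const_mul (a := 2) h₁ (Or.inr (by simp))).add
    (ENNReal.Tendsto.const_mul (a := 2) h₂ (Or.inr (by simp)))
  simp only [mul_zero, add_zero] at h12
  have h := ae_eq_zero_of_slab_bound (h := fun x => g₁ x - g₂ x) (hg1.sub hg2)
    (B := fun δ => 2 * (∫⁻ p in Ω ×ˢ Ioo (0 : ℝ) δ, ‖w p - g₁ p.1‖ₑ ^ 2) +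
      2 * ∫⁻ p in Ω ×ˢ Ioo (0 : ℝ) δ, ‖w p - g₂ p.1‖ₑ ^ 2)
    (h12.congr fun δ => by ring) fun δ => by
      have hw' : AEMeasurable w (volume.restrict (Ω ×ˢ Ioo (0 : ℝ) δ)) :=
        hw.mono_measure (Measure.restrict_mono (prod_mono_right fun y hy => hy.1) le_rfl)
      have hg1' : AEMeasurable (fun p : Eucl n × ℝ => g₁ p.1)
          (volume.restrict (Ω ×ˢ Ioo (0 : ℝ) δ)) := by
        rw [volume_restrict_prod_Ioo]
        exact hg1.comp_fst
      have hm : AEMeasurable (fun p => ‖w p - g₁ p.1‖ₑ ^ 2)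
          (volume.restrict (Ω ×ˢ Ioo (0 : ℝ) δ)) := (hw'.sub hg1').enorm.pow_const 2
      rw [← lintegral_const_mul'' _ hm, ← lintegral_const_mul' _ _ (by simp),
        ← lintegral_add_left' (hm.const_mul 2)]
      refine lintegral_mono fun p => ?_
      -- The splitting is `g₁ - g₂ = (w - g₂) - (w - g₁)`.
      have := enorm_sq_le_two_mul (g₁ p.1 - g₂ p.1) (w p - g₂ p.1)
      rw [sub_sub_sub_cancel_right] at this
      rwa [add_comm]
  refine Lp.ext ?_
  filter_upwards [h] with x hx
  exact sub_eq_zero.1 hx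

theorem isTrace_tr {n : ℕ} {Ω : Set (Eucl n)} {α : ℝ} {w : HL Ω α}
    (h : ∃ g : L2 Ω, IsTrace Ω (cylFun w) g) : IsTrace Ω (cylFun w) (tr w) := by
  rw [tr, dif_pos h]
  exact h.choose_spec

/-- The default value in `tr` never occurs, and `tr` inherits linearity and continuity from the
extension `trOp`. -/
theorem tr_eq_trOp {n : ℕ} {Ω : Set (Eucl n)} (hΩ : IsOpen Ω) {s α : ℝ}
    (hs : FracExponent s α) (w : HL Ω α) : tr w = trOp hΩ hs w :=
  IsTrace.unique (aemeasurable_cylFun hΩ w) (isTrace_tr ⟨_, isTrace_trOp hΩ hs w⟩)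
    (isTrace_trOp hΩ hs w)

theorem trOp_nonneg {n : ℕ} {Ω : Set (Eucl n)} (hΩ : IsOpen Ω) {s α : ℝ}
    (hs : FracExponent s α) {w : HL Ω α}
    (hw : ∀ᵐ p ∂volume.restrict (openCylinder Ω), 0 ≤ cylFun w p) :
    ∀ᵐ x ∂volume.restrict Ω, 0 ≤ trOp hΩ hs w x :=
  (isTrace_trOp hΩ hs w).ae_nonneg hw

theorem cylFun_sub_ae {n : ℕ} {Ω : Set (Eucl n)} (hΩ : IsOpen Ω) {α : ℝ} (w w' : HL Ω α) :
    ∀ᵐ p ∂volume.restrict (openCylinder Ω), cylFun (w - w') p = cylFun w p - cylFun w' p :=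
  (ae_cylMeasure_iff hΩ α).1 (Lp.coeFn_sub w.1.1.fst w'.1.1.fst)

theorem trOp_mono {n : ℕ} {Ω : Set (Eucl n)} (hΩ : IsOpen Ω) {s α : ℝ}
    (hs : FracExponent s α) {w w' : HL Ω α}
    (h : ∀ᵐ p ∂volume.restrict (openCylinder Ω), cylFun w p ≤ cylFun w' p) :
    ∀ᵐ x ∂volume.restrict Ω, trOp hΩ hs w x ≤ trOp hΩ hs w' x := by
  have h1 := trOp_nonneg hΩ hs (w := w' - w) (by
    filter_upwards [h, cylFun_sub_ae hΩ w' w] with p hp hq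
    rw [hq]
    exact sub_nonneg.2 hp)
  rw [map_sub] at h1
  filter_upwards [h1, Lp.coeFn_sub (trOp hΩ hs w') (trOp hΩ hs w)] with x hx hx'
  rw [hx'] at hx
  exact sub_nonneg.1 hx

/-! ### The bilinear form of the elliptic operator -/

theorem exists_pointwise_clm {X F : Type*} [MeasurableSpace X] [NormedAddCommGroup F]
    [NormedSpace ℝ F] {μ : Measure X} (B : X → F →L[ℝ] F) {M : ℝ}
    (hM : ∀ᵐ x ∂μ, ∀ ξ, ‖B x ξ‖ ≤ M * ‖ξ‖)
    (hB : ∀ G : X → F, AEStronglyMeasurable G μ → AEStronglyMeasurable (fun x => B x (G x)) μ) :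
    ∃ T : Lp F 2 μ →L[ℝ] Lp F 2 μ, ∀ G, T G =ᵐ[μ] fun x => B x (G x) := by
  have hmem : ∀ G : Lp F 2 μ, MemLp (fun x => B x (G x)) 2 μ := fun G =>
    (Lp.memLp G).of_le_mul (hB G (Lp.aestronglyMeasurable G)) (by
      filter_upwards [hM] with x hx
      exact hx (G x))
  let T : Lp F 2 μ →ₗ[ℝ] Lp F 2 μ :=
    { toFun := fun G => (hmem G).toLp _
      map_add' := fun G H => by
        refine Lp.ext ?_
        filter_upwards [(hmem (G + H)).coeFn_toLp, (hmem G).coeFn_toLp, (hmem H).coeFn_toLp,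
          Lp.coeFn_add G H, Lp.coeFn_add ((hmem G).toLp _) ((hmem H).toLp _)] with x h1 h2 h3 h4 h5
        rw [h1, h5, Pi.add_apply, h2, h3, h4, Pi.add_apply, map_add]
      map_smul' := fun a G => by
        refine Lp.ext ?_
        filter_upwards [(hmem (a • G)).coeFn_toLp, (hmem G).coeFn_toLp,
          Lp.coeFn_smul a G, Lp.coeFn_smul a ((hmem G).toLp _)] with x h1 h2 h4 h5
        rw [h1, RingHom.id_apply, h5, Pi.smul_apply, h2, h4, Pi.smul_apply, map_smul] }
  refine ⟨T.mkContinuous M fun G => ?_, fun G => (hmem G).coeFn_toLp⟩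
  refine Lp.norm_le_mul_norm_of_ae_le_mul ?_
  filter_upwards [hM, (hmem G).coeFn_toLp] with x hx h1
  change ‖(hmem G).toLp _ x‖ ≤ _
  rw [h1]
  exact hx (G x)

theorem exists_ae_norm_le_of_memLp_top {X F : Type*} [MeasurableSpace X] [NormedAddCommGroup F]
    {μ : Measure X} {f : X → F} (hf : MemLp f ⊤ μ) : ∃ M : ℝ, ∀ᵐ x ∂μ, ‖f x‖ ≤ M := by
  refine ⟨(eLpNorm f ⊤ μ).toReal, ?_⟩
  filter_upwards [enorm_ae_le_eLpNormEssSup f μ] with x hx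
  rw [← toReal_enorm]
  refine ENNReal.toReal_mono hf.2.ne ?_
  rwa [eLpNorm_exponent_top]

theorem inner_toEuclideanCLM_symm {n : ℕ} {A : Matrix (Fin n) (Fin n) ℝ} (hA : A.IsSymm)
    (ξ η : Eucl n) :
    inner ℝ (Matrix.toEuclideanCLM (n := Fin n) (𝕜 := ℝ) A ξ) η =
      inner ℝ ξ (Matrix.toEuclideanCLM (n := Fin n) (𝕜 := ℝ) A η) := by
  have hstar : star A = A := by
    rw [Matrix.star_eq_conjTranspose, Matrix.conjTranspose_eq_transpose_of_trivial]
    exact hA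
  have h : ContinuousLinearMap.adjoint (Matrix.toEuclideanCLM (n := Fin n) (𝕜 := ℝ) A) =
      Matrix.toEuclideanCLM (n := Fin n) (𝕜 := ℝ) A := by
    rw [← ContinuousLinearMap.star_eq_adjoint, ← map_star, hstar]
  conv_lhs => rw [← h]
  rw [ContinuousLinearMap.adjoint_inner_left]

theorem norm_toEuclideanCLM_le {n : ℕ} {A : Matrix (Fin n) (Fin n) ℝ} (hA : A.IsSymm) {Λ : ℝ}
    (hΛ : 0 < Λ)
    (h0 : ∀ ξ : Eucl n, 0 ≤ inner ℝ (Matrix.toEuclideanCLM (n := Fin n) (𝕜 := ℝ) A ξ) ξ)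
    (h1 : ∀ ξ : Eucl n, inner ℝ (Matrix.toEuclideanCLM (n := Fin n) (𝕜 := ℝ) A ξ) ξ ≤ Λ * ‖ξ‖ ^ 2)
    (ξ : Eucl n) : ‖Matrix.toEuclideanCLM (n := Fin n) (𝕜 := ℝ) A ξ‖ ≤ Λ * ‖ξ‖ := by
  set T := Matrix.toEuclideanCLM (n := Fin n) (𝕜 := ℝ) A
  -- Ellipticity bounds only the quadratic form. By symmetry, expansion of the form at `Λξ - Tξ`
  -- gives `2Λ|Tξ|² ≤ Λ²⟨Tξ,ξ⟩ + ⟨TTξ,Tξ⟩ ≤ Λ³|ξ|² + Λ|Tξ|²`, hence `|Tξ| ≤ Λ|ξ|`.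
  have key : 0 ≤ inner ℝ (T (Λ • ξ - T ξ)) (Λ • ξ - T ξ) := h0 _
  have hs : inner ℝ (T (T ξ)) ξ = ‖T ξ‖ ^ 2 := by
    rw [inner_toEuclideanCLM_symm hA, real_inner_self_eq_norm_sq]
  rw [map_sub, map_smul, inner_sub_left, inner_sub_right, inner_sub_right, real_inner_smul_left,
    real_inner_smul_left, real_inner_smul_right, real_inner_smul_right, hs,
    real_inner_self_eq_norm_sq] at key
  have h2 := h1 ξ
  have h3 := h1 (T ξ)
  refine le_of_sq_le_sq ?_ (by positivity)
  have h4 : Λ * ‖T ξ‖ ^ 2 ≤ Λ * (Λ * ‖ξ‖) ^ 2 := by nlinarith [sq_nonneg Λ]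
  exact le_of_mul_le_mul_left h4 hΛ

/-- The form `∫ A G · H + c u w` on pairs `(u, G)`, `(w, H)`. -/
theorem IsEllipticCoeff.exists_form {n : ℕ} {Ω : Set (Eucl n)}
    {A : Eucl n → Matrix (Fin n) (Fin n) ℝ} {c : Eucl n → ℝ} (h : IsEllipticCoeff Ω A c) :
    ∃ (S : Lp (Eucl n) 2 (volume.restrict Ω) →L[ℝ] Lp (Eucl n) 2 (volume.restrict Ω))
      (T : L2 Ω →L[ℝ] L2 Ω),
      (∀ G, S G =ᵐ[volume.restrict Ω]
        fun x => Matrix.toEuclideanCLM (n := Fin n) (𝕜 := ℝ) (A x) (G x)) ∧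
      (∀ u, T u =ᵐ[volume.restrict Ω] fun x => c x * u x) ∧
      (∀ G H, inner ℝ (S G) H = inner ℝ (S H) G) ∧ (∀ u w, inner ℝ (T u) w = inner ℝ (T w) u) ∧
      (∀ G, 0 ≤ inner ℝ (S G) G) ∧ ∀ u, 0 ≤ inner ℝ (T u) u := by
  obtain ⟨hm, hsym, ⟨Λ₁, Λ₂, hΛ, hle, hell⟩, hcb, hc0⟩ := h
  have hbound : ∀ᵐ x ∂volume.restrict Ω, ∀ ξ,
      ‖Matrix.toEuclideanCLM (n := Fin n) (𝕜 := ℝ) (A x) ξ‖ ≤ Λ₂ * ‖ξ‖ := by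
    filter_upwards [hsym, hell] with x h1 h2
    exact norm_toEuclideanCLM_le h1 (hΛ.trans_le hle)
      (fun ξ => le_trans (by positivity) (h2 ξ).1) fun ξ => (h2 ξ).2
  obtain ⟨S, hS⟩ := exists_pointwise_clm
    (fun x => Matrix.toEuclideanCLM (n := Fin n) (𝕜 := ℝ) (A x)) hbound fun G hG => by
      have hi : ∀ i, AEMeasurable
          (fun x => (Matrix.toEuclideanCLM (n := Fin n) (𝕜 := ℝ) (A x) (G x)) i)
          (volume.restrict Ω) := by
        intro i
        have : (fun x => (Matrix.toEuclideanCLM (n := Fin n) (𝕜 := ℝ) (A x) (G x)) i) =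
            fun x => ∑ j, A x i j * G x j := by
          funext x
          simp [Matrix.ofLp_toEuclideanCLM, Matrix.mulVec, dotProduct]
        rw [this]
        refine Finset.aemeasurable_fun_sum _ fun j _ => (hm i j).mul ?_
        exact (EuclideanSpace.proj (𝕜 := ℝ) j).continuous.measurable.comp_aemeasurable
          hG.aemeasurable
      have h2 : AEMeasurable (fun x => WithLp.ofLp
          (Matrix.toEuclideanCLM (n := Fin n) (𝕜 := ℝ) (A x) (G x))) (volume.restrict Ω) :=
        aemeasurable_pi_iff.2 hi
      exact ((PiLp.continuous_toLp 2 fun _ : Fin n => ℝ).measurable.comp_aemeasurable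
        h2).aestronglyMeasurable
  obtain ⟨M, hM⟩ : ∃ M : ℝ, ∀ᵐ x ∂volume.restrict Ω, ‖c x‖ ≤ M :=
    exists_ae_norm_le_of_memLp_top hcb
  obtain ⟨T, hT⟩ := exists_pointwise_clm (μ := volume.restrict Ω)
    (fun x => c x • ContinuousLinearMap.id ℝ ℝ) (M := M) (by
      filter_upwards [hM] with x hx ξ
      simp only [smul_apply, ContinuousLinearMap.id_apply, norm_smul]
      gcongr) fun G hG => by
      change AEStronglyMeasurable (fun x => c x * G x) (volume.restrict Ω)
      exact hcb.1.mul hG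
  refine ⟨S, T, hS, fun u => ?_, fun G H => ?_, fun u w => ?_, fun G => ?_, fun u => ?_⟩
  · filter_upwards [hT u] with x hx
    simpa using hx
  · rw [L2.inner_def, L2.inner_def]
    refine integral_congr_ae ?_
    filter_upwards [hS G, hS H, hsym] with x h1 h2 h3
    rw [h1, h2, inner_toEuclideanCLM_symm h3, real_inner_comm]
  · rw [L2.inner_def, L2.inner_def]
    refine integral_congr_ae ?_
    filter_upwards [hT u, hT w] with x h1 h2
    rw [h1, h2]
    simp
    ring
  · rw [L2.inner_def]
    refine integral_nonneg_of_ae ?_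
    filter_upwards [hS G, hell] with x h1 h2
    rw [h1]
    exact le_trans (by positivity) (h2 (G x)).1
  · rw [L2.inner_def]
    refine integral_nonneg_of_ae ?_
    filter_upwards [hT u, hc0] with x h1 h2
    rw [h1]
    simp
    nlinarith [mul_nonneg h2 (mul_self_nonneg (u x))]

/-- Bessel's inequality for a non-negative symmetric form with a diagonalising family. -/
theorem sum_mul_sq_le_of_diagonal {V : Type*} [AddCommGroup V] [Module ℝ V]
    (a : V →ₗ[ℝ] V →ₗ[ℝ] ℝ) (hsymm : ∀ P Q, a P Q = a Q P) (hpos : ∀ P, 0 ≤ a P P)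
    {E : ℕ → V} {lam : ℕ → ℝ} (hE : ∀ j k, a (E j) (E k) = if j = k then lam j else 0)
    {Q : V} {w : ℕ → ℝ} (hQ : ∀ k, a (E k) Q = lam k * w k) (N : ℕ) :
    ∑ k ∈ Finset.range N, lam k * w k ^ 2 ≤ a Q Q := by
  -- `P` is the projection of `Q` onto the first `N` vectors: `a(P,Q)` and `a(P,P)` both equal the
  -- sum on the left, and `0 ≤ a(Q - P, Q - P)` gives the claim. The form may be degenerate.
  set P := ∑ k ∈ Finset.range N, w k • E k with hP
  have hPa : ∀ R, a P R = ∑ k ∈ Finset.range N, w k * a (E k) R := by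
    intro R
    rw [hP, map_sum, LinearMap.sum_apply]
    simp
  have h1 : a P Q = ∑ k ∈ Finset.range N, lam k * w k ^ 2 := by
    rw [hPa]
    refine Finset.sum_congr rfl fun k _ => ?_
    rw [hQ]
    ring
  have hEP : ∀ k ∈ Finset.range N, a (E k) P = lam k * w k := by
    intro k hk
    rw [hP, map_sum]
    simp only [map_smul, hE, smul_eq_mul, mul_ite, mul_zero]
    rw [Finset.sum_ite_eq, if_pos hk, mul_comm]
  have h2 : a P P = ∑ k ∈ Finset.range N, lam k * w k ^ 2 := by
    rw [hPa]
    refine Finset.sum_congr rfl fun k hk => ?_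
    rw [hEP k hk]
    ring
  have h3 := hpos (Q - P)
  simp only [map_sub, LinearMap.sub_apply] at h3
  rw [hsymm Q P, h1, h2] at h3
  linarith

theorem IsTestFunction.section {n : ℕ} {Ω : Set (Eucl n)} {φ : Eucl n × ℝ → ℝ}
    (h : IsTestFunction (Ω ×ˢ univ) φ) (y : ℝ) : IsTestFunction Ω fun x => φ (x, y) := by
  refine ⟨h.1.comp (contDiff_prodMk_left y), hasCompactSupport_section h.2.1 y, fun x hx => ?_⟩
  have := tsupport_comp_subset_preimage φ (f := fun x : Eucl n => (x, y))
    (Continuous.prodMk_left y) hx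
  exact (h.2.2 this).1

/-- The eigenvalue equation tested with elements of `H¹₀(Ω)`. -/
theorem eigen_eq_of_mem_H10Pairs {n : ℕ} {Ω : Set (Eucl n)}
    {A : Eucl n → Matrix (Fin n) (Fin n) ℝ} {c : Eucl n → ℝ}
    {S : Lp (Eucl n) 2 (volume.restrict Ω) →L[ℝ] Lp (Eucl n) 2 (volume.restrict Ω)}
    {T : L2 Ω →L[ℝ] L2 Ω}
    (hS : ∀ G, S G =ᵐ[volume.restrict Ω]
        fun x => Matrix.toEuclideanCLM (n := Fin n) (𝕜 := ℝ) (A x) (G x))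
    (hT : ∀ u, T u =ᵐ[volume.restrict Ω] fun x => c x * u x) {lam : ℝ} {u : L2 Ω}
    {G : Lp (Eucl n) 2 (volume.restrict Ω)}
    (hG : ∀ ψ : Eucl n → ℝ, IsTestFunction Ω ψ →
      ∫ x in Ω, (inner ℝ (Matrix.toEuclideanCLM (n := Fin n) (𝕜 := ℝ) (A x) (G x)) (gradient ψ x)
        + c x * u x * ψ x) = lam * ∫ x in Ω, u x * ψ x)
    {Q : L2 Ω × Lp (Eucl n) 2 (volume.restrict Ω)} (hQ : Q ∈ H10Pairs Ω) :
    inner ℝ (S G) Q.2 + inner ℝ (T u) Q.1 = lam * inner ℝ u Q.1 := by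
  -- Both sides are continuous in the pair, so the identity passes from test functions to their
  -- closure.
  have hcl : IsClosed {Q : L2 Ω × Lp (Eucl n) 2 (volume.restrict Ω) |
      inner ℝ (S G) Q.2 + inner ℝ (T u) Q.1 = lam * inner ℝ u Q.1} :=
    isClosed_eq ((continuous_const.inner continuous_snd).add
      (continuous_const.inner continuous_fst))
      (continuous_const.mul (continuous_const.inner continuous_fst))
  refine closure_minimal ?_ hcl hQ
  rintro P ⟨ψ, hψ, h1, h2⟩
  have e := hG ψ hψ
  rw [mem_ofPred_eq]
  rw [L2.inner_def, L2.inner_def, L2.inner_def, ← integral_add (L2.integrable_inner _ _)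
    (L2.integrable_inner _ _)]
  convert e using 1
  · refine integral_congr_ae ?_
    filter_upwards [hS G, hT u, h1, h2] with x a1 a2 a3 a4
    rw [a1, a2, a3, a4]
    simp [mul_comm]
  · congr 1
    refine integral_congr_ae ?_
    filter_upwards [h1] with x a3
    rw [a3]
    simp [mul_comm]

/-! ### Traces belong to the fractional space -/

theorem enorm_sq_eq_ofReal {E : Type*} [NormedAddCommGroup E] (a : E) :
    ‖a‖ₑ ^ 2 = ENNReal.ofReal (‖a‖ ^ 2) := by
  rw [ENNReal.ofReal_pow (norm_nonneg _), ofReal_norm]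

/-- The element `φ(·, y)` of `L²(Ω)`. -/
noncomputable def sliceLp {n : ℕ} (Ω : Set (Eucl n)) {F : Type*} [NormedAddCommGroup F]
    {f : Eucl n × ℝ → F} (hf : Continuous f) (hs : HasCompactSupport f) (y : ℝ) :
    Lp F 2 (volume.restrict Ω) :=
  (memLp_section Ω hf hs y).toLp _

theorem sliceLp_ae {n : ℕ} (Ω : Set (Eucl n)) {F : Type*} [NormedAddCommGroup F]
    {f : Eucl n × ℝ → F} (hf : Continuous f) (hs : HasCompactSupport f) (y : ℝ) :
    sliceLp Ω hf hs y =ᵐ[volume.restrict Ω] fun x => f (x, y) :=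
  (memLp_section Ω hf hs y).coeFn_toLp

theorem slice_mem_H10Pairs {n : ℕ} {Ω : Set (Eucl n)} (φ : TestFn Ω) (y : ℝ) :
    (sliceLp Ω φ.2.1.continuous φ.2.2.1 y,
      sliceLp Ω (continuous_gradX φ.2.1) (hasCompactSupport_gradX φ.2.2.1) y) ∈ H10Pairs Ω := by
  refine subset_closure ⟨fun x => φ.1 (x, y), φ.2.section y,
    sliceLp_ae Ω φ.2.1.continuous φ.2.2.1 y, ?_⟩
  refine (sliceLp_ae Ω (continuous_gradX φ.2.1) (hasCompactSupport_gradX φ.2.2.1) y).trans (Eventually.of_forall fun x => ?_)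
  exact (gradX_eq_gradient φ.2.1 x y).symm

theorem inner_sliceLp {n : ℕ} {Ω : Set (Eucl n)} {f : Eucl n × ℝ → ℝ} (hf : Continuous f)
    (hs : HasCompactSupport f) (e : L2 Ω) (y : ℝ) :
    inner ℝ e (sliceLp Ω hf hs y) = ∫ x in Ω, f (x, y) * e x := by
  rw [L2.inner_def]
  refine integral_congr_ae ?_
  filter_upwards [sliceLp_ae Ω hf hs y] with x hx
  rw [hx]
  simp

theorem integrable_L2 {n : ℕ} {Ω : Set (Eucl n)} (hb : Bornology.IsBounded Ω) (e : L2 Ω) :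
    Integrable e (volume.restrict Ω) := by
  have : IsFiniteMeasure (volume.restrict Ω) := ⟨by simpa using hb.measure_lt_top⟩
  exact (Lp.memLp e).integrable one_le_two

theorem integrable_slice_mul {n : ℕ} {Ω : Set (Eucl n)} {f : Eucl n × ℝ → ℝ} (hf : Continuous f)
    (hs : HasCompactSupport f) (e : L2 Ω) (y : ℝ) :
    Integrable (fun x => f (x, y) * e x) (volume.restrict Ω) :=
  (memLp_section Ω hf hs y).integrable_mul (Lp.memLp e)

theorem continuous_inner_sliceLp {n : ℕ} {Ω : Set (Eucl n)} (hb : Bornology.IsBounded Ω)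
    {f : Eucl n × ℝ → ℝ} (hf : Continuous f) (hs : HasCompactSupport f) (e : L2 Ω) :
    Continuous fun y => inner ℝ e (sliceLp Ω hf hs y) := by
  obtain ⟨B, hB⟩ := hs.exists_bound_of_continuous hf
  simp only [inner_sliceLp]
  refine continuous_of_dominated (bound := fun x => B * ‖e x‖)
    (fun y => (integrable_slice_mul hf hs e y).1) (fun y => Eventually.of_forall fun x => ?_)
    ((integrable_L2 hb e).norm.const_mul B) (Eventually.of_forall fun x => ?_)
  · rw [norm_mul]
    gcongr
    exact hB _
  · exact (hf.comp (Continuous.prodMk_right x)).mul continuous_const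

/-- Differentiation under the integral sign. It makes each Fourier coefficient of `φ(·, y)` a
differentiable function of `y`, to which the half-line inequality applies. -/
theorem hasDerivAt_inner_sliceLp {n : ℕ} {Ω : Set (Eucl n)} (hb : Bornology.IsBounded Ω)
    (φ : TestFn Ω) (e : L2 Ω) (y : ℝ) :
    HasDerivAt (fun y => inner ℝ e (sliceLp Ω φ.2.1.continuous φ.2.2.1 y))
      (inner ℝ e (sliceLp Ω (continuous_dY φ.2.1) (hasCompactSupport_dY φ.2.2.1) y)) y := by
  obtain ⟨B, hB⟩ := (hasCompactSupport_dY φ.2.2.1).exists_bound_of_continuous (continuous_dY φ.2.1)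
  simp only [inner_sliceLp]
  refine (hasDerivAt_integral_of_dominated_loc_of_deriv_le (s := univ)
    (F := fun y x => φ.1 (x, y) * e x) (F' := fun y x => dY φ.1 (x, y) * e x)
    (bound := fun x => B * ‖e x‖) univ_mem
    (Eventually.of_forall fun y => (integrable_slice_mul φ.2.1.continuous φ.2.2.1 e y).1)
    (integrable_slice_mul φ.2.1.continuous φ.2.2.1 e y)
    (integrable_slice_mul (continuous_dY φ.2.1) (hasCompactSupport_dY φ.2.2.1) e y).1
    (Eventually.of_forall fun x y _ => ?_) ((integrable_L2 hb e).norm.const_mul B)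
    (Eventually.of_forall fun x y _ => ?_)).2
  · rw [norm_mul]
    gcongr
    exact hB _
  · exact (hasDerivAt_dY φ.2.1 x y).mul_const (e x)

theorem lintegral_enorm_sliceLp {n : ℕ} (Ω : Set (Eucl n)) (α : ℝ) {F : Type*}
    [NormedAddCommGroup F] {f : Eucl n × ℝ → F} (hf : Continuous f) (hs : HasCompactSupport f) :
    ∫⁻ y, ‖sliceLp Ω hf hs y‖ₑ ^ 2 ∂powerMeasure α = ∫⁻ p, ‖f p‖ₑ ^ 2 ∂cylMeasure Ω α := by
  have h : ∀ y, ‖sliceLp Ω hf hs y‖ₑ ^ 2 = ∫⁻ x in Ω, ‖f (x, y)‖ₑ ^ 2 := fun y =>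
    enorm_sq_toLp (memLp_section Ω hf hs y)
  simp only [h]
  rw [cylMeasure_eq_prod, lintegral_prod_symm _ (by
    have : Continuous fun p => ‖f p‖ₑ ^ 2 := (ENNReal.continuous_pow 2).comp hf.enorm
    exact this.measurable.aemeasurable)]

theorem measurable_enorm_sliceLp {n : ℕ} (Ω : Set (Eucl n)) {F : Type*}
    [NormedAddCommGroup F] {f : Eucl n × ℝ → F} (hf : Continuous f) (hs : HasCompactSupport f) :
    Measurable fun y => ‖sliceLp Ω hf hs y‖ₑ ^ 2 := by
  have h : ∀ y, ‖sliceLp Ω hf hs y‖ₑ ^ 2 = ∫⁻ x in Ω, ‖f (x, y)‖ₑ ^ 2 := fun y =>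
    enorm_sq_toLp (memLp_section Ω hf hs y)
  simp only [h]
  have : Continuous fun p => ‖f p‖ₑ ^ 2 := (ENNReal.continuous_pow 2).comp hf.enorm
  exact this.measurable.lintegral_prod_left'

-- The eigenfunctions, paired with their gradients, diagonalise the non-negative energy form of the
-- operator, so Bessel's inequality for that form bounds the sum by the energy. The eigenvalues are
-- the diagonal values of the form, hence non-negative.
set_option maxHeartbeats 1000000 in
theorem exists_sum_eigenvalue_mul_le {n : ℕ} {Ω : Set (Eucl n)}
    {A : Eucl n → Matrix (Fin n) (Fin n) ℝ} {c : Eucl n → ℝ}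
    (hAc : IsEllipticCoeff Ω A c) {lam : ℕ → ℝ}
    {e : HilbertBasis ℕ ℝ (L2 Ω)} (he : ∀ k, IsDirichletEigenpair Ω A c (lam k) (e k)) :
    (∀ k, 0 ≤ lam k) ∧ ∃ M : ℝ, 1 ≤ M ∧ ∀ Q ∈ H10Pairs Ω, ∀ N : ℕ,
      ∑ k ∈ Finset.range N, lam k * inner ℝ (e k) Q.1 ^ 2 ≤ M * (‖Q.1‖ ^ 2 + ‖Q.2‖ ^ 2) := by
  obtain ⟨S, T, hS, hT, hSs, hTs, hS0, hT0⟩ := hAc.exists_form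
  choose G hGmem hG using he
  let a : (L2 Ω × Lp (Eucl n) 2 (volume.restrict Ω)) →ₗ[ℝ]
      (L2 Ω × Lp (Eucl n) 2 (volume.restrict Ω)) →ₗ[ℝ] ℝ :=
    LinearMap.mk₂ ℝ (fun P Q => inner ℝ (S P.2) Q.2 + inner ℝ (T P.1) Q.1)
      (fun P P' Q => by simp [inner_add_left]; ring)
      (fun r P Q => by simp [real_inner_smul_left]; ring)
      (fun P Q Q' => by simp [inner_add_right]; ring)
      (fun r P Q => by simp [real_inner_smul_right]; ring)
  have ha : ∀ P Q, a P Q = inner ℝ (S P.2) Q.2 + inner ℝ (T P.1) Q.1 := fun P Q => rfl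
  have hasymm : ∀ P Q, a P Q = a Q P := fun P Q => by rw [ha, ha, hSs, hTs]
  have hapos : ∀ P, 0 ≤ a P P := fun P => add_nonneg (hS0 _) (hT0 _)
  have heig : ∀ k Q, Q ∈ H10Pairs Ω → a (e k, G k) Q = lam k * inner ℝ (e k) Q.1 :=
    fun k Q hQ => eigen_eq_of_mem_H10Pairs hS hT (hG k) hQ
  have hE : ∀ j k, a (e j, G j) (e k, G k) = if j = k then lam j else 0 := by
    intro j k
    rw [heig j _ (hGmem k), orthonormal_iff_ite.1 e.orthonormal j k]
    simp
  have hlam : ∀ k, 0 ≤ lam k := fun k => by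
    have := hapos (e k, G k)
    rwa [hE, if_pos rfl] at this
  -- The summand `1` ensures `1 ≤ M`, so that the same constant can later absorb the `∂_y` term.
  set M : ℝ := ‖S‖ + ‖T‖ + 1 with hM
  have hM1 : 1 ≤ M := by
    rw [hM]
    linarith [norm_nonneg S, norm_nonneg T]
  have haM : ∀ P, a P P ≤ M * (‖P.1‖ ^ 2 + ‖P.2‖ ^ 2) := by
    intro P
    have h1 : inner ℝ (S P.2) P.2 ≤ ‖S‖ * ‖P.2‖ ^ 2 := by
      refine (real_inner_le_norm _ _).trans ?_
      rw [sq, ← mul_assoc]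
      gcongr
      exact S.le_opNorm _
    have h2 : inner ℝ (T P.1) P.1 ≤ ‖T‖ * ‖P.1‖ ^ 2 := by
      refine (real_inner_le_norm _ _).trans ?_
      rw [sq, ← mul_assoc]
      gcongr
      exact T.le_opNorm _
    rw [ha, hM]
    nlinarith [norm_nonneg S, norm_nonneg T, mul_nonneg (norm_nonneg S) (sq_nonneg ‖P.1‖),
      mul_nonneg (norm_nonneg T) (sq_nonneg ‖P.2‖), sq_nonneg ‖P.1‖, sq_nonneg ‖P.2‖]
  refine ⟨hlam, M, hM1, fun Q hQ N => ?_⟩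
  exact (sum_mul_sq_le_of_diagonal a hasymm hapos hE (Q := Q)
    (w := fun k => inner ℝ (e k) Q.1) (fun k => heig k _ hQ) N).trans (haM _)

set_option maxHeartbeats 1000000 in
/-- The fractional norm of the trace of a smooth function is controlled by the energy. -/
theorem exists_sum_smoothTrace_le {n : ℕ} {Ω : Set (Eucl n)} (hΩ : IsOpen Ω)
    (hb : Bornology.IsBounded Ω) {A : Eucl n → Matrix (Fin n) (Fin n) ℝ} {c : Eucl n → ℝ}
    (hAc : IsEllipticCoeff Ω A c) {s α : ℝ} (hs : FracExponent s α) {lam : ℕ → ℝ}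
    {e : HilbertBasis ℕ ℝ (L2 Ω)} (he : ∀ k, IsDirichletEigenpair Ω A c (lam k) (e k)) :
    (∀ k, 0 ≤ lam k) ∧ ∃ C : ℝ, 0 ≤ C ∧ ∀ (φ : TestFn Ω) (N : ℕ),
      ∑ k ∈ Finset.range N, lam k ^ s * inner ℝ (e k) (smoothTrace Ω φ) ^ 2 ≤
        C * ‖smoothElt hΩ hs.neg_one_lt φ‖ ^ 2 := by
  obtain ⟨hlam, M, hM1, hMle⟩ := exists_sum_eigenvalue_mul_le hAc he
  refine ⟨hlam, ?_⟩
  have hM0 : 0 ≤ M := zero_le_one.trans hM1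
  have hs0 := hs.pos
  set K : ℝ := 4 + 1 / s with hK
  have hK0 : 0 ≤ K := by positivity
  refine ⟨K * M, by positivity, fun φ N => ?_⟩
  set u := fun y => sliceLp Ω φ.2.1.continuous φ.2.2.1 y with hu
  set g := fun y => sliceLp Ω (continuous_gradX φ.2.1) (hasCompactSupport_gradX φ.2.2.1) y with hg
  set d := fun y => sliceLp Ω (continuous_dY φ.2.1) (hasCompactSupport_dY φ.2.2.1) y with hd
  have hum : Measurable fun y => ‖u y‖ₑ ^ 2 := measurable_enorm_sliceLp Ω _ _
  have hiu : ∫⁻ y, ‖u y‖ₑ ^ 2 ∂powerMeasure α = ∫⁻ p, ‖φ.1 p‖ₑ ^ 2 ∂cylMeasure Ω α :=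
    lintegral_enorm_sliceLp Ω α _ _
  have hig : ∫⁻ y, ‖g y‖ₑ ^ 2 ∂powerMeasure α = ∫⁻ p, ‖gradX φ.1 p‖ₑ ^ 2 ∂cylMeasure Ω α :=
    lintegral_enorm_sliceLp Ω α _ _
  have hid : ∫⁻ y, ‖d y‖ₑ ^ 2 ∂powerMeasure α = ∫⁻ p, ‖dY φ.1 p‖ₑ ^ 2 ∂cylMeasure Ω α :=
    lintegral_enorm_sliceLp Ω α _ _
  have hfm : ∀ k, Measurable fun y => ‖inner ℝ (e k) (u y)‖ₑ ^ 2 := fun k =>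
    ((continuous_inner_sliceLp hb _ _ (e k)).measurable.enorm).pow_const 2
  have hfm' : ∀ k, Measurable fun y => ‖inner ℝ (e k) (d y)‖ₑ ^ 2 := fun k =>
    ((continuous_inner_sliceLp hb _ _ (e k)).measurable.enorm).pow_const 2
  -- The energy form controls the coefficients of the slice `φ(·, y)`, which lies in `H¹₀(Ω)`; the
  -- ordinary Bessel inequality controls those of `∂_y φ(·, y)`.
  have hsum1 : ∀ y, ∑ k ∈ Finset.range N, ENNReal.ofReal (lam k) * ‖inner ℝ (e k) (u y)‖ₑ ^ 2 ≤
      ENNReal.ofReal M * (‖u y‖ₑ ^ 2 + ‖g y‖ₑ ^ 2) := by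
    intro y
    have h' := ENNReal.ofReal_le_ofReal (hMle _ (slice_mem_H10Pairs φ y) N)
    rw [ENNReal.ofReal_sum_of_nonneg fun k _ => mul_nonneg (hlam k) (sq_nonneg _),
      ENNReal.ofReal_mul hM0, ENNReal.ofReal_add (by positivity) (by positivity),
      ENNReal.ofReal_pow (norm_nonneg _), ENNReal.ofReal_pow (norm_nonneg _), ofReal_norm,
      ofReal_norm] at h'
    refine le_trans (le_of_eq (Finset.sum_congr rfl fun k _ => ?_)) h'
    rw [ENNReal.ofReal_mul (hlam k), enorm_sq_real]
  have hsum2 : ∀ y, ∑ k ∈ Finset.range N, ‖inner ℝ (e k) (d y)‖ₑ ^ 2 ≤ ‖d y‖ₑ ^ 2 := by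
    intro y
    have h := e.orthonormal.sum_inner_products_le (d y) (s := Finset.range N)
    have h' := ENNReal.ofReal_le_ofReal h
    rw [ENNReal.ofReal_sum_of_nonneg fun k _ => sq_nonneg _,
      ENNReal.ofReal_pow (norm_nonneg _), ofReal_norm] at h'
    refine le_trans (le_of_eq (Finset.sum_congr rfl fun k _ => ?_)) h'
    rw [ENNReal.ofReal_pow (norm_nonneg _), ofReal_norm]
  -- The half-line inequality is used with `λ = λₖ` for `f(y) = (φₖ, φ(·, y))`. Its constant does
  -- not depend on `λ`, so the sum over `k` can be moved inside the integrals.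
  have key : ∑ k ∈ Finset.range N, ENNReal.ofReal (lam k ^ s) * ‖inner ℝ (e k) (u 0)‖ₑ ^ 2 ≤
      ENNReal.ofReal (K * M) * ‖smoothElt hΩ hs.neg_one_lt φ‖ₑ ^ 2 := by
    calc ∑ k ∈ Finset.range N, ENNReal.ofReal (lam k ^ s) * ‖inner ℝ (e k) (u 0)‖ₑ ^ 2
        ≤ ∑ k ∈ Finset.range N, ENNReal.ofReal K *
          (ENNReal.ofReal (lam k) * ∫⁻ y, ‖inner ℝ (e k) (u y)‖ₑ ^ 2 ∂powerMeasure α +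
            ∫⁻ y, ‖inner ℝ (e k) (d y)‖ₑ ^ 2 ∂powerMeasure α) :=
          Finset.sum_le_sum fun k _ => rpow_mul_enorm_zero_sq_le hs
            (hasDerivAt_inner_sliceLp hb φ (e k)) (continuous_inner_sliceLp hb _ _ (e k)) (hlam k)
      _ = ENNReal.ofReal K *
          (∫⁻ y, ∑ k ∈ Finset.range N, ENNReal.ofReal (lam k) * ‖inner ℝ (e k) (u y)‖ₑ ^ 2
              ∂powerMeasure α +
            ∫⁻ y, ∑ k ∈ Finset.range N, ‖inner ℝ (e k) (d y)‖ₑ ^ 2 ∂powerMeasure α) := by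
          rw [← Finset.mul_sum, Finset.sum_add_distrib,
            lintegral_finsetSum _ fun k _ => (hfm k).const_mul _,
            lintegral_finsetSum _ fun k _ => hfm' k]
          congr 2
          refine Finset.sum_congr rfl fun k _ => ?_
          rw [lintegral_const_mul _ (hfm k)]
      _ ≤ ENNReal.ofReal K *
          (∫⁻ y, ENNReal.ofReal M * (‖u y‖ₑ ^ 2 + ‖g y‖ₑ ^ 2) ∂powerMeasure α +
            ∫⁻ y, ‖d y‖ₑ ^ 2 ∂powerMeasure α) := by
          gcongr with y y
          · exact hsum1 y
          · exact hsum2 y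
      _ = ENNReal.ofReal K * (ENNReal.ofReal M * (∫⁻ p, ‖φ.1 p‖ₑ ^ 2 ∂cylMeasure Ω α +
            ∫⁻ p, ‖gradX φ.1 p‖ₑ ^ 2 ∂cylMeasure Ω α) +
            ∫⁻ p, ‖dY φ.1 p‖ₑ ^ 2 ∂cylMeasure Ω α) := by
          rw [lintegral_const_mul' _ _ ENNReal.ofReal_ne_top,
            lintegral_add_left hum, hiu, hig, hid]
      _ ≤ ENNReal.ofReal K * (ENNReal.ofReal M * (∫⁻ p, ‖φ.1 p‖ₑ ^ 2 ∂cylMeasure Ω α +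
            ∫⁻ p, ‖gradX φ.1 p‖ₑ ^ 2 ∂cylMeasure Ω α) +
            ENNReal.ofReal M * ∫⁻ p, ‖dY φ.1 p‖ₑ ^ 2 ∂cylMeasure Ω α) := by
          gcongr
          refine le_mul_of_one_le_left zero_le ?_
          rwa [ENNReal.one_le_ofReal]
      _ = _ := by
          rw [enorm_sq_smoothElt, ENNReal.ofReal_mul hK0]
          ring
  have h0 : smoothTrace Ω φ = u 0 := rfl
  rw [h0, ← ENNReal.ofReal_le_ofReal_iff (by positivity)]
  rw [ENNReal.ofReal_sum_of_nonneg fun k _ =>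
      mul_nonneg (Real.rpow_nonneg (hlam k) s) (sq_nonneg _),
    ENNReal.ofReal_mul (by positivity), ← enorm_sq_eq_ofReal (smoothElt hΩ hs.neg_one_lt φ)]
  refine le_trans (le_of_eq (Finset.sum_congr rfl fun k _ => ?_)) key
  rw [ENNReal.ofReal_mul (Real.rpow_nonneg (hlam k) s), enorm_sq_real]

/-- A finite partial sum is continuous in `w`, so the bound extends from a dense set; it is uniform
in `N`, which yields summability afterwards. -/
theorem sum_mul_inner_sq_le_of_denseRange {ι X H : Type*} [NormedAddCommGroup X] [NormedSpace ℝ X]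
    [NormedAddCommGroup H] [InnerProductSpace ℝ H] {J : ι → X} (hJ : DenseRange J)
    (T : X →L[ℝ] H) (e : ℕ → H) (a : ℕ → ℝ) (C : ℝ)
    (h : ∀ i N, ∑ k ∈ Finset.range N, a k * inner ℝ (e k) (T (J i)) ^ 2 ≤ C * ‖J i‖ ^ 2)
    (w : X) (N : ℕ) :
    ∑ k ∈ Finset.range N, a k * inner ℝ (e k) (T w) ^ 2 ≤ C * ‖w‖ ^ 2 := by
  refine hJ.induction_on w ?_ fun i => h i N
  refine isClosed_le (continuous_finsetSum _ fun k _ => continuous_const.mul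
    ((continuous_const.inner T.continuous).pow 2)) ?_
  exact continuous_const.mul (continuous_norm.pow 2)

/-- This puts every trace in the domain on which the assumptions on `Ψ` hold. -/
theorem trOp_mem_fracSpace {n : ℕ} {Ω : Set (Eucl n)} (hΩ : IsOpen Ω)
    (hb : Bornology.IsBounded Ω) {A : Eucl n → Matrix (Fin n) (Fin n) ℝ} {c : Eucl n → ℝ}
    (hAc : IsEllipticCoeff Ω A c) {s α : ℝ} (hs : FracExponent s α) (w : HL Ω α) :
    trOp hΩ hs w ∈ fracSpace Ω A c s := by
  intro lam e he
  obtain ⟨hlam, C, hC, hle⟩ := exists_sum_smoothTrace_le hΩ hb hAc hs he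
  have key := @sum_mul_inner_sq_le_of_denseRange (TestFn Ω) (HL Ω α) (L2 Ω) inferInstance
    inferInstance inferInstance inferInstance (smoothElt hΩ hs.neg_one_lt)
    (denseRange_smoothElt hΩ hs.neg_one_lt) (trOp hΩ hs) e (fun k => lam k ^ s) C (fun φ N => by
      rw [trOp_smoothElt]
      exact hle φ N) w
  exact (summable_of_sum_range_le
    (fun k => mul_nonneg (Real.rpow_nonneg (hlam k) s) (sq_nonneg _)) key).congr
      fun k => by rw [real_inner_comm]

/-! ### Weak convergence and extension of operators -/

/-- Uniformly bounded operators that converge to the identity on a dense set converge to it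
strongly. This reduces the construction of recovery operators to smooth functions. -/
theorem exists_clm_extension_tendsto_id {E X : Type*} [AddCommGroup E] [Module ℝ E]
    [NormedAddCommGroup X] [NormedSpace ℝ X] [CompleteSpace X] {J : E →ₗ[ℝ] X}
    (hJ : DenseRange J) (S : ℕ → E →ₗ[ℝ] E) {C : ℝ} (hC : ∀ k φ, ‖J (S k φ)‖ ≤ C * ‖J φ‖)
    (hlim : ∀ φ, Tendsto (fun k => J (S k φ)) atTop (𝓝 (J φ))) :
    ∃ T : ℕ → X →L[ℝ] X, (∀ k φ, T k (J φ) = J (S k φ)) ∧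
      ∀ v, Tendsto (fun k => T k v) atTop (𝓝 v) := by
  have hC' : ∀ k φ, ‖(J ∘ₗ S k) φ‖ ≤ max C 0 * ‖J φ‖ := fun k φ =>
    (hC k φ).trans (by gcongr; exact le_max_left _ _)
  refine ⟨fun k => (J ∘ₗ S k).extendOfNorm J,
    fun k φ => LinearMap.extendOfNorm_eq hJ ⟨_, hC' k⟩ φ, fun v => ?_⟩
  have hb : ∀ k x, ‖(J ∘ₗ S k).extendOfNorm J x‖ ≤ max C 0 * ‖x‖ := fun k =>
    LinearMap.norm_extendOfNorm_apply_le hJ _ (hC' k)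
  rw [Metric.tendsto_atTop]
  intro ε hε
  have hC0 : 0 ≤ max C 0 := le_max_right _ _
  obtain ⟨φ, hφ⟩ := hJ.exists_dist_lt v (ε := ε / (2 * (max C 0 + 1))) (by positivity)
  obtain ⟨N, hN⟩ := Metric.tendsto_atTop.1 (hlim φ) (ε / 2) (by positivity)
  refine ⟨N, fun k hk => ?_⟩
  have h1 : ‖v - J φ‖ < ε / (2 * (max C 0 + 1)) := by rwa [← dist_eq_norm]
  have h2 : ‖J (S k φ) - J φ‖ < ε / 2 := by
    rw [← dist_eq_norm]
    exact hN k hk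
  have h3 := hb k (v - J φ)
  have h4 : (J ∘ₗ S k).extendOfNorm J (J φ) = J (S k φ) :=
    LinearMap.extendOfNorm_eq hJ ⟨_, hC' k⟩ φ
  rw [dist_eq_norm]
  have h5 : (J ∘ₗ S k).extendOfNorm J v - v =
      (J ∘ₗ S k).extendOfNorm J (v - J φ) + (J (S k φ) - J φ) - (v - J φ) := by
    rw [map_sub, h4]
    abel
  have h6 : (max C 0 + 1) * ‖v - J φ‖ < ε / 2 := by
    calc (max C 0 + 1) * ‖v - J φ‖ < (max C 0 + 1) * (ε / (2 * (max C 0 + 1))) := by gcongr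
      _ = ε / 2 := by field_simp
  calc ‖(J ∘ₗ S k).extendOfNorm J v - v‖
      ≤ ‖(J ∘ₗ S k).extendOfNorm J (v - J φ)‖ + ‖J (S k φ) - J φ‖ + ‖v - J φ‖ := by
        rw [h5]
        exact (norm_sub_le _ _).trans (by gcongr; exact norm_add_le _ _)
    _ < ε := by linarith

/-- By Banach–Alaoglu the bounded sequence has weak cluster points. The weak limit of the images
forces `T` to map each of them to `f`; injectivity of `T` then leaves only one, so the whole
sequence converges without passing to a subsequence. -/
theorem exists_weak_limit_of_inner {X F : Type*} [NormedAddCommGroup X] [InnerProductSpace ℝ X]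
    [CompleteSpace X] [NormedAddCommGroup F] [InnerProductSpace ℝ F] [CompleteSpace F]
    (T : X →L[ℝ] F) (hT : Function.Injective T) {x : ℕ → X} {M : ℝ} (hM : ∀ k, ‖x k‖ ≤ M) {f : F}
    (hf : ∀ g, Tendsto (fun k => inner ℝ g (T (x k))) atTop (𝓝 (inner ℝ g f))) :
    ∃ x₀, WeaklyConverges x x₀ ∧ T x₀ = f := by
  let D : X → WeakDual ℝ X := fun z => StrongDual.toWeakDual (InnerProductSpace.toDual ℝ X z)
  have hD : ∀ z y, D z y = inner ℝ z y := fun z y => rfl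
  let y : ℕ → WeakDual ℝ X := fun k => D (x k)
  have hK := WeakDual.isCompact_closedBall (𝕜 := ℝ) (E := X) 0 M
  have hyK : ∀ k, y k ∈ WeakDual.toStrongDual ⁻¹' Metric.closedBall (0 : StrongDual ℝ X) M := by
    intro k
    rw [mem_preimage, mem_closedBall_zero_iff]
    change ‖InnerProductSpace.toDual ℝ X (x k)‖ ≤ M
    rw [LinearIsometryEquiv.norm_map]
    exact hM k
  have hcl : ∀ ℓ : WeakDual ℝ X, MapClusterPt ℓ atTop y → ∃ x₀, T x₀ = f ∧ D x₀ = ℓ := by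
    intro ℓ hℓ
    obtain ⟨x₀, hx₀⟩ := (InnerProductSpace.toDual ℝ X).surjective (WeakDual.toStrongDual ℓ)
    have hDx : D x₀ = ℓ := by
      apply WeakDual.toStrongDual.injective
      exact hx₀
    refine ⟨x₀, ext_inner_left ℝ fun g => ?_, hDx⟩
    -- Evaluation at `T* g` turns the hypothesis on the images `T (x k)` into information on the
    -- cluster point.
    have h1 : MapClusterPt (ℓ (ContinuousLinearMap.adjoint T g)) atTop
        fun k => y k (ContinuousLinearMap.adjoint T g) :=
      hℓ.continuousAt_comp
        (f := fun ℓ : WeakDual ℝ X => ℓ (ContinuousLinearMap.adjoint T g))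
        (WeakDual.eval_continuous _).continuousAt
    have h2 : Tendsto (fun k => y k (ContinuousLinearMap.adjoint T g)) atTop (𝓝 (inner ℝ g f)) := by
      refine (hf g).congr fun k => ?_
      change _ = inner ℝ (x k) _
      rw [ContinuousLinearMap.adjoint_inner_right, real_inner_comm]
    have h4 : ℓ (ContinuousLinearMap.adjoint T g) = inner ℝ g f := by
      have : ClusterPt (ℓ (ContinuousLinearMap.adjoint T g)) (𝓝 (inner ℝ g f)) := h1.clusterPt.mono h2
      exact eq_of_nhds_neBot this
    rw [← h4, ← hDx, hD, ContinuousLinearMap.adjoint_inner_right, real_inner_comm]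
  obtain ⟨ℓ, -, hℓ⟩ := hK.exists_mapClusterPt (f := atTop) (u := y)
    (tendsto_principal.2 (Eventually.of_forall hyK))
  obtain ⟨x₀, hTx, hDx⟩ := hcl ℓ hℓ
  refine ⟨x₀, fun L => ?_, hTx⟩
  have hlim : Tendsto y atTop (𝓝 ℓ) := by
    refine hK.tendsto_nhds_of_unique_mapClusterPt (Eventually.of_forall hyK) fun ℓ' _ hℓ' => ?_
    obtain ⟨x₁, hTx₁, hDx₁⟩ := hcl ℓ' hℓ'
    rw [← hDx, ← hDx₁, hT (hTx₁.trans hTx.symm)]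
  obtain ⟨z, rfl⟩ := (InnerProductSpace.toDual ℝ X).surjective L
  have := ((WeakDual.eval_continuous z).tendsto ℓ).comp hlim
  rw [← hDx] at this
  refine (this.congr fun k => ?_).trans (le_of_eq ?_)
  · change inner ℝ (x k) z = inner ℝ z (x k)
    rw [real_inner_comm]
  · change 𝓝 (inner ℝ x₀ z) = 𝓝 (inner ℝ z x₀)
    rw [real_inner_comm]

/-- The parallelogram law supplies an inner product with the given norm, and weak convergence
depends on the norm only. -/
theorem exists_weak_limit {X F : Type*} [NormedAddCommGroup X] [NormedSpace ℝ X]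
    [CompleteSpace X]
    (hX : ∀ x y : X, ‖x + y‖ * ‖x + y‖ + ‖x - y‖ * ‖x - y‖ = 2 * (‖x‖ * ‖x‖ + ‖y‖ * ‖y‖))
    [NormedAddCommGroup F] [InnerProductSpace ℝ F] [CompleteSpace F]
    (T : X →L[ℝ] F) (hT : Function.Injective T) {x : ℕ → X} {M : ℝ} (hM : ∀ k, ‖x k‖ ≤ M) {f : F}
    (hf : ∀ g, Tendsto (fun k => inner ℝ g (T (x k))) atTop (𝓝 (inner ℝ g f))) :
    ∃ x₀, WeaklyConverges x x₀ ∧ T x₀ = f := by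
  let _ := InnerProductSpace.ofNorm ℝ hX
  exact exists_weak_limit_of_inner T hT hM hf

/-- Mazur's theorem: a limit outside the set would be strictly separated from it by a continuous
functional. -/
theorem WeaklyConverges.mem_of_isClosed {X : Type*} [NormedAddCommGroup X] [NormedSpace ℝ X]
    {K : Set X} (hc : Convex ℝ K) (hK : IsClosed K) {x : ℕ → X} {x₀ : X}
    (hx : WeaklyConverges x x₀) (hmem : ∀ᶠ k in atTop, x k ∈ K) : x₀ ∈ K := by
  by_contra h
  obtain ⟨f, u, h1, h2⟩ := geometric_hahn_banach_closed_point hc hK h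
  exact (le_of_tendsto (hx f) (hmem.mono fun k hk => (h1 _ hk).le)).not_gt h2

/-! ### Order in `L²` -/

/-- An `L²`-convergent sequence has a subsequence that converges almost everywhere. -/
theorem isClosed_setOf_ae_le {P : Type*} [MeasurableSpace P] {m : Measure P} (A : Set P)
    (ψ : P → ℝ) : IsClosed {g : Lp ℝ 2 m | ∀ᵐ p ∂m, p ∈ A → g p ≤ ψ p} := by
  refine IsSeqClosed.isClosed fun u g hu hlim => ?_
  obtain ⟨σ, -, h1⟩ := exists_subseq_tendsto_ae hlim
  change ∀ᵐ p ∂m, p ∈ A → g p ≤ ψ p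
  filter_upwards [h1, ae_all_iff.2 hu] with p hp hq hA
  exact le_of_tendsto' hp fun k => hq (σ k) hA

theorem convex_setOf_ae_le {P : Type*} [MeasurableSpace P] {m : Measure P} (A : Set P)
    (ψ : P → ℝ) : Convex ℝ {g : Lp ℝ 2 m | ∀ᵐ p ∂m, p ∈ A → g p ≤ ψ p} := by
  intro g hg g' hg' a b ha hb hab
  change ∀ᵐ p ∂m, p ∈ A → (a • g + b • g' : Lp ℝ 2 m) p ≤ ψ p
  filter_upwards [hg, hg', Lp.coeFn_add (a • g) (b • g'), Lp.coeFn_smul a g, Lp.coeFn_smul b g']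
    with p h1 h2 h3 h4 h5 hA
  rw [h3, Pi.add_apply, h4, h5, Pi.smul_apply, Pi.smul_apply, smul_eq_mul, smul_eq_mul]
  have e1 := mul_le_mul_of_nonneg_left (h1 hA) ha
  have e2 := mul_le_mul_of_nonneg_left (h2 hA) hb
  calc a * g p + b * g' p ≤ a * ψ p + b * ψ p := add_le_add e1 e2
    _ = ψ p := by rw [← add_mul, hab, one_mul]

/-- Monotone convergence in `L²`. -/
theorem exists_monotone_limit_L2 {P : Type*} [MeasurableSpace P] {m : Measure P}
    {u : ℕ → Lp ℝ 2 m} {Y : Lp ℝ 2 m}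
    (h : ∀ k, ∀ᵐ p ∂m, 0 ≤ u k p ∧ u k p ≤ u (k + 1) p ∧ u (k + 1) p ≤ Y p) :
    ∃ f : Lp ℝ 2 m,
      (∀ᵐ p ∂m, Monotone (fun k => u k p) ∧ Tendsto (fun k => u k p) atTop (𝓝 (f p))) ∧
      ∀ g : Lp ℝ 2 m, Tendsto (fun k => inner ℝ g (u k)) atTop (𝓝 (inner ℝ g f)) := by
  have hall := ae_all_iff.2 h
  have hbd : ∀ᵐ p ∂m, ∀ k, ‖u k p‖ ≤ Y p := by
    filter_upwards [hall] with p hp k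
    rw [Real.norm_of_nonneg (hp k).1]
    exact (hp k).2.1.trans (hp k).2.2
  have hmono : ∀ᵐ p ∂m, Monotone fun k => u k p := by
    filter_upwards [hall] with p hp
    exact monotone_nat_of_le_succ fun k => (hp k).2.1
  have hlim : ∀ᵐ p ∂m, Tendsto (fun k => u k p) atTop (𝓝 (⨆ k, u k p)) := by
    filter_upwards [hmono, hbd] with p h1 h2
    refine tendsto_atTop_ciSup h1 ⟨Y p, ?_⟩
    rintro _ ⟨k, rfl⟩
    exact (le_abs_self _).trans (h2 k)
  have hmeas : AEStronglyMeasurable (fun p => ⨆ k, u k p) m :=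
    aestronglyMeasurable_of_tendsto_ae atTop (fun k => Lp.aestronglyMeasurable (u k)) hlim
  have hmem : MemLp (fun p => ⨆ k, u k p) 2 m := by
    refine (Lp.memLp Y).of_le hmeas ?_
    filter_upwards [hlim, hbd] with p h1 h2
    exact (le_of_tendsto' h1.norm h2).trans (le_abs_self _)
  refine ⟨hmem.toLp _, ?_, fun g => ?_⟩
  · filter_upwards [hmono, hlim, hmem.coeFn_toLp] with p h1 h2 h3
    rw [h3]
    exact ⟨h1, h2⟩
  · simp only [L2.inner_def]
    refine tendsto_integral_of_dominated_convergence (fun p => ‖Y p‖ * ‖g p‖)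
      (fun k => (L2.integrable_inner g (u k)).1)
      ((Lp.memLp Y).norm.integrable_mul (Lp.memLp g).norm) (fun k => ?_) ?_
    · filter_upwards [hbd] with p hp
      refine (norm_inner_le_norm _ _).trans ?_
      rw [mul_comm]
      gcongr
      exact (hp k).trans (le_abs_self _)
    · filter_upwards [hlim, hmem.coeFn_toLp] with p h1 h2
      rw [h2]
      exact tendsto_const_nhds.inner h1

/-! ### Mosco convergence of obstacle sets -/

/-- The `v` with `Tr v ≤ ψ`, and with `F v ≤ 0` where `h > τ`. -/
def obstacleSet {X P Q : Type*} [NormedAddCommGroup X] [NormedSpace ℝ X] [MeasurableSpace P]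
    [MeasurableSpace Q] {m : Measure P} {μ : Measure Q} (F : X →L[ℝ] Lp ℝ 2 m)
    (Tr : X →L[ℝ] Lp ℝ 2 μ) (h : P → ℝ) (τ : EReal) (ψ : Q → ℝ) : Set X :=
  {v | (∀ᵐ x ∂μ, Tr v x ≤ ψ x) ∧ ∀ᵐ p ∂m, τ < (h p : EReal) → F v p ≤ 0}

section ObstacleSet

variable {X P Q : Type*} [NormedAddCommGroup X] [NormedSpace ℝ X] [MeasurableSpace P]
    [MeasurableSpace Q] {m : Measure P} {μ : Measure Q} (F : X →L[ℝ] Lp ℝ 2 m)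
    (Tr : X →L[ℝ] Lp ℝ 2 μ) (h : P → ℝ)

theorem obstacleSet_eq (τ : EReal) (ψ : Q → ℝ) : obstacleSet F Tr h τ ψ =
    Tr ⁻¹' {g : Lp ℝ 2 μ | ∀ᵐ x ∂μ, x ∈ univ → g x ≤ ψ x} ∩
      F ⁻¹' {g : Lp ℝ 2 m | ∀ᵐ p ∂m, p ∈ {p | τ < (h p : EReal)} → g p ≤ (fun _ => 0) p} := by
  ext v
  simp [obstacleSet]

theorem isClosed_obstacleSet (τ : EReal) (ψ : Q → ℝ) : IsClosed (obstacleSet F Tr h τ ψ) := by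
  rw [obstacleSet_eq]
  exact ((isClosed_setOf_ae_le _ _).preimage Tr.continuous).inter
    ((isClosed_setOf_ae_le _ _).preimage F.continuous)

theorem convex_obstacleSet (τ : EReal) (ψ : Q → ℝ) : Convex ℝ (obstacleSet F Tr h τ ψ) := by
  rw [obstacleSet_eq]
  exact ((convex_setOf_ae_le _ _).linear_preimage Tr.toLinearMap).inter
    ((convex_setOf_ae_le _ _).linear_preimage F.toLinearMap)

theorem smul_mem_obstacleSet {τ : EReal} {ψ ψ' : Q → ℝ} {v : X} (hv : v ∈ obstacleSet F Tr h τ ψ)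
    {a : ℝ} (ha : 0 ≤ a) (hψ : ∀ᵐ x ∂μ, a * ψ x ≤ ψ' x) : a • v ∈ obstacleSet F Tr h τ ψ' := by
  constructor
  · rw [map_smul]
    filter_upwards [hv.1, hψ, Lp.coeFn_smul a (Tr v)] with x h1 h2 h3
    rw [h3]
    exact (mul_le_mul_of_nonneg_left h1 ha).trans h2
  · rw [map_smul]
    filter_upwards [hv.2, Lp.coeFn_smul a (F v)] with p h1 h2 h3
    rw [h2]
    exact mul_nonpos_of_nonneg_of_nonpos ha (h1 h3)

theorem nonempty_obstacleSet (τ : EReal) {ψ : Q → ℝ} (hψ : ∀ᵐ x ∂μ, 0 ≤ ψ x) :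
    (obstacleSet F Tr h τ ψ).Nonempty := by
  refine ⟨0, ?_, ?_⟩
  · rw [map_zero]
    filter_upwards [hψ, Lp.coeFn_zero ℝ 2 μ] with x h1 h2
    rw [h2]
    exact h1
  · rw [map_zero]
    filter_upwards [Lp.coeFn_zero ℝ 2 m] with x h2 _
    rw [h2]
    rfl

/-- The abstract core. The operators `T k` adjust the truncation, scaling adjusts the obstacle, and
the constraints pass to weak limits by convexity. The lower bound `ν` converts the additive error `ε
k` into a multiplicative one, which a scalar can remove. -/
theorem moscoConverges_obstacleSet {τ : ℕ → EReal} {τ' : EReal}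
    (hτ : Tendsto τ atTop (𝓝 τ')) {ψ : ℕ → Q → ℝ} {ψ' : Q → ℝ} {ν : ℝ} (hν : 0 < ν)
    (hψν : ∀ k, ∀ᵐ x ∂μ, ν ≤ ψ k x) (hψν' : ∀ᵐ x ∂μ, ν ≤ ψ' x)
    (hψ : ∀ k, ∀ᵐ x ∂μ, ψ k x ≤ ψ' x) {ε : ℕ → ℝ} (hε0 : ∀ k, 0 ≤ ε k)
    (hε : Tendsto ε atTop (𝓝 0)) (hψε : ∀ k, ∀ᵐ x ∂μ, ψ' x ≤ ψ k x + ε k)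
    {T : ℕ → X → X} (hT : ∀ v, Tendsto (fun k => T k v) atTop (𝓝 v))
    (hmem : ∀ k v, v ∈ obstacleSet F Tr h τ' ψ' → T k v ∈ obstacleSet F Tr h (τ k) ψ') :
    MoscoConverges (fun k => obstacleSet F Tr h (τ k) (ψ k)) (obstacleSet F Tr h τ' ψ') where
  admissible k := ⟨nonempty_obstacleSet F Tr h _ ((hψν k).mono fun _ hx => hν.le.trans hx),
    isClosed_obstacleSet F Tr h _ _, convex_obstacleSet F Tr h _ _⟩
  admissible_limit := ⟨nonempty_obstacleSet F Tr h _ (hψν'.mono fun _ hx => hν.le.trans hx),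
    isClosed_obstacleSet F Tr h _ _, convex_obstacleSet F Tr h _ _⟩
  recovery v hv := by
    have hpos : ∀ k, 0 < 1 + ε k / ν := fun k => by
      have := div_nonneg (hε0 k) hν.le
      linarith
    -- Since `ν ≤ ψ k`, one has `ψ' ≤ ψ k + ε k ≤ (1 + ε k / ν) ψ k`; the scalar tends to `1`.
    refine ⟨fun k => (1 + ε k / ν)⁻¹ • T k v, fun k => ?_, ?_⟩
    · refine smul_mem_obstacleSet F Tr h (hmem k v hv) (inv_nonneg.2 (hpos k).le) ?_
      filter_upwards [hψν k, hψε k] with x h1 h2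
      rw [inv_mul_le_iff₀ (hpos k)]
      refine h2.trans ?_
      have : ε k ≤ ε k / ν * ψ k x := by
        rw [div_mul_eq_mul_div, le_div_iff₀ hν]
        exact mul_le_mul_of_nonneg_left h1 (hε0 k)
      linarith
    · have h1 : Tendsto (fun k => (1 + ε k / ν)⁻¹) atTop (𝓝 1) := by
        have := ((hε.div_const ν).const_add 1).inv₀ (by simp)
        simpa using this
      simpa using h1.smul (hT v)
  weak_limit x v hx := by
    rintro ⟨σ, hσ, hw⟩
    constructor
    · have h1 := hw.mem_of_isClosed
        (K := Tr ⁻¹' {g : Lp ℝ 2 μ | ∀ᵐ x ∂μ, x ∈ univ → g x ≤ ψ' x})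
        ((convex_setOf_ae_le _ _).linear_preimage Tr.toLinearMap)
        ((isClosed_setOf_ae_le _ _).preimage Tr.continuous)
        (Eventually.of_forall fun k => by
          change ∀ᵐ q ∂μ, q ∈ univ → Tr (x (σ k)) q ≤ ψ' q
          filter_upwards [(hx (σ k)).1, hψ (σ k)] with q h1 h2 _
          exact h1.trans h2)
      filter_upwards [h1] with q hq
      exact hq trivial
    -- The heights `τ (σ k)` are eventually below any fixed `r > τ'`, which gives a fixed closed
    -- convex constraint above `r`. Countably many rational `r` then exhaust the region `h > τ'`.
    · have h1 : ∀ r : ℚ, τ' < ((r : ℝ) : EReal) →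
          ∀ᵐ p ∂m, ((r : ℝ) : EReal) < (h p : EReal) → F v p ≤ 0 := by
        intro r hr
        exact hw.mem_of_isClosed
          (K := F ⁻¹' {g : Lp ℝ 2 m | ∀ᵐ p ∂m, p ∈ {p | ((r : ℝ) : EReal) < (h p : EReal)} →
            g p ≤ (fun _ => 0) p})
          ((convex_setOf_ae_le _ _).linear_preimage F.toLinearMap)
          ((isClosed_setOf_ae_le _ _).preimage F.continuous) (by
            filter_upwards [(hτ.comp hσ.tendsto_atTop).eventually_lt_const hr] with k hk
            change ∀ᵐ p ∂m, p ∈ {p | ((r : ℝ) : EReal) < (h p : EReal)} → F (x (σ k)) p ≤ 0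
            filter_upwards [(hx (σ k)).2] with p hp hrp
            exact hp (lt_trans hk hrp))
      have h2 : ∀ᵐ p ∂m, ∀ r : ℚ, τ' < ((r : ℝ) : EReal) →
          ((r : ℝ) : EReal) < (h p : EReal) → F v p ≤ 0 := by
        rw [ae_all_iff]
        intro r
        by_cases hr : τ' < ((r : ℝ) : EReal)
        · filter_upwards [h1 r hr] with p hp _
          exact hp
        · exact Eventually.of_forall fun p h' => absurd h' hr
      filter_upwards [h2] with p hp hlt
      obtain ⟨r, hr1, hr2⟩ := EReal.lt_iff_exists_rat_btwn.1 hlt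
      exact hp r hr1 hr2

end ObstacleSet

/-! ### Cutting off and stretching in the extended direction -/

/-- Scaling of `y^α dy` under `y ↦ r y`. -/
theorem lintegral_powerMeasure_comp_mul (α : ℝ) {r : ℝ} (hr : 0 < r) {f : ℝ → ℝ≥0∞}
    (hf : Measurable f) :
    ∫⁻ y, f (r * y) ∂powerMeasure α =
      ENNReal.ofReal (r ^ (-(1 + α))) * ∫⁻ y, f y ∂powerMeasure α := by
  have hm : Measurable fun y : ℝ => r * y := measurable_const_mul r
  have hg : Measurable ((Ioi (0 : ℝ)).indicator fun z => ENNReal.ofReal (z ^ α) * f z) :=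
    ((measurable_ofReal_rpow α).mul hf).indicator measurableSet_Ioi
  rw [lintegral_powerMeasure α (f := fun y => f (r * y)) (hf.comp hm), lintegral_powerMeasure α hf,
    ← lintegral_indicator measurableSet_Ioi, ← lintegral_indicator measurableSet_Ioi]
  have e : ∀ y : ℝ, (Ioi (0 : ℝ)).indicator (fun y => ENNReal.ofReal (y ^ α) * f (r * y)) y =
      ENNReal.ofReal (r ^ (-α)) *
        (Ioi (0 : ℝ)).indicator (fun z => ENNReal.ofReal (z ^ α) * f z) (r * y) := by
    intro y
    by_cases hy : 0 < y
    · rw [indicator_of_mem (mem_Ioi.2 hy), indicator_of_mem (mem_Ioi.2 (mul_pos hr hy)),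
        ← mul_assoc, ← ENNReal.ofReal_mul (by positivity), Real.mul_rpow hr.le hy.le, ← mul_assoc,
        ← Real.rpow_add hr, neg_add_cancel, Real.rpow_zero, one_mul]
    · have hy' : ¬ 0 < r * y := fun h => hy (pos_of_mul_pos_right h hr.le)
      rw [indicator_of_notMem (s := Ioi (0 : ℝ)) hy, indicator_of_notMem (s := Ioi (0 : ℝ)) hy',
        mul_zero]
  change ∫⁻ y, (Ioi (0 : ℝ)).indicator (fun y => ENNReal.ofReal (y ^ α) * f (r * y)) y = _
  simp_rw [e]
  rw [lintegral_const_mul' _ _ ENNReal.ofReal_ne_top, ← lintegral_map hg hm, Real.map_volume_mul_left hr.ne',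
    lintegral_smul_measure, abs_of_pos (inv_pos.2 hr), smul_eq_mul, ← mul_assoc,
    ← ENNReal.ofReal_mul (by positivity)]
  congr 2
  rw [neg_add, Real.rpow_add hr, Real.rpow_neg_one, mul_comm]

theorem measurable_stretch {n : ℕ} (r : ℝ) :
    Measurable fun p : Eucl n × ℝ => (p.1, r * p.2) :=
  measurable_fst.prodMk (measurable_snd.const_mul r)

theorem lintegral_cylMeasure_stretch {n : ℕ} (Ω : Set (Eucl n)) (α : ℝ) {r : ℝ} (hr : 0 < r)
    {f : Eucl n × ℝ → ℝ≥0∞} (hf : Measurable f) :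
    ∫⁻ p, f (p.1, r * p.2) ∂cylMeasure Ω α =
      ENNReal.ofReal (r ^ (-(1 + α))) * ∫⁻ p, f p ∂cylMeasure Ω α := by
  rw [lintegral_cylMeasure Ω α (f := fun p => f (p.1, r * p.2)) (hf.comp (measurable_stretch r)),
    lintegral_cylMeasure Ω α hf,
    ← lintegral_const_mul _ hf.lintegral_prod_right']
  refine lintegral_congr fun x => ?_
  exact lintegral_powerMeasure_comp_mul α hr (hf.comp measurable_prodMk_left)

/-- Null sets pull back to null sets by the scaling formula, so almost everywhere statements can be
composed with the stretching. -/
theorem quasiMeasurePreserving_stretch {n : ℕ} (Ω : Set (Eucl n)) (α : ℝ) {r : ℝ} (hr : 0 < r) :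
    Measure.QuasiMeasurePreserving (fun p : Eucl n × ℝ => (p.1, r * p.2)) (cylMeasure Ω α)
      (cylMeasure Ω α) := by
  refine ⟨measurable_stretch r, Measure.AbsolutelyContinuous.mk fun s hs h0 => ?_⟩
  have h := lintegral_cylMeasure_stretch Ω α hr (f := s.indicator 1) (measurable_one.indicator hs)
  rw [lintegral_indicator_one hs, h0, mul_zero] at h
  rw [Measure.map_apply (measurable_stretch r) hs,
    ← lintegral_indicator_one ((measurable_stretch r) hs), ← h]
  rfl

/-- The function `ζ(y) φ(x, r y)`. -/
def stretchFun {n : ℕ} (ζ : ℝ → ℝ) (r : ℝ) (φ : Eucl n × ℝ → ℝ) (p : Eucl n × ℝ) : ℝ :=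
  ζ p.2 * φ (p.1, r * p.2)

theorem stretchFun_mem {n : ℕ} {Ω : Set (Eucl n)} {ζ : ℝ → ℝ} (hζ : ContDiff ℝ ∞ ζ) {r : ℝ}
    (hr : r ≠ 0) (φ : TestFn Ω) : stretchFun ζ r φ.1 ∈ TestFn Ω := by
  let D : Eucl n × ℝ ≃ₜ Eucl n × ℝ := (Homeomorph.refl _).prodCongr (Homeomorph.mulLeft₀ r hr)
  have hcs : HasCompactSupport (φ.1 ∘ D) := φ.2.2.1.comp_homeomorph D
  refine ⟨?_, hcs.mul_left (f := fun p : Eucl n × ℝ => ζ p.2), ?_⟩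
  · exact (hζ.comp contDiff_snd).mul
      (φ.2.1.comp (contDiff_fst.prodMk (contDiff_const.mul contDiff_snd)))
  · refine (tsupport_mul_subset_right (f := fun p : Eucl n × ℝ => ζ p.2) (g := φ.1 ∘ D)).trans ?_
    rw [tsupport_comp_eq_preimage]
    intro p hp
    exact ⟨(φ.2.2.2 hp).1, trivial⟩

/-- The operator `φ ↦ ζ(y) φ(x, r y)` on smooth functions. -/
noncomputable def stretch {n : ℕ} (Ω : Set (Eucl n)) {ζ : ℝ → ℝ} (hζ : ContDiff ℝ ∞ ζ) {r : ℝ}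
    (hr : r ≠ 0) : TestFn Ω →ₗ[ℝ] TestFn Ω where
  toFun φ := ⟨stretchFun ζ r φ.1, stretchFun_mem hζ hr φ⟩
  map_add' φ ψ := by
    ext p
    exact mul_add _ _ _
  map_smul' a φ := by
    ext p
    exact mul_left_comm _ _ _

theorem fderiv_stretchFun {n : ℕ} {ζ : ℝ → ℝ} (hζ : ContDiff ℝ ∞ ζ) (r : ℝ)
    {φ : Eucl n × ℝ → ℝ} (hφ : ContDiff ℝ ∞ φ) (p : Eucl n × ℝ) (v : Eucl n) (t : ℝ) :
    fderiv ℝ (stretchFun ζ r φ) p (v, t) =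
      ζ p.2 * fderiv ℝ φ (p.1, r * p.2) (v, r * t) + φ (p.1, r * p.2) * (deriv ζ p.2 * t) := by
  have h1 : HasFDerivAt (fun p : Eucl n × ℝ => (p.1, r * p.2))
      ((ContinuousLinearMap.fst ℝ (Eucl n) ℝ).prod (r • ContinuousLinearMap.snd ℝ (Eucl n) ℝ)) p :=
    hasFDerivAt_fst.prodMk (hasFDerivAt_snd.const_mul r)
  have h2 := (hφ.differentiable (by simp) (p.1, r * p.2)).hasFDerivAt.comp p h1
  have h3 : HasFDerivAt (fun p : Eucl n × ℝ => ζ p.2)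
      (deriv ζ p.2 • ContinuousLinearMap.snd ℝ (Eucl n) ℝ) p :=
    (hζ.differentiable (by simp) p.2).hasDerivAt.comp_hasFDerivAt p hasFDerivAt_snd
  have h4 : HasFDerivAt (stretchFun ζ r φ) _ p := h3.mul h2
  rw [h4.fderiv]
  simp

theorem inner_gradX {n : ℕ} (φ : Eucl n × ℝ → ℝ) (p : Eucl n × ℝ) (v : Eucl n) :
    inner ℝ (gradX φ p) v = fderiv ℝ φ p (v, 0) := by
  simpa using inner_gradX_add_dY φ p v 0

theorem gradX_stretchFun {n : ℕ} {ζ : ℝ → ℝ} (hζ : ContDiff ℝ ∞ ζ) (r : ℝ)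
    {φ : Eucl n × ℝ → ℝ} (hφ : ContDiff ℝ ∞ φ) (p : Eucl n × ℝ) :
    gradX (stretchFun ζ r φ) p = ζ p.2 • gradX φ (p.1, r * p.2) := by
  refine ext_inner_right ℝ fun v => ?_
  rw [inner_gradX, fderiv_stretchFun hζ r hφ, real_inner_smul_left, inner_gradX]
  simp

theorem dY_stretchFun {n : ℕ} {ζ : ℝ → ℝ} (hζ : ContDiff ℝ ∞ ζ) (r : ℝ)
    {φ : Eucl n × ℝ → ℝ} (hφ : ContDiff ℝ ∞ φ) (p : Eucl n × ℝ) :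
    dY (stretchFun ζ r φ) p =
      ζ p.2 * (r * dY φ (p.1, r * p.2)) + φ (p.1, r * p.2) * deriv ζ p.2 := by
  rw [dY, fderiv_stretchFun hζ r hφ, dY, ← smul_eq_mul (a := r) (b := fderiv ℝ _ _ _), ← map_smul]
  simp

theorem gradX_sub {n : ℕ} {φ ψ : Eucl n × ℝ → ℝ} (hφ : ContDiff ℝ ∞ φ) (hψ : ContDiff ℝ ∞ ψ)
    (p : Eucl n × ℝ) : gradX (φ - ψ) p = gradX φ p - gradX ψ p := by
  refine ext_inner_right ℝ fun v => ?_
  rw [inner_sub_left, inner_gradX, inner_gradX, inner_gradX,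
    fderiv_sub (hφ.differentiable (by simp) p) (hψ.differentiable (by simp) p)]
  rfl

theorem dY_sub {n : ℕ} {φ ψ : Eucl n × ℝ → ℝ} (hφ : ContDiff ℝ ∞ φ) (hψ : ContDiff ℝ ∞ ψ)
    (p : Eucl n × ℝ) : dY (φ - ψ) p = dY φ p - dY ψ p := by
  rw [dY, fderiv_sub (hφ.differentiable (by simp) p) (hψ.differentiable (by simp) p)]
  rfl

/-- The density `|φ|² + |∇φ|²`. -/
noncomputable def energyDensity {n : ℕ} (φ : Eucl n × ℝ → ℝ) (p : Eucl n × ℝ) : ℝ :=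
  φ p ^ 2 + (‖gradX φ p‖ ^ 2 + dY φ p ^ 2)

theorem continuous_energyDensity {n : ℕ} {φ : Eucl n × ℝ → ℝ} (hφ : ContDiff ℝ ∞ φ) :
    Continuous (energyDensity φ) :=
  (hφ.continuous.pow 2).add (((continuous_gradX hφ).norm.pow 2).add ((continuous_dY hφ).pow 2))

theorem hasCompactSupport_energyDensity {n : ℕ} {φ : Eucl n × ℝ → ℝ} (hφ : HasCompactSupport φ) :
    HasCompactSupport (energyDensity φ) :=
  HasCompactSupport.add (hφ.comp_left (g := fun t : ℝ => t ^ 2) (by simp))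
    (HasCompactSupport.add
      ((hasCompactSupport_gradX hφ).comp_left (g := fun t : Eucl n => ‖t‖ ^ 2) (by simp))
      ((hasCompactSupport_dY hφ).comp_left (g := fun t : ℝ => t ^ 2) (by simp)))

theorem enorm_sq_smoothElt_eq_lintegral {n : ℕ} {Ω : Set (Eucl n)} (hΩ : IsOpen Ω) {α : ℝ}
    (hα : -1 < α) (φ : TestFn Ω) :
    ‖smoothElt hΩ hα φ‖ₑ ^ 2 = ∫⁻ p, ENNReal.ofReal (energyDensity φ.1 p) ∂cylMeasure Ω α := by
  have hm1 : Measurable fun p => ‖φ.1 p‖ₑ ^ 2 := φ.2.1.continuous.enorm.measurable.pow_const 2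
  have hm2 : Measurable fun p => ‖gradX φ.1 p‖ₑ ^ 2 :=
    (continuous_gradX φ.2.1).enorm.measurable.pow_const 2
  rw [enorm_sq_smoothElt, ← lintegral_add_left hm2, ← lintegral_add_left hm1]
  refine lintegral_congr fun p => ?_
  rw [energyDensity, ENNReal.ofReal_add (by positivity) (by positivity),
    ENNReal.ofReal_add (by positivity) (by positivity), enorm_sq_eq_ofReal, enorm_sq_eq_ofReal,
    enorm_sq_eq_ofReal, Real.norm_eq_abs, Real.norm_eq_abs, sq_abs, sq_abs]

theorem enorm_sq_smoothElt_sub {n : ℕ} {Ω : Set (Eucl n)} (hΩ : IsOpen Ω) {α : ℝ}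
    (hα : -1 < α) (φ ψ : TestFn Ω) :
    ‖smoothElt hΩ hα φ - smoothElt hΩ hα ψ‖ₑ ^ 2 =
      ∫⁻ p, ENNReal.ofReal (energyDensity (φ.1 - ψ.1) p) ∂cylMeasure Ω α := by
  rw [← map_sub]
  exact enorm_sq_smoothElt_eq_lintegral hΩ hα (φ - ψ)

theorem tendsto_of_enorm_sub_sq_tendsto_zero {E ι : Type*} [NormedAddCommGroup E] {l : Filter ι}
    {u : ι → E} {a : E} (h : Tendsto (fun k => ‖u k - a‖ₑ ^ 2) l (𝓝 0)) : Tendsto u l (𝓝 a) := by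
  rw [tendsto_iff_enorm_sub_tendsto_zero]
  have := (ENNReal.continuous_rpow_const (y := 1 / 2)).tendsto _ |>.comp h
  rw [ENNReal.zero_rpow_of_pos (by norm_num)] at this
  refine this.congr fun k => ?_
  change (‖u k - a‖ₑ ^ 2) ^ (1 / 2 : ℝ) = _
  rw [← ENNReal.rpow_natCast, ← ENNReal.rpow_mul]
  norm_num

theorem energyDensity_sub_le {n : ℕ} {φ ψ : Eucl n × ℝ → ℝ} (hφ : ContDiff ℝ ∞ φ)
    (hψ : ContDiff ℝ ∞ ψ) (p : Eucl n × ℝ) :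
    energyDensity (φ - ψ) p ≤ 2 * energyDensity φ p + 2 * energyDensity ψ p := by
  rw [energyDensity, gradX_sub hφ hψ, dY_sub hφ hψ, Pi.sub_apply, energyDensity, energyDensity]
  have h1 : ‖gradX φ p - gradX ψ p‖ ^ 2 ≤ 2 * ‖gradX φ p‖ ^ 2 + 2 * ‖gradX ψ p‖ ^ 2 := by
    have := norm_sub_le (gradX φ p) (gradX ψ p)
    nlinarith [norm_nonneg (gradX φ p - gradX ψ p), sq_nonneg (‖gradX φ p‖ - ‖gradX ψ p‖)]
  nlinarith [sq_nonneg (φ p + ψ p), sq_nonneg (dY φ p + dY ψ p)]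

/-- The `y`-derivative is `ζ r ∂_y φ + ζ' φ`, whose square is at most `2R² (∂_y φ)² + 2K² φ²`; the
remaining terms cost a factor `1`. -/
theorem energyDensity_stretchFun_le {n : ℕ} {ζ : ℝ → ℝ} (hζ : ContDiff ℝ ∞ ζ) {r R K : ℝ}
    (hr : 1 ≤ r) (hrR : r ≤ R) (hζ1 : ∀ y, |ζ y| ≤ 1) (hζK : ∀ y, |deriv ζ y| ≤ K)
    {φ : Eucl n × ℝ → ℝ} (hφ : ContDiff ℝ ∞ φ) (p : Eucl n × ℝ) :
    energyDensity (stretchFun ζ r φ) p ≤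
      (1 + 2 * R ^ 2 + 2 * K ^ 2) * energyDensity φ (p.1, r * p.2) := by
  rw [energyDensity, gradX_stretchFun hζ r hφ, dY_stretchFun hζ r hφ, stretchFun, energyDensity,
    norm_smul, Real.norm_eq_abs]
  set a := φ (p.1, r * p.2)
  set g := ‖gradX φ (p.1, r * p.2)‖
  set d := dY φ (p.1, r * p.2)
  have z1 : ζ p.2 ^ 2 ≤ 1 := (sq_le_one_iff_abs_le_one _).2 (hζ1 _)
  have z2 : deriv ζ p.2 ^ 2 ≤ K ^ 2 := sq_le_sq' (abs_le.1 (hζK p.2)).1 (abs_le.1 (hζK p.2)).2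
  have z3 : r ^ 2 ≤ R ^ 2 := by gcongr
  have e1 : (ζ p.2 * a) ^ 2 ≤ a ^ 2 := by
    rw [mul_pow]
    exact mul_le_of_le_one_left (sq_nonneg _) z1
  have e2 : (|ζ p.2| * g) ^ 2 ≤ g ^ 2 := by
    rw [mul_pow, sq_abs]
    exact mul_le_of_le_one_left (sq_nonneg _) z1
  have e3 : (ζ p.2 * (r * d)) ^ 2 ≤ R ^ 2 * d ^ 2 := by
    rw [mul_pow, mul_pow]
    refine (mul_le_of_le_one_left (by positivity) z1).trans ?_
    gcongr
  have e4 : (a * deriv ζ p.2) ^ 2 ≤ K ^ 2 * a ^ 2 := by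
    rw [mul_pow, mul_comm]
    gcongr
  have e5 : (ζ p.2 * (r * d) + a * deriv ζ p.2) ^ 2 ≤
      2 * (ζ p.2 * (r * d)) ^ 2 + 2 * (a * deriv ζ p.2) ^ 2 := by
    nlinarith [sq_nonneg (ζ p.2 * (r * d) - a * deriv ζ p.2)]
  have p1 : 0 ≤ R ^ 2 * a ^ 2 := by positivity
  have p2 : 0 ≤ R ^ 2 * g ^ 2 := by positivity
  have p3 : 0 ≤ K ^ 2 * g ^ 2 := by positivity
  have p4 : 0 ≤ K ^ 2 * d ^ 2 := by positivity
  nlinarith [sq_nonneg a, sq_nonneg g, sq_nonneg d]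

/-- Operators `φ ↦ ζₖ(y) φ(x, rₖ y)` that approximate the identity. -/
structure IsApproxStretch (ζ : ℕ → ℝ → ℝ) (r : ℕ → ℝ) (R K : ℝ) : Prop where
  smooth : ∀ k, ContDiff ℝ ∞ (ζ k)
  abs_le_one : ∀ k y, |ζ k y| ≤ 1
  zero : ∀ k, ζ k 0 = 1
  deriv_le : ∀ k y, |deriv (ζ k) y| ≤ K
  one_le : ∀ k, 1 ≤ r k
  le : ∀ k, r k ≤ R
  tendsto_one : ∀ y, Tendsto (fun k => ζ k y) atTop (𝓝 1)
  tendsto_deriv : ∀ y, Tendsto (fun k => deriv (ζ k) y) atTop (𝓝 0)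
  tendsto_r : Tendsto r atTop (𝓝 1)

namespace IsApproxStretch

variable {ζ : ℕ → ℝ → ℝ} {r : ℕ → ℝ} {R K : ℝ}

theorem pos (h : IsApproxStretch ζ r R K) (k : ℕ) : 0 < r k := zero_lt_one.trans_le (h.one_le k)

/-- The change of variables contributes `r^{-(1+α)}`, which is at most `1` because `r ≥ 1` and `α >
-1`; the bound is thus uniform in `k`. -/
theorem norm_smoothElt_le (h : IsApproxStretch ζ r R K) {n : ℕ} {Ω : Set (Eucl n)} (hΩ : IsOpen Ω)
    {α : ℝ} (hα : -1 < α) (k : ℕ) (φ : TestFn Ω) :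
    ‖smoothElt hΩ hα (stretch Ω (h.smooth k) (h.pos k).ne' φ)‖ ≤
      √(1 + 2 * R ^ 2 + 2 * K ^ 2) * ‖smoothElt hΩ hα φ‖ := by
  refine norm_le_of_enorm_sq_le (by positivity) ?_
  rw [enorm_sq_smoothElt_eq_lintegral, enorm_sq_smoothElt_eq_lintegral]
  have hm : Measurable fun p => ENNReal.ofReal (energyDensity φ.1 p) :=
    (continuous_energyDensity φ.2.1).measurable.ennreal_ofReal
  calc ∫⁻ p, ENNReal.ofReal (energyDensity (stretchFun (ζ k) (r k) φ.1) p) ∂cylMeasure Ω α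
      ≤ ∫⁻ p, ENNReal.ofReal (1 + 2 * R ^ 2 + 2 * K ^ 2) *
          ENNReal.ofReal (energyDensity φ.1 (p.1, r k * p.2)) ∂cylMeasure Ω α := by
        refine lintegral_mono fun p => ?_
        rw [← ENNReal.ofReal_mul (by positivity)]
        exact ENNReal.ofReal_le_ofReal (energyDensity_stretchFun_le (h.smooth k) (h.one_le k)
          (h.le k) (h.abs_le_one k) (h.deriv_le k) φ.2.1 p)
    _ = ENNReal.ofReal (1 + 2 * R ^ 2 + 2 * K ^ 2) * (ENNReal.ofReal (r k ^ (-(1 + α))) *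
          ∫⁻ p, ENNReal.ofReal (energyDensity φ.1 p) ∂cylMeasure Ω α) := by
        rw [lintegral_const_mul' _ _ ENNReal.ofReal_ne_top,
          lintegral_cylMeasure_stretch Ω α (h.pos k) hm]
    _ ≤ _ := by
        gcongr
        refine mul_le_of_le_one_left zero_le ?_
        rw [ENNReal.ofReal_le_one]
        exact Real.rpow_le_one_of_one_le_of_nonpos (h.one_le k) (by linarith)

theorem tendsto_energyDensity (h : IsApproxStretch ζ r R K) {n : ℕ} {φ : Eucl n × ℝ → ℝ}
    (hφ : ContDiff ℝ ∞ φ) (hs : ∀ k, ContDiff ℝ ∞ (stretchFun (ζ k) (r k) φ)) (p : Eucl n × ℝ) :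
    Tendsto (fun k => energyDensity (stretchFun (ζ k) (r k) φ - φ) p) atTop (𝓝 0) := by
  have hD : Tendsto (fun k => (p.1, r k * p.2)) atTop (𝓝 p) := by
    have := (tendsto_const_nhds (x := p.1)).prodMk_nhds (h.tendsto_r.mul_const p.2)
    simpa using this
  have h1 := (hφ.continuous.tendsto p).comp hD
  have h2 := ((continuous_gradX hφ).tendsto p).comp hD
  have h3 := ((continuous_dY hφ).tendsto p).comp hD
  have z := h.tendsto_one p.2
  have t1 := ((z.mul h1).sub_const (φ p)).pow 2
  have t2 := ((z.smul h2).sub_const (gradX φ p)).norm.pow 2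
  have t3 := (((z.mul (h.tendsto_r.mul h3)).add (h1.mul (h.tendsto_deriv p.2))).sub_const
    (dY φ p)).pow 2
  have t := t1.add (t2.add t3)
  simp only [one_mul, one_smul, mul_zero, add_zero, sub_self, norm_zero, ne_eq, OfNat.ofNat_ne_zero,
    not_false_eq_true, zero_pow] at t
  refine t.congr fun k => ?_
  rw [energyDensity, gradX_sub (hs k) hφ, dY_sub (hs k) hφ, gradX_stretchFun (h.smooth k) _ hφ,
    dY_stretchFun (h.smooth k) _ hφ]
  rfl

/-- Dominated convergence: the energy density of the difference tends to `0` pointwise and is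
bounded by a constant on one fixed ball. -/
theorem tendsto_smoothElt (h : IsApproxStretch ζ r R K) {n : ℕ} {Ω : Set (Eucl n)} (hΩ : IsOpen Ω)
    {α : ℝ} (hα : -1 < α) (φ : TestFn Ω) :
    Tendsto (fun k => smoothElt hΩ hα (stretch Ω (h.smooth k) (h.pos k).ne' φ)) atTop
      (𝓝 (smoothElt hΩ hα φ)) := by
  have := isLocallyFiniteMeasure_cylMeasure Ω hα
  have hs : ∀ k, ContDiff ℝ ∞ (stretchFun (ζ k) (r k) φ.1) := fun k =>
    (stretchFun_mem (h.smooth k) (h.pos k).ne' φ).1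
  have hcs := hasCompactSupport_energyDensity φ.2.2.1
  obtain ⟨B, hB⟩ := hcs.exists_bound_of_continuous (continuous_energyDensity φ.2.1)
  obtain ⟨ρ, hρ⟩ := hcs.isCompact.isBounded.subset_closedBall 0
  have hB' : ∀ p, energyDensity φ.1 p ≤ B := fun p => (le_abs_self _).trans (hB p)
  have h0 : ∀ p : Eucl n × ℝ, p ∉ Metric.closedBall (0 : Eucl n × ℝ) ρ →
      energyDensity φ.1 p = 0 := fun p hp =>
    image_eq_zero_of_notMem_tsupport fun hq => hp (hρ hq)
  -- As `r k ≥ 1`, the stretched function has its support in the same ball as `φ`.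
  have hD : ∀ k (p : Eucl n × ℝ), p ∉ Metric.closedBall (0 : Eucl n × ℝ) ρ →
      ((p.1, r k * p.2) : Eucl n × ℝ) ∉ Metric.closedBall (0 : Eucl n × ℝ) ρ := by
    intro k p hp hq
    rw [mem_closedBall_zero_iff, Prod.norm_def, max_le_iff] at hp hq
    refine hp ⟨hq.1, le_trans ?_ hq.2⟩
    rw [norm_mul, Real.norm_of_nonneg (h.pos k).le]
    exact le_mul_of_one_le_left (norm_nonneg _) (h.one_le k)
  set C := 1 + 2 * R ^ 2 + 2 * K ^ 2
  have hC : 0 ≤ C := by positivity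
  have hbd : ∀ k p, ENNReal.ofReal (energyDensity (stretchFun (ζ k) (r k) φ.1 - φ.1) p) ≤
      (Metric.closedBall (0 : Eucl n × ℝ) ρ).indicator
        (fun _ => ENNReal.ofReal (2 * (C * B) + 2 * B)) p := by
    intro k p
    have e1 := energyDensity_sub_le (hs k) φ.2.1 p
    have e2 := energyDensity_stretchFun_le (h.smooth k) (h.one_le k) (h.le k) (h.abs_le_one k)
      (h.deriv_le k) φ.2.1 p
    by_cases hp : p ∈ Metric.closedBall (0 : Eucl n × ℝ) ρ
    · rw [indicator_of_mem hp]
      refine ENNReal.ofReal_le_ofReal ?_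
      have e3 := mul_le_mul_of_nonneg_left (hB' (p.1, r k * p.2)) hC
      linarith [hB' p]
    · rw [indicator_of_notMem hp, h0 p hp] at *
      rw [h0 _ (hD k p hp)] at e2
      rw [nonpos_iff_eq_zero, ENNReal.ofReal_eq_zero]
      linarith
  have hlim : Tendsto (fun k => ∫⁻ p, ENNReal.ofReal
      (energyDensity (stretchFun (ζ k) (r k) φ.1 - φ.1) p) ∂cylMeasure Ω α) atTop (𝓝 0) := by
    have := tendsto_lintegral_of_dominated_convergence (μ := cylMeasure Ω α)
      (F := fun k p => ENNReal.ofReal (energyDensity (stretchFun (ζ k) (r k) φ.1 - φ.1) p))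
      (f := fun _ => 0) _
      (fun k => (continuous_energyDensity ((hs k).sub φ.2.1)).measurable.ennreal_ofReal)
      (fun k => Eventually.of_forall (hbd k)) (by
        rw [lintegral_indicator_const Metric.isClosed_closedBall.measurableSet]
        exact ENNReal.mul_ne_top ENNReal.ofReal_ne_top
          (isCompact_closedBall _ _).measure_lt_top.ne)
      (Eventually.of_forall fun p => by
        simpa using ENNReal.tendsto_ofReal (h.tendsto_energyDensity φ.2.1 hs p))
    simpa using this
  exact tendsto_of_enorm_sub_sq_tendsto_zero
    (hlim.congr fun k => (enorm_sq_smoothElt_sub hΩ hα _ φ).symm)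

end IsApproxStretch

/-! ### The approximating operators on `H¹_L(y^α, C)` -/

namespace IsApproxStretch

variable {ζ : ℕ → ℝ → ℝ} {r : ℕ → ℝ} {R K : ℝ}

/-- Stretching fixes `y = 0`, and the cut-off equals `1` there. -/
theorem smoothTrace_stretch (h : IsApproxStretch ζ r R K) {n : ℕ} {Ω : Set (Eucl n)} (k : ℕ)
    (φ : TestFn Ω) :
    smoothTrace Ω (stretch Ω (h.smooth k) (h.pos k).ne' φ) = smoothTrace Ω φ := by
  refine Lp.ext ?_
  filter_upwards [smoothTrace_ae φ, smoothTrace_ae (stretch Ω (h.smooth k) (h.pos k).ne' φ)]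
    with x h1 h2
  rw [h1, h2]
  change ζ k 0 * φ.1 (x, r k * 0) = _
  rw [h.zero, one_mul, mul_zero]

theorem trOp_eq (h : IsApproxStretch ζ r R K) {n : ℕ} {Ω : Set (Eucl n)} (hΩ : IsOpen Ω) {s α : ℝ}
    (hs : FracExponent s α) {k : ℕ} {T : HL Ω α →L[ℝ] HL Ω α}
    (hT : ∀ φ, T (smoothElt hΩ hs.neg_one_lt φ) =
      smoothElt hΩ hs.neg_one_lt (stretch Ω (h.smooth k) (h.pos k).ne' φ)) (v : HL Ω α) :
    trOp hΩ hs (T v) = trOp hΩ hs v := by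
  have h1 : Continuous fun v => trOp hΩ hs (T v) := (trOp hΩ hs).continuous.comp T.continuous
  refine congrFun ((denseRange_smoothElt hΩ hs.neg_one_lt).equalizer h1
    (trOp hΩ hs).continuous ?_) v
  funext φ
  change trOp hΩ hs (T (smoothElt hΩ hs.neg_one_lt φ)) = trOp hΩ hs (smoothElt hΩ hs.neg_one_lt φ)
  rw [hT, trOp_smoothElt, trOp_smoothElt, h.smoothTrace_stretch]

/-- The formula is clear for smooth functions; it survives the limit along a subsequence converging
almost everywhere, since stretching respects null sets. -/
theorem fst_ae (h : IsApproxStretch ζ r R K) {n : ℕ} {Ω : Set (Eucl n)} (hΩ : IsOpen Ω) {α : ℝ}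
    (hα : -1 < α) {k : ℕ} {T : HL Ω α →L[ℝ] HL Ω α}
    (hT : ∀ φ, T (smoothElt hΩ hα φ) =
      smoothElt hΩ hα (stretch Ω (h.smooth k) (h.pos k).ne' φ)) (v : HL Ω α) :
    ∀ᵐ p ∂cylMeasure Ω α, cylFun (T v) p = ζ k p.2 * cylFun v (p.1, r k * p.2) := by
  obtain ⟨φ, h1, h2⟩ := exists_smooth_seq_tendsto_ae hΩ hα v
  have h3 : Tendsto (fun j => (T (smoothElt hΩ hα (φ j))).1.1.fst) atTop (𝓝 (T v).1.1.fst) :=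
    (continuous_fst_HL.tendsto (T v)).comp ((T.continuous.tendsto v).comp h1)
  obtain ⟨σ, hσ, h4⟩ := exists_subseq_tendsto_ae h3
  have h5 : ∀ᵐ p ∂cylMeasure Ω α, ∀ j, (T (smoothElt hΩ hα (φ j))).1.1.fst p =
      ζ k p.2 * (φ j).1 (p.1, r k * p.2) := by
    rw [ae_all_iff]
    intro j
    rw [hT]
    exact fst_smoothElt_ae hΩ hα (stretch Ω (h.smooth k) (h.pos k).ne' (φ j))
  have h6 := (quasiMeasurePreserving_stretch Ω α (h.pos k)).ae ((ae_cylMeasure_iff hΩ α).2 h2)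
  filter_upwards [h4, h5, h6] with p e4 e5 e6
  refine tendsto_nhds_unique e4 ?_
  refine (((e6.comp hσ.tendsto_atTop).const_mul (ζ k p.2))).congr fun j => ?_
  exact (e5 (σ j)).symm

theorem exists_operators (h : IsApproxStretch ζ r R K) {n : ℕ} {Ω : Set (Eucl n)} (hΩ : IsOpen Ω)
    {s α : ℝ} (hs : FracExponent s α) :
    ∃ T : ℕ → HL Ω α → HL Ω α, (∀ v, Tendsto (fun k => T k v) atTop (𝓝 v)) ∧
      (∀ k v, trOp hΩ hs (T k v) = trOp hΩ hs v) ∧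
      ∀ k v, ∀ᵐ p ∂cylMeasure Ω α, cylFun (T k v) p = ζ k p.2 * cylFun v (p.1, r k * p.2) := by
  have hc := completeSpace_HL hΩ hs.neg_one_lt
  obtain ⟨T, hT, hlim⟩ := @exists_clm_extension_tendsto_id (TestFn Ω) (HL Ω α) inferInstance
    inferInstance inferInstance inferInstance hc _ (denseRange_smoothElt hΩ hs.neg_one_lt)
    (fun k => stretch Ω (h.smooth k) (h.pos k).ne') _
    (fun k φ => h.norm_smoothElt_le hΩ hs.neg_one_lt k φ)
    (fun φ => h.tendsto_smoothElt hΩ hs.neg_one_lt φ)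
  exact ⟨fun k v => T k v, hlim, fun k v => h.trOp_eq hΩ hs (hT k) v,
    fun k v => h.fst_ae hΩ hs.neg_one_lt (hT k) v⟩

end IsApproxStretch

theorem isApproxStretch_one {r : ℕ → ℝ} {R : ℝ} (h1 : ∀ k, 1 ≤ r k) (hR : ∀ k, r k ≤ R)
    (hr : Tendsto r atTop (𝓝 1)) : IsApproxStretch (fun _ _ => 1) r R 0 where
  smooth _ := contDiff_const
  abs_le_one _ _ := by simp
  zero _ := rfl
  deriv_le _ _ := by simp
  one_le := h1
  le := hR
  tendsto_one _ := tendsto_const_nhds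
  tendsto_deriv _ := by simp
  tendsto_r := hr

theorem exists_abs_deriv_smoothTransition_le :
    ∃ B, 0 ≤ B ∧ ∀ y, |deriv Real.smoothTransition y| ≤ B := by
  have hc : Continuous (deriv Real.smoothTransition) :=
    (Real.smoothTransition.contDiff (n := 1)).continuous_deriv le_rfl
  have hs : HasCompactSupport (deriv Real.smoothTransition) := by
    refine HasCompactSupport.intro (isCompact_Icc (a := (0 : ℝ)) (b := 1)) fun y hy => ?_
    rcases lt_or_ge y 0 with h | h
    · have : Real.smoothTransition =ᶠ[𝓝 y] fun _ => 0 := by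
        filter_upwards [Iio_mem_nhds h] with z hz
        exact Real.smoothTransition.zero_of_nonpos (le_of_lt hz)
      rw [this.deriv_eq, deriv_const]
    · have h1 : 1 < y := by
        by_contra h'
        exact hy ⟨h, not_lt.1 h'⟩
      have : Real.smoothTransition =ᶠ[𝓝 y] fun _ => 1 := by
        filter_upwards [Ioi_mem_nhds h1] with z hz
        exact Real.smoothTransition.one_of_one_le (le_of_lt hz)
      rw [this.deriv_eq, deriv_const]
  obtain ⟨B, hB⟩ := hs.exists_bound_of_continuous hc
  exact ⟨B, (norm_nonneg _).trans (hB 0), hB⟩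

/-- A smooth cut-off, equal to `1` at `0` and vanishing for `y ≥ τ`. -/
noncomputable def heightCutoff (τ y : ℝ) : ℝ := Real.smoothTransition (2 - 2 / τ * y)

theorem heightCutoff_eq_zero {τ y : ℝ} (hτ : 0 < τ) (hy : τ ≤ y) : heightCutoff τ y = 0 := by
  refine Real.smoothTransition.zero_of_nonpos ?_
  have : 2 / τ * τ ≤ 2 / τ * y := by gcongr
  rw [div_mul_cancel₀ _ hτ.ne'] at this
  linarith

theorem deriv_heightCutoff (τ y : ℝ) :
    deriv (heightCutoff τ) y = deriv Real.smoothTransition (2 - 2 / τ * y) * (-(2 / τ)) := by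
  have h1 : HasDerivAt (fun y : ℝ => 2 - 2 / τ * y) (-(2 / τ)) y := by
    simpa using ((hasDerivAt_id y).const_mul (2 / τ)).const_sub 2
  have h2 := ((Real.smoothTransition.contDiff (n := 1)).differentiable (by simp)
    (2 - 2 / τ * y)).hasDerivAt
  exact (h2.comp y h1).deriv

/-- The case of infinite limiting height. The cut-off has slope of order `1/τ k`, which tends to
`0`, so multiplication by it approximates the identity in the energy norm. -/
theorem exists_isApproxStretch_heightCutoff {τ : ℕ → ℝ} (hτ0 : ∀ k, 0 < τ k)
    (hτ : Tendsto τ atTop atTop) :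
    ∃ K, IsApproxStretch (fun k => heightCutoff (τ k)) (fun _ => 1) 1 K := by
  obtain ⟨B, hB0, hB⟩ := exists_abs_deriv_smoothTransition_le
  have hinv : Tendsto (fun k => 2 / τ k) atTop (𝓝 0) := hτ.const_div_atTop 2
  obtain ⟨M, hM⟩ := hinv.bddAbove_range
  have hd : ∀ k y, |deriv (heightCutoff (τ k)) y| ≤ B * (2 / τ k) := by
    intro k y
    have := hτ0 k
    rw [deriv_heightCutoff, abs_mul, abs_neg, abs_of_pos (a := 2 / τ k) (by positivity)]
    gcongr
    exact hB _
  refine ⟨B * M, ?_, ?_, ?_, ?_, fun _ => le_rfl, fun _ => le_rfl, ?_, ?_, tendsto_const_nhds⟩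
  · intro k
    exact Real.smoothTransition.contDiff.comp (contDiff_const.sub (contDiff_const.mul contDiff_id))
  · intro k y
    rw [heightCutoff, abs_of_nonneg (Real.smoothTransition.nonneg _)]
    exact Real.smoothTransition.le_one _
  · intro k
    exact Real.smoothTransition.one_of_one_le (by norm_num)
  · intro k y
    refine (hd k y).trans ?_
    gcongr
    exact hM ⟨k, rfl⟩
  · intro y
    have h1 : Tendsto (fun k => 2 - 2 / τ k * y) atTop (𝓝 2) := by
      simpa using (hinv.mul_const y).const_sub 2
    refine tendsto_const_nhds.congr' ?_
    filter_upwards [h1.eventually_const_le one_lt_two] with k hk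
    exact (Real.smoothTransition.one_of_one_le hk).symm
  · intro y
    refine squeeze_zero_norm (fun k => hd k y) ?_
    simpa using hinv.const_mul B

theorem exists_isApproxStretch {τ : ℕ → ℝ} (hτ : ∀ k, 0 < τ k) {τ' : EReal} (hτ' : 0 < τ')
    (hlim : Tendsto (fun k => (τ k : EReal)) atTop (𝓝 τ')) :
    ∃ (ζ : ℕ → ℝ → ℝ) (r : ℕ → ℝ) (R K : ℝ), IsApproxStretch ζ r R K ∧
      ∀ k y, τ k < y → ζ k y = 0 ∨ (ζ k y = 1 ∧ τ' < ((r k * y : ℝ) : EReal)) := by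
  induction τ' with
  | bot => exact absurd hτ' (by simp)
  | top =>
    obtain ⟨K, h⟩ := exists_isApproxStretch_heightCutoff hτ (EReal.tendsto_coe_nhds_top_iff.1 hlim)
    exact ⟨_, _, _, K, h, fun k y hy => Or.inl (heightCutoff_eq_zero (hτ k) hy.le)⟩
  | coe t =>
    have ht : 0 < t := EReal.coe_pos.1 hτ'
    have hl : Tendsto τ atTop (𝓝 t) := EReal.tendsto_coe.1 hlim
    -- For finite height a cut-off at `τ k` would not tend to `1` above `t`; instead the function is
    -- compressed, so that `y > τ k` is sent to `r y > t`. The maximum with `1` leaves it unchanged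
    -- when `τ k ≥ t`, where nothing has to be corrected.
    have hr : Tendsto (fun k => max 1 (t / τ k)) atTop (𝓝 1) := by
      have := (tendsto_const_nhds (x := (1 : ℝ))).max
        ((tendsto_const_nhds (x := t)).div hl ht.ne')
      rwa [div_self ht.ne', max_self] at this
    obtain ⟨R, hR⟩ := hr.bddAbove_range
    refine ⟨_, _, R, 0, isApproxStretch_one (fun k => le_max_left 1 (t / τ k))
      (fun k => hR ⟨k, rfl⟩) hr, fun k y hy => Or.inr ⟨rfl, EReal.coe_lt_coe_iff.2 ?_⟩⟩
    have := hτ k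
    have hy0 : 0 < y := this.trans hy
    calc t = t / τ k * τ k := by field_simp
      _ < t / τ k * y := by gcongr
      _ ≤ max 1 (t / τ k) * y := by
        gcongr
        exact le_max_right _ _

theorem cylFun_nonpos_of_stretch {n : ℕ} {Ω : Set (Eucl n)} {α : ℝ} {ζ : ℝ → ℝ} {r τ : ℝ}
    {τ' : EReal} (hr : 0 < r)
    (hζ : ∀ y, τ < y → ζ y = 0 ∨ (ζ y = 1 ∧ τ' < ((r * y : ℝ) : EReal)))
    {f g : Eucl n × ℝ → ℝ} (hg : ∀ᵐ p ∂cylMeasure Ω α, g p = ζ p.2 * f (p.1, r * p.2))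
    (hf : ∀ᵐ p ∂cylMeasure Ω α, τ' < (p.2 : EReal) → f p ≤ 0) :
    ∀ᵐ p ∂cylMeasure Ω α, (τ : EReal) < (p.2 : EReal) → g p ≤ 0 := by
  filter_upwards [hg, (quasiMeasurePreserving_stretch Ω α hr).ae hf] with p hp hq hlt
  rw [hp]
  rcases hζ p.2 (EReal.coe_lt_coe_iff.1 hlt) with h0 | ⟨h1, h2⟩
  · rw [h0, zero_mul]
  · rw [h1, one_mul]
    exact hq h2

set_option maxHeartbeats 1000000 in
theorem exists_recovery_operators {n : ℕ} {Ω : Set (Eucl n)} (hΩ : IsOpen Ω) {s α : ℝ}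
    (hs : FracExponent s α) {τ : ℕ → ℝ} (hτ : ∀ k, 0 < τ k) {τ' : EReal} (hτ' : 0 < τ')
    (hlim : Tendsto (fun k => (τ k : EReal)) atTop (𝓝 τ')) :
    ∃ T : ℕ → HL Ω α → HL Ω α, (∀ v, Tendsto (fun k => T k v) atTop (𝓝 v)) ∧
      (∀ k v, trOp hΩ hs (T k v) = trOp hΩ hs v) ∧
      ∀ k v, (∀ᵐ p ∂cylMeasure Ω α, τ' < (p.2 : EReal) → cylFun v p ≤ 0) →
        ∀ᵐ p ∂cylMeasure Ω α, (τ k : EReal) < (p.2 : EReal) → cylFun (T k v) p ≤ 0 := by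
  obtain ⟨ζ, r, R, K, h, hζ⟩ := exists_isApproxStretch hτ hτ' hlim
  obtain ⟨T, h1, h2, h3⟩ := h.exists_operators hΩ hs
  exact ⟨T, h1, h2, fun k v hv => cylFun_nonpos_of_stretch (f := cylFun v)
    (g := cylFun (T k v)) (h.pos k) (hζ k) (h3 k v) hv⟩

/-! ### The limit of a monotone sequence -/

/-- The function component, as a continuous linear map. -/
noncomputable def cylFunCLM {n : ℕ} (Ω : Set (Eucl n)) (α : ℝ) :
    HL Ω α →L[ℝ] Lp ℝ 2 (cylMeasure Ω α) where
  toFun w := w.1.1.fst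
  map_add' _ _ := rfl
  map_smul' _ _ := rfl
  cont := continuous_fst_HL

theorem injective_cylFunCLM {n : ℕ} {Ω : Set (Eucl n)} (hΩ : IsOpen Ω) (α : ℝ) :
    Function.Injective (cylFunCLM Ω α) := fun _ _ h =>
  Subtype.ext (H1Weighted.ext_fst hΩ h)

theorem parallelogram_withLp {E F G : Type*} [NormedAddCommGroup E] [InnerProductSpace ℝ E]
    [NormedAddCommGroup F] [InnerProductSpace ℝ F] [NormedAddCommGroup G] [InnerProductSpace ℝ G]
    (x y : WithLp 2 (E × WithLp 2 (F × G))) :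
    ‖x + y‖ * ‖x + y‖ + ‖x - y‖ * ‖x - y‖ = 2 * (‖x‖ * ‖x‖ + ‖y‖ * ‖y‖) := by
  simpa only [sq] using parallelogram_law_with_norm ℝ x y

theorem parallelogram_HL {n : ℕ} {Ω : Set (Eucl n)} {α : ℝ} (x y : HL Ω α) :
    ‖x + y‖ * ‖x + y‖ + ‖x - y‖ * ‖x - y‖ = 2 * (‖x‖ * ‖x‖ + ‖y‖ * ‖y‖) :=
  parallelogram_withLp x.1.1 y.1.1

/-- Monotone convergence yields a limit in the weighted `L²` space only. Boundedness in `HL` and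
injectivity of the function component lift it to a weak limit in `HL`. -/
theorem exists_monotone_limit_HL {n : ℕ} {Ω : Set (Eucl n)} (hΩ : IsOpen Ω) {α : ℝ} (hα : -1 < α)
    (v : ℕ → HL Ω α) {M : ℝ} (hM : ∀ k, ‖v k‖ ≤ M) (Y : HL Ω α)
    (hv : ∀ k, ∀ᵐ p ∂volume.restrict (openCylinder Ω),
      0 ≤ cylFun (v k) p ∧ cylFun (v k) p ≤ cylFun (v (k + 1)) p ∧
        cylFun (v (k + 1)) p ≤ cylFun Y p) :
    ∃ v' : HL Ω α, WeaklyConverges v v' ∧ ∀ᵐ p ∂volume.restrict (openCylinder Ω),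
      Monotone (fun k => cylFun (v k) p) ∧
        Tendsto (fun k => cylFun (v k) p) atTop (𝓝 (cylFun v' p)) := by
  have hc := completeSpace_HL hΩ hα
  obtain ⟨f, h1, h2⟩ := exists_monotone_limit_L2 (u := fun k => cylFunCLM Ω α (v k))
    (Y := cylFunCLM Ω α Y) fun k => (ae_cylMeasure_iff hΩ α).2 (hv k)
  obtain ⟨v', hw, rfl⟩ := @exists_weak_limit (HL Ω α) (Lp ℝ 2 (cylMeasure Ω α)) inferInstance
    inferInstance hc parallelogram_HL inferInstance inferInstance inferInstance (cylFunCLM Ω α)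
    (injective_cylFunCLM hΩ α) v M hM f h2
  exact ⟨v', hw, (ae_cylMeasure_iff hΩ α).1 h1⟩

/-- The images have a monotone limit, which is also a weak limit in `L²`; continuous operators
preserve weak convergence, so it must be the image of `v'`. -/
theorem WeaklyConverges.monotone_limit {X Q : Type*} [NormedAddCommGroup X] [NormedSpace ℝ X]
    [MeasurableSpace Q] {μ : Measure Q} {v : ℕ → X} {v' : X} (hw : WeaklyConverges v v')
    (Tr : X →L[ℝ] Lp ℝ 2 μ) {Y : Lp ℝ 2 μ}
    (h : ∀ k, ∀ᵐ x ∂μ, 0 ≤ Tr (v k) x ∧ Tr (v k) x ≤ Tr (v (k + 1)) x ∧ Tr (v (k + 1)) x ≤ Y x) :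
    ∀ᵐ x ∂μ, Monotone (fun k => Tr (v k) x) ∧
      Tendsto (fun k => Tr (v k) x) atTop (𝓝 (Tr v' x)) := by
  obtain ⟨f, h1, h2⟩ := exists_monotone_limit_L2 (u := fun k => Tr (v k)) h
  have : f = Tr v' := ext_inner_left ℝ fun g =>
    tendsto_nhds_unique (h2 g) (hw ((innerSL ℝ g).comp Tr))
  rwa [this] at h1

/-- Dominated convergence: everything lies between `0` and `M` on a set of finite measure. This is
where the boundedness of the trace of the upper barrier enters. -/
theorem convergesInLp_of_monotone {n : ℕ} {Ω : Set (Eucl n)} (hb : Bornology.IsBounded Ω)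
    {u : ℕ → L2 Ω} {u' : L2 Ω} {M : ℝ}
    (h0 : ∀ k, ∀ᵐ x ∂volume.restrict Ω, 0 ≤ u k x)
    (h : ∀ᵐ x ∂volume.restrict Ω, Monotone (fun k => u k x) ∧
      Tendsto (fun k => u k x) atTop (𝓝 (u' x)))
    (hM : ∀ᵐ x ∂volume.restrict Ω, u' x ≤ M) {p : ℝ≥0∞} (hp : 1 < p) (hp' : p < ⊤) :
    ConvergesInLp Ω p (fun k => u k) u' := by
  have : IsFiniteMeasure (volume.restrict Ω) := ⟨by simpa using hb.measure_lt_top⟩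
  have hle : ∀ᵐ x ∂volume.restrict Ω, ∀ k, 0 ≤ u k x ∧ u k x ≤ u' x := by
    filter_upwards [ae_all_iff.2 h0, h] with x h1 h2 k
    exact ⟨h1 k, h2.1.ge_of_tendsto h2.2 k⟩
  have hp0 : p ≠ 0 := (zero_lt_one.trans hp).ne'
  have hpos : 0 < p.toReal := ENNReal.toReal_pos hp0 hp'.ne
  refine ⟨fun k => MemLp.of_bound (Lp.aestronglyMeasurable _) M ?_,
    MemLp.of_bound (Lp.aestronglyMeasurable _) M ?_, ?_⟩
  · filter_upwards [hle, hM] with x h1 h2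
    rw [Real.norm_of_nonneg (h1 k).1]
    exact (h1 k).2.trans h2
  · filter_upwards [hle, hM] with x h1 h2
    rw [Real.norm_of_nonneg ((h1 0).1.trans (h1 0).2)]
    exact h2
  · have key : Tendsto (fun k => ∫⁻ x in Ω, ‖u k x - u' x‖ₑ ^ p.toReal) atTop (𝓝 0) := by
      have := tendsto_lintegral_of_dominated_convergence' (μ := volume.restrict Ω)
        (F := fun k x => ‖u k x - u' x‖ₑ ^ p.toReal) (f := fun _ => 0)
        (fun _ => ENNReal.ofReal M ^ p.toReal)
        (fun k => (((Lp.aestronglyMeasurable (u k)).sub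
          (Lp.aestronglyMeasurable u')).enorm).pow_const _)
        (fun k => by
          filter_upwards [hle, hM] with x h1 h2
          gcongr
          rw [← ofReal_norm, norm_sub_rev, Real.norm_of_nonneg (sub_nonneg.2 (h1 k).2)]
          exact ENNReal.ofReal_le_ofReal (by linarith [(h1 k).1]))
        (by
          rw [lintegral_const]
          exact ENNReal.mul_ne_top (ENNReal.rpow_ne_top_of_nonneg hpos.le ENNReal.ofReal_ne_top)
            (measure_ne_top _ _))
        (by
          filter_upwards [h] with x hx
          have h1 := (hx.2.sub_const (u' x)).enorm
          rw [sub_self, enorm_zero] at h1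
          have h2 := (ENNReal.continuous_rpow_const (y := p.toReal)).tendsto _ |>.comp h1
          rwa [ENNReal.zero_rpow_of_pos hpos] at h2)
      simpa using this
    have h2 := (ENNReal.continuous_rpow_const (y := 1 / p.toReal)).tendsto _ |>.comp key
    rw [ENNReal.zero_rpow_of_pos (by positivity)] at h2
    refine h2.congr fun k => ?_
    rw [eLpNorm_eq_lintegral_rpow_enorm_toReal hp0 hp'.ne]
    rfl

theorem ConvergesInLp.exists_bound {n : ℕ} {Ω : Set (Eucl n)} {ψ : ℕ → Eucl n → ℝ}
    {ψ' : Eucl n → ℝ} (h : ConvergesInLp Ω ⊤ ψ ψ') :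
    ∃ ε : ℕ → ℝ, (∀ k, 0 ≤ ε k) ∧ Tendsto ε atTop (𝓝 0) ∧
      ∀ k, ∀ᵐ x ∂volume.restrict Ω, ψ' x ≤ ψ k x + ε k := by
  refine ⟨fun k => (eLpNorm (fun x => ψ k x - ψ' x) ⊤ (volume.restrict Ω)).toReal,
    fun k => ENNReal.toReal_nonneg, ?_, fun k => ?_⟩
  · have := (ENNReal.tendsto_toReal ENNReal.zero_ne_top).comp h.2.2
    rwa [ENNReal.toReal_zero] at this
  · filter_upwards [enorm_ae_le_eLpNormEssSup (fun x => ψ k x - ψ' x) (volume.restrict Ω)] with x hx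
    rw [← eLpNorm_exponent_top] at hx
    -- Membership in `L^∞` makes the norm of the difference finite, so its real value is not the
    -- default `0` of `ENNReal.toReal`.
    have h1 := ENNReal.toReal_mono ((h.1 k).sub h.2.1).2.ne hx
    rw [toReal_enorm, Real.norm_eq_abs] at h1
    have h2 := (abs_le.1 h1).1
    change -(eLpNorm (fun x => ψ k x - ψ' x) ⊤ (volume.restrict Ω)).toReal ≤ _ at h2
    linarith

theorem mem_truncConstraintSet_iff {n : ℕ} {Ω : Set (Eucl n)} (hΩ : IsOpen Ω) {s α : ℝ}
    (hs : FracExponent s α) (Ψ : L2 Ω → (Eucl n →ₘ[volume.restrict Ω] ℝ)) (τ : EReal)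
    (w v : HL Ω α) :
    v ∈ truncConstraintSet Ψ τ w ↔
      (∀ᵐ x ∂volume.restrict Ω, trOp hΩ hs v x ≤ Ψ (trOp hΩ hs w) x) ∧
        ∀ᵐ p ∂cylMeasure Ω α, τ < (p.2 : EReal) → cylFun v p ≤ 0 := by
  rw [ae_cylMeasure_iff hΩ, ← tr_eq_trOp hΩ hs v, ← tr_eq_trOp hΩ hs w]
  rfl

set_option maxHeartbeats 1000000 in
theorem truncConstraintSet_eq_obstacleSet {n : ℕ} {Ω : Set (Eucl n)} (hΩ : IsOpen Ω) {s α : ℝ}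
    (hs : FracExponent s α) (Ψ : L2 Ω → (Eucl n →ₘ[volume.restrict Ω] ℝ)) (τ : EReal)
    (w : HL Ω α) :
    truncConstraintSet Ψ τ w =
      @obstacleSet (HL Ω α) _ _ inferInstance inferInstance inferInstance inferInstance _ _
        (cylFunCLM Ω α) (trOp hΩ hs) Prod.snd τ (Ψ (trOp hΩ hs w)) :=
  Set.ext fun v => mem_truncConstraintSet_iff hΩ hs Ψ τ w v

theorem trOp_monotone_limit {n : ℕ} {Ω : Set (Eucl n)} (hΩ : IsOpen Ω) {s α : ℝ}
    (hs : FracExponent s α) {v : ℕ → HL Ω α} {v' Y : HL Ω α}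
    (hv : ∀ k, ∀ᵐ p ∂volume.restrict (openCylinder Ω),
      0 ≤ cylFun (v k) p ∧ cylFun (v k) p ≤ cylFun (v (k + 1)) p ∧
        cylFun (v (k + 1)) p ≤ cylFun Y p) (hw : WeaklyConverges v v') :
    (∀ k, ∀ᵐ x ∂volume.restrict Ω, 0 ≤ trOp hΩ hs (v k) x) ∧
      (∀ᵐ x ∂volume.restrict Ω, Monotone (fun k => trOp hΩ hs (v k) x) ∧
        Tendsto (fun k => trOp hΩ hs (v k) x) atTop (𝓝 (trOp hΩ hs v' x))) ∧
      ∀ᵐ x ∂volume.restrict Ω, trOp hΩ hs v' x ≤ trOp hΩ hs Y x := by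
  have h0 : ∀ k, ∀ᵐ x ∂volume.restrict Ω, 0 ≤ trOp hΩ hs (v k) x := fun k =>
    trOp_nonneg hΩ hs ((hv k).mono fun p hp => hp.1)
  have h1 : ∀ k, ∀ᵐ x ∂volume.restrict Ω, trOp hΩ hs (v k) x ≤ trOp hΩ hs (v (k + 1)) x :=
    fun k => trOp_mono hΩ hs ((hv k).mono fun p hp => hp.2.1)
  have h2 : ∀ k, ∀ᵐ x ∂volume.restrict Ω, trOp hΩ hs (v (k + 1)) x ≤ trOp hΩ hs Y x :=
    fun k => trOp_mono hΩ hs ((hv k).mono fun p hp => hp.2.2)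
  have h3 := hw.monotone_limit (trOp hΩ hs) fun k => by
    filter_upwards [h0 k, h1 k, h2 k] with x a b c
    exact ⟨a, b, c⟩
  refine ⟨h0, h3, ?_⟩
  filter_upwards [h3, ae_all_iff.2 h2] with x a b
  -- The upper bound is assumed for the terms of index `k + 1`, hence the shift.
  exact le_of_tendsto' ((tendsto_add_atTop_iff_nat 1).2 a.2) b

set_option maxHeartbeats 1000000 in
theorem moscoConverges_truncConstraintSet {n : ℕ} {Ω : Set (Eucl n)} (hΩ : IsOpen Ω) {s α : ℝ}
    (hs : FracExponent s α) {Ψ : L2 Ω → (Eucl n →ₘ[volume.restrict Ω] ℝ)} {v : ℕ → HL Ω α}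
    {v' : HL Ω α} {τ : ℕ → EReal} {τ' : EReal} (hτ : Tendsto τ atTop (𝓝 τ')) {ν : ℝ} (hν : 0 < ν)
    (hψν : ∀ w : HL Ω α, ∀ᵐ x ∂volume.restrict Ω, ν ≤ Ψ (trOp hΩ hs w) x)
    (hψ : ∀ k, ∀ᵐ x ∂volume.restrict Ω, Ψ (trOp hΩ hs (v k)) x ≤ Ψ (trOp hΩ hs v') x)
    (hΨ : ConvergesInLp Ω ⊤ (fun k => Ψ (trOp hΩ hs (v k))) (Ψ (trOp hΩ hs v')))
    {T : ℕ → HL Ω α → HL Ω α} (hT : ∀ w, Tendsto (fun k => T k w) atTop (𝓝 w))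
    (htr : ∀ k w, trOp hΩ hs (T k w) = trOp hΩ hs w)
    (hneg : ∀ k w, (∀ᵐ p ∂cylMeasure Ω α, τ' < (p.2 : EReal) → cylFun w p ≤ 0) →
      ∀ᵐ p ∂cylMeasure Ω α, τ k < (p.2 : EReal) → cylFun (T k w) p ≤ 0) :
    MoscoConverges (fun k => truncConstraintSet Ψ (τ k) (v k)) (truncConstraintSet Ψ τ' v') := by
  obtain ⟨ε, hε0, hε, hψε⟩ := hΨ.exists_bound
  simp only [truncConstraintSet_eq_obstacleSet hΩ hs]
  exact @moscoConverges_obstacleSet (HL Ω α) _ _ inferInstance inferInstance inferInstance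
    inferInstance _ _ (cylFunCLM Ω α) (trOp hΩ hs) Prod.snd _ _ hτ _ _ ν hν
    (fun k => hψν (v k)) (hψν v') hψ ε hε0 hε hψε T hT fun k w hw =>
      ⟨by rw [htr]; exact hw.1, hneg k w hw.2⟩

set_option maxHeartbeats 1000000 in
theorem lemma4p2 {n : ℕ} (hn : 1 ≤ n) {Ω : Set (Eucl n)} (hΩ : IsLipschitzDomain Ω)
    {A : Eucl n → Matrix (Fin n) (Fin n) ℝ} {c : Eucl n → ℝ} (hAc : IsEllipticCoeff Ω A c)
    {s α : ℝ} (hs : 0 < s ∧ s < 1) (hα : α = 1 - 2 * s)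
    {Ψ : L2 Ω → (Eucl n →ₘ[volume.restrict Ω] ℝ)}
    (hΨ : IsObstacleMap Ω (fracSpace Ω A c s) Ψ)
    (v : ℕ → HL Ω α) (hbdd : ∃ M : ℝ, ∀ k, ‖v k‖ ≤ M)
    (Y : HL Ω α) (hY : MemLp (tr Y) ⊤ (volume.restrict Ω))
    (hv : ∀ k, ∀ᵐ p ∂volume.restrict (openCylinder Ω),
      0 ≤ cylFun (v k) p ∧ cylFun (v k) p ≤ cylFun (v (k + 1)) p ∧ cylFun (v (k + 1)) p ≤ cylFun Y p)
    (τ' : EReal) (hτ' : 0 < τ') (τ : ℕ → ℝ) (hτ : ∀ k, 0 < τ k)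
    (hlim : Tendsto (fun k => (τ k : EReal)) atTop (𝓝 τ')) :
    ∃ v' : HL Ω α,
      WeaklyConverges v v' ∧
      (∀ᵐ p ∂volume.restrict (openCylinder Ω),
        Monotone (fun k => cylFun (v k) p) ∧ Tendsto (fun k => cylFun (v k) p) atTop (𝓝 (cylFun v' p))) ∧
      MoscoConverges (fun k => truncConstraintSet Ψ τ' (v k)) (truncConstraintSet Ψ τ' v') ∧
      MoscoConverges (fun k => truncConstraintSet Ψ (τ k : EReal) (v k))
        (truncConstraintSet Ψ τ' v') := by
  have ho := hΩ.isOpen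
  have hb := hΩ.isBounded
  have hs' : FracExponent s α := ⟨hs.1, hs.2, hα⟩
  obtain ⟨M, hM⟩ := hbdd
  obtain ⟨v', hw, hmono⟩ := exists_monotone_limit_HL ho hs'.neg_one_lt v hM Y hv
  obtain ⟨t0, t1, t2⟩ := trOp_monotone_limit ho hs' hv hw
  have hD : ∀ w : HL Ω α, trOp ho hs' w ∈ fracSpace Ω A c s := trOp_mem_fracSpace ho hb hAc hs'
  rw [tr_eq_trOp ho hs'] at hY
  obtain ⟨B, hB⟩ := exists_ae_norm_le_of_memLp_top hY
  have hbd : ∀ᵐ x ∂volume.restrict Ω, trOp ho hs' v' x ≤ B := by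
    filter_upwards [t2, hB] with x h1 h2
    exact h1.trans ((le_abs_self _).trans h2)
  have hψ : ∀ k, ∀ᵐ x ∂volume.restrict Ω, Ψ (trOp ho hs' (v k)) x ≤ Ψ (trOp ho hs' v') x := by
    intro k
    have := hΨ.mono _ (hD (v k)) _ (hD v') (by
      filter_upwards [t0 k, t1] with x h1 h2
      exact ⟨h1, h2.1.ge_of_tendsto h2.2 k⟩)
    exact this.mono fun x hx => hx.2
  have hconv := hΨ.continuous (fun k => trOp ho hs' (v k)) (trOp ho hs' v') (fun k => hD (v k))
    (hD v') fun p hp hp' => convergesInLp_of_monotone hb t0 t1 hbd hp hp'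
  obtain ⟨ν, hν, hΨν⟩ := hΨ.lower_bound
  obtain ⟨T, hT, htr, hneg⟩ := exists_recovery_operators ho hs' hτ hτ' hlim
  refine ⟨v', hw, hmono, ?_, ?_⟩
  -- With a fixed truncation height only the obstacle varies, so the identity serves as recovery
  -- operator.
  · exact moscoConverges_truncConstraintSet ho hs' (τ := fun _ => τ') tendsto_const_nhds hν
      (fun w => hΨν _ (hD w)) hψ hconv (T := fun _ w => w) (fun _ => tendsto_const_nhds)
      (fun _ _ => rfl) fun _ _ h => h
  · exact moscoConverges_truncConstraintSet ho hs' hlim hν (fun w => hΨν _ (hD w)) hψ hconv hT htr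
      hneg
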